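/- Let $A=V/\Lambda$ be a principally polarized complex abelian variety of dimension $g$, i.e. $\Lambda$ is a lattice in a $g$-dimensional complex vector space $V$ and $E=\operatorname{Im}H$ is the imaginary part of a positive definite Hermitian form $H$ on $V$, with $E$ integral and unimodular on $\Lambda$. Then $\Lambda$ has a decomposition $\Lambda=\Lambda_+\oplus\Lambda_-$ into two $E$-isotropic sublattices. Fix any such decomposition, let $V_\pm$ be the real spans of $\Lambda_\pm$ and $T_\pm=V_\pm/\Lambda_\pm$. Then $A=T_+\times T_-$; let $\pi\colon A\to T_-$ be the projection (a Lagrangian fibration). Let $(L,\nabla)$ be the Hermitian line bundle with unitary connection on $A$ given by $L=(V\times\mathbb C)/\Lambda$, where $p+m$ (with $p\in\Lambda_+$, $m\in\Lambda_-$) acts by $(v,\zeta)\mapsto\bigl(v+p+m,\ e^{\pi iE(p,m)+\pi iE(v,p+m)}\zeta\bigr)$, and $\nabla=d+\pi i\,E(v,dv)$, of curvature $2\pi i E$; sections of $L^k$ are regarded as equivariant functions on $V$. There are bases $a$ of $\Lambda_+$ and $b$ of $\Lambda_-$ with $E(b_i,a_j)=\delta_{ij}$; for each such pair (an adapted basis)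 $b_j=\sum_i\Omega_{ij}a_i$ with $\Omega$ symmetric and $\operatorname{Im}\Omega>0$; write $v=\sum_i z_ia_i$ with $z_i\in\mathbb C$ and $y_j=E(v,a_j)$. Let $k\ge 1$, let $H^0(A,L^k)$ be the space of smooth sections of $L^k$ annihilated by $\nabla^{0,1}$ (the Kähler wave space), let $BS_k\subset T_-$ be the set of $t$ for which $L^k|_{\pi^{-1}(t)}$ has a nowhere vanishing covariantly constant section, and let $Q^k_\pi$ be the direct sum, over $t\in BS_k$, of the spaces of covariantly constant sections of $L^k|_{\pi^{-1}(t)}$ (the Bohr–Sommerfeld wave space). Then: 1. $BS_k=\{t\in T_-: kt=0\}$, it has $k^g$ elements, and each of the summands of $Q^k_\pi$ is a line. 2. There is a linear isomorphism $\Phi\colon Q^k_\pi\to H^0(A,L^k)$, inducing a bijection $\mathbb PQ^k_\pi\cong\mathbb PH^0(A,L^k)$, such that the following holds for every adapted basis. - (a) A section $e^{\pi ik\,y\cdot z}F(z)$ lies in $H^0(A,L^k)$ if and only if $F$ is holomorphic on $\mathbb C^g$, $F(z+e_j)=F(z)$ and $F(z+\Omega e_j)=e^{-2\pi ikz_j-\pi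 ik\Omega_{jj}}F(z)$ for all $j$. If $\Theta$ is the divisor of the Riemann theta function $\vartheta(z)=\sum_{n\in\mathbb Z^g}e^{\pi i\,n\cdot\Omega n+2\pi i\,n\cdot z}$, then multiplication by the $k$-th power of the section $e^{\pi i\,y\cdot z}\vartheta(z)$ of $L$ is an isomorphism $H^0(A,\mathcal O(k\Theta))\cong H^0(A,L^k)$. - (b) $BS_k$ is the set of the points $t_l$ represented by $\beta_l=-\frac1k\sum_jl_jb_j$, $l\in\mathbb Z^g$. - (c) For $l\in\mathbb Z^g$ let $\theta^{\mathbb R}_l=k^{-g}\sum_{m\in\{0,\dots,k-1\}^g}e^{2\pi i\,l\cdot m/k}\,\delta_{m/k}$, a distribution on $\mathbb R^g/\mathbb Z^g$. Its Fourier series is $\sum_{n\in\mathbb Z^g}e^{2\pi i(l+kn)\cdot x}$, and its coherent state transform $C_{1/k}$ is the theta function with characteristic $\theta_l(z,\Omega)=\sum_{n\in\mathbb Z^g}e^{\frac{\pi i}{k}(l+kn)\cdot\Omega(l+kn)+2\pi i(l+kn)\cdot z}$. Here, for a distribution $T=\sum_na_ne^{2\pi i\,n\cdot x}$, $C_t(T)(z)=\sum_na_n\,e^{\pi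 it\,n\cdot\Omega n}e^{2\pi i\,n\cdot z}$ is the analytic continuation of $e^{\frac t2\Delta}T$ with $\Delta=\sum_{i,j}\frac{-i\,\Omega_{ij}}{2\pi}\partial_i\partial_j$. Both series (for $\theta_l$ and for $C_{1/k}(\theta_l^{\mathbb R})$) converge absolutely for all $z$. - (d) Let $s$ be a covariantly constant section over $\pi^{-1}(t_l)$. Parallel transport along the segments from $x$ to $x+\beta_l$ turns $s$ into the function $f_s(x)=s(\beta_l+\sum_ix_ia_i)\,e^{-\pi ik\,E(\beta_l,\sum_ix_ia_i)}$ on $T_+$, and $f_s\cdot\theta^{\mathbb R}_0=s(\beta_l)\,\theta_l^{\mathbb R}$. The isomorphism $\Phi$ sends $s$ to the section $e^{\pi ik\,y\cdot z}\,C_{1/k}(f_s\cdot\theta^{\mathbb R}_0)(z)=s(\beta_l)\,e^{\pi ik\,y\cdot z}\,\theta_l(z,\Omega)$. -/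

import Mathlib

open scoped ContDiff Topology LinearAlgebra.Projectivization
open Complex Module

noncomputable section

/-! ### Principally polarized abelian varieties and their real polarizations -/

/-- A principally polarized complex abelian variety `V / Λ`: a lattice `Λ` in a finite dimensional
complex vector space `V` and a Riemann form `E` (the imaginary part of a positive definite
Hermitian form) which is integral and unimodular on `Λ`. The form `E` is the translation invariant
symplectic form of the torus `V / Λ`. -/
structure PPAV (V : Type*) [NormedAddCommGroup V] [NormedSpace ℂ V] [FiniteDimensional ℂ V] where
  /-- The lattice of periods. -/
  lattice : Submodule ℤ V
  discrete : DiscreteTopology lattice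
  span_lattice : Submodule.span ℝ (lattice : Set V) = ⊤
  /-- The Riemann form. -/
  E : LinearMap.BilinForm ℝ V
  alternating : ∀ v, E v v = 0
  invariant : ∀ v w, E (I • v) (I • w) = E v w
  positive : ∀ v, v ≠ 0 → 0 < E (I • v) v
  integral : ∀ u ∈ lattice, ∀ v ∈ lattice, ∃ n : ℤ, E u v = n
  unimodular : ∀ f : lattice →ₗ[ℤ] ℤ, ∃ u ∈ lattice, ∀ v : lattice, E u (v : V) = (f v : ℝ)

variable {V : Type*} [NormedAddCommGroup V] [NormedSpace ℂ V] [FiniteDimensional ℂ V]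

/-- A decomposition `Λ = Λ₊ ⊕ Λ₋` of the lattice into two isotropic sublattices. -/
structure LagrangianDecomposition (A : PPAV V) where
  plus : Submodule ℤ V
  minus : Submodule ℤ V
  sup_eq : plus ⊔ minus = A.lattice
  disjoint : Disjoint plus minus
  isotropic_plus : ∀ u ∈ plus, ∀ v ∈ plus, A.E u v = 0
  isotropic_minus : ∀ u ∈ minus, ∀ v ∈ minus, A.E u v = 0

namespace LagrangianDecomposition

variable {A : PPAV V} (D : LagrangianDecomposition A)

/-- The real subspace `V₊` spanned by `Λ₊`: the tangent space of the fibres. -/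
def Vplus : Submodule ℝ V := Submodule.span ℝ (D.plus : Set V)

/-- The real subspace `V₋` spanned by `Λ₋`. -/
def Vminus : Submodule ℝ V := Submodule.span ℝ (D.minus : Set V)

/-- The subtorus `T₊ = V₊ / Λ₊` of `V / Λ`. -/
def Tplus : Submodule ℤ (V ⧸ A.lattice) :=
  (D.Vplus.restrictScalars ℤ).map A.lattice.mkQ

/-- The subtorus `T₋ = V₋ / Λ₋` of `V / Λ`. -/
def Tminus : Submodule ℤ (V ⧸ A.lattice) :=
  (D.Vminus.restrictScalars ℤ).map A.lattice.mkQ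

/-- The fibre over `t ∈ T₋` of the projection `π : V / Λ = T₊ × T₋ → T₋`, that is, the coset
`t + T₊`. -/
def fibre (t : D.Tminus) : Set (V ⧸ A.lattice) := {x | x - (t : V ⧸ A.lattice) ∈ D.Tplus}

/-! ### The prequantization line bundle

`L` is the quotient of `V × ℂ` by the action `λ · (v, ζ) = (v + λ, α(λ) exp(π i E(v, λ)) ζ)` of `Λ`,
where `α(p + m) = exp(π i E(p, m))` for `p ∈ Λ₊`, `m ∈ Λ₋`. Hence a section of `L ^ k` over a subset
of `V / Λ` is an equivariant function on its preimage in `V`. The unitary connection of `L ^ k` is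
`d + k π i E(v, dv)`, of curvature `k (2 π i E)`. -/

/-- The function `s` on `V` is equivariant, that is, it is a section of `L ^ k`. -/
def IsSection (k : ℕ) (s : V → ℂ) : Prop :=
  ∀ v, ∀ p ∈ D.plus, ∀ m ∈ D.minus,
    s (v + (p + m)) = exp (Real.pi * I * k * ((A.E p m + A.E v (p + m) : ℝ) : ℂ)) * s v

end LagrangianDecomposition

/-- The connection form of `L ^ k` at `v`, applied to the tangent vector `w`. -/
def PPAV.connForm (A : PPAV V) (k : ℕ) (v w : V) : ℂ := Real.pi * I * k * (A.E v w : ℂ)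

/-- The covariant derivative `∇_w s` at `v` of a smooth section `s` of `L ^ k`. -/
def PPAV.covDeriv (A : PPAV V) (k : ℕ) (s : V → ℂ) (v w : V) : ℂ :=
  fderiv ℝ s v w + A.connForm k v w * s v

namespace LagrangianDecomposition

variable {A : PPAV V} (D : LagrangianDecomposition A)

/-- The space `H⁰(V / Λ, L ^ k)` of holomorphic sections of `L ^ k`: the smooth sections
annihilated by `∇^{0,1}`. -/
def kahlerSpace (k : ℕ) : Submodule ℂ (V → ℂ) where
  carrier := {s | ContDiff ℝ ∞ s ∧ D.IsSection k s ∧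
    ∀ v w, A.covDeriv k s v w + I * A.covDeriv k s v (I • w) = 0}
  zero_mem' := by
    refine ⟨contDiff_const, fun v p _ m _ => by simp, fun v w => ?_⟩
    have : fderiv ℝ (0 : V → ℂ) v = 0 := by simp
    simp [PPAV.covDeriv, this]
  add_mem' := by
    rintro s t ⟨hs, hs1, hs2⟩ ⟨ht, ht1, ht2⟩
    refine ⟨hs.add ht, fun v p hp m hm => ?_, fun v w => ?_⟩
    · simp only [Pi.add_apply, hs1 v p hp m hm, ht1 v p hp m hm]; ring
    · have h : fderiv ℝ (s + t) v = fderiv ℝ s v + fderiv ℝ t v :=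
        fderiv_add (hs.differentiable (by simp) v) (ht.differentiable (by simp) v)
      have h1 := hs2 v w
      have h2 := ht2 v w
      simp only [PPAV.covDeriv, h, add_apply, Pi.add_apply] at h1 h2 ⊢
      linear_combination h1 + h2
  smul_mem' := by
    rintro c s ⟨hs, hs1, hs2⟩
    refine ⟨contDiff_const.smul hs, fun v p hp m hm => ?_, fun v w => ?_⟩
    · simp only [Pi.smul_apply, smul_eq_mul, hs1 v p hp m hm]; ring
    · have h : fderiv ℝ (c • s) v = c • fderiv ℝ s v :=
        fderiv_const_smul (hs.differentiable (by simp) v) c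
      have h1 := hs2 v w
      simp only [PPAV.covDeriv, h, smul_apply, Pi.smul_apply,
        smul_eq_mul] at h1 ⊢
      linear_combination c * h1

/-- The space of covariantly constant sections of the restriction of `L ^ k` to the fibre over `t`
(as functions on `V` they are extended by `0` outside the preimage of the fibre). -/
def covConst (k : ℕ) (t : D.Tminus) : Submodule ℂ (V → ℂ) where
  carrier := {s | (∀ v, A.lattice.mkQ v ∉ D.fibre t → s v = 0) ∧ D.IsSection k s ∧
    ∀ v, A.lattice.mkQ v ∈ D.fibre t → ∀ w ∈ D.Vplus,
      HasLineDerivAt ℝ s (-(A.connForm k v w * s v)) v w}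
  zero_mem' := by
    refine ⟨fun _ _ => rfl, fun v p _ m _ => by simp, fun v _ w _ => ?_⟩
    simpa [HasLineDerivAt] using hasDerivAt_const (0 : ℝ) (0 : ℂ)
  add_mem' := by
    rintro s t ⟨hs, hs1, hs2⟩ ⟨ht, ht1, ht2⟩
    refine ⟨fun v hv => by simp [hs v hv, ht v hv], fun v p hp m hm => ?_, fun v hv w hw => ?_⟩
    · simp only [Pi.add_apply, hs1 v p hp m hm, ht1 v p hp m hm]; ring
    · have h : HasLineDerivAt ℝ (s + t) (-(A.connForm k v w * s v) + -(A.connForm k v w * t v))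
          v w := HasDerivAt.add (hs2 v hv w hw) (ht2 v hv w hw)
      rwa [← neg_add, ← mul_add] at h
  smul_mem' := by
    rintro c s ⟨hs, hs1, hs2⟩
    refine ⟨fun v hv => by simp [hs v hv], fun v p hp m hm => ?_, fun v hv w hw => ?_⟩
    · simp only [Pi.smul_apply, smul_eq_mul, hs1 v p hp m hm]; ring
    · have h : HasLineDerivAt ℝ (c • s) (c • -(A.connForm k v w * s v)) v w :=
        HasDerivAt.const_smul c (hs2 v hv w hw)
      rwa [smul_neg, ← mul_smul_comm] at h

/-- The set of Bohr-Sommerfeld fibres of level `k`: those `t` such that the restriction of `L ^ k`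
to the fibre over `t` has a nowhere vanishing covariantly constant section. -/
def bohrSommerfeld (k : ℕ) : Set D.Tminus :=
  {t | ∃ s ∈ D.covConst k t, ∀ v, A.lattice.mkQ v ∈ D.fibre t → s v ≠ 0}

/-- The Bohr-Sommerfeld wave space of level `k`: the direct sum of the lines of covariantly
constant sections over the Bohr-Sommerfeld fibres. -/
abbrev bsSpace (k : ℕ) : Type _ :=
  DirectSum (D.bohrSommerfeld k) fun t => D.covConst k (t : D.Tminus)

open Classical in
/-- The inclusion into the Bohr-Sommerfeld wave space of the line over the fibre `t`. -/
def bsIncl (k : ℕ) (t : D.bohrSommerfeld k) : D.covConst k (t : D.Tminus) →ₗ[ℂ] D.bsSpace k :=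
  DirectSum.lof ℂ (D.bohrSommerfeld k) (fun t => D.covConst k (t : D.Tminus)) t

/-- A symplectic basis of `Λ` adapted to the decomposition: a basis `a` of `Λ₊` and the dual basis
`b` of `Λ₋`. -/
structure AdaptedBasis where
  a : Fin (finrank ℂ V) → V
  b : Fin (finrank ℂ V) → V
  span_a : Submodule.span ℤ (Set.range a) = D.plus
  span_b : Submodule.span ℤ (Set.range b) = D.minus
  dual : ∀ i j, A.E (b i) (a j) = if i = j then 1 else 0

end LagrangianDecomposition

/-! ### Distributions on the torus and the coherent state transform -/

/-- Smooth functions on `U(1)^g = (ℝ / ℤ)^g`. -/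
def TorusTest (g : ℕ) : Submodule ℂ ((Fin g → ℝ) → ℂ) where
  carrier := {f | ContDiff ℝ ∞ f ∧ ∀ x (n : Fin g → ℤ), f (x + fun i => (n i : ℝ)) = f x}
  zero_mem' := ⟨contDiff_const, fun _ _ => rfl⟩
  add_mem' := by
    rintro f h ⟨hf, hf1⟩ ⟨hh, hh1⟩
    exact ⟨hf.add hh, fun x n => by simp only [Pi.add_apply, hf1, hh1]⟩
  smul_mem' := by
    rintro c f ⟨hf, hf1⟩
    exact ⟨contDiff_const.smul hf, fun x n => by simp only [Pi.smul_apply, hf1]⟩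

/-- A linear functional on smooth functions is a distribution if it is continuous for the
topology of uniform convergence of all derivatives. -/
def IsTorusDistribution {g : ℕ} (T : TorusTest g →ₗ[ℂ] ℂ) : Prop :=
  ∃ (N : ℕ) (C : ℝ), ∀ (f : TorusTest g) (M : ℝ),
    (∀ j ≤ N, ∀ x, ‖iteratedFDeriv ℝ j (f : (Fin g → ℝ) → ℂ) x‖ ≤ M) → ‖T f‖ ≤ C * M

/-- The character `exp(2 π i n · x)` of the torus. -/
def torusChar {g : ℕ} (n : Fin g → ℤ) : TorusTest g :=
  ⟨fun x => exp (2 * Real.pi * I * ∑ i, (n i : ℂ) * (x i : ℂ)), by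
    constructor
    · have h : ContDiff ℝ ∞ fun x : Fin g → ℝ =>
          2 * Real.pi * I * ∑ i, (n i : ℂ) * (x i : ℂ) :=
        contDiff_const.mul (ContDiff.sum fun i _ => contDiff_const.mul
          (Complex.ofRealCLM.contDiff.comp (contDiff_apply ℝ ℝ i)))
      exact h.cexp
    · intro x m
      rw [Complex.exp_eq_exp_iff_exists_int]
      refine ⟨∑ i, n i * m i, ?_⟩
      push_cast [Pi.add_apply, mul_add, Finset.sum_add_distrib]
      ring⟩

/-- The Fourier coefficient `a_n` of `T = ∑ a_n exp(2 π i n · x)`. -/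
def torusFourierCoeff {g : ℕ} (T : TorusTest g →ₗ[ℂ] ℂ) (n : Fin g → ℤ) : ℂ := T (torusChar (-n))

/-- The delta distribution at the point `p`. -/
def torusDelta {g : ℕ} (p : Fin g → ℝ) : TorusTest g →ₗ[ℂ] ℂ :=
  (LinearMap.proj p : ((Fin g → ℝ) → ℂ) →ₗ[ℂ] ℂ).comp (TorusTest g).subtype

/-- The product of a function `h` with the delta distribution of level `k` at the identity, which
is the average of the delta distributions at the points of order `k` of the torus. -/
def levelDelta {g : ℕ} (k : ℕ) (h : (Fin g → ℝ) → ℂ) : TorusTest g →ₗ[ℂ] ℂ :=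
  ((k : ℂ) ^ g)⁻¹ • ∑ m : Fin g → Fin k,
    h (fun i => ((m i : ℕ) : ℝ) / k) • torusDelta fun i => ((m i : ℕ) : ℝ) / k

/-- The distribution `θ_l^ℝ = exp(2 π i l · x) θ_0^ℝ`, where `θ_0^ℝ` is the delta distribution of
level `k`. -/
def thetaDist {g : ℕ} (k : ℕ) (l : Fin g → ℤ) : TorusTest g →ₗ[ℂ] ℂ :=
  levelDelta k (torusChar l : (Fin g → ℝ) → ℂ)

/-- The eigenvalue on `exp(2 π i n · x)` of the operator
`Δ^{(-iΩ)} = ∑ (-i Ω_{ij} / 2π) ∂_i ∂_j`. -/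
def laplaceEigenvalue {g : ℕ} (Ω : Matrix (Fin g) (Fin g) ℂ) (n : Fin g → ℤ) : ℂ :=
  ∑ i, ∑ j, (-I * Ω i j / (2 * Real.pi)) * (2 * Real.pi * I * n i) * (2 * Real.pi * I * n j)

/-- The term of index `n` of the analytic continuation of `exp((t/2) Δ^{(-iΩ)}) T`. -/
def cstTerm {g : ℕ} (Ω : Matrix (Fin g) (Fin g) ℂ) (t : ℝ) (T : TorusTest g →ₗ[ℂ] ℂ)
    (z : Fin g → ℂ) (n : Fin g → ℤ) : ℂ :=
  torusFourierCoeff T n * exp (t / 2 * laplaceEigenvalue Ω n) *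
    exp (2 * Real.pi * I * ∑ i, (n i : ℂ) * z i)

/-- The coherent state transform: the analytic continuation from `U(1)^g` to `(ℂ^*)^g`, in the
coordinates `exp(2 π i z_i)`, of `exp((t/2) Δ^{(-iΩ)}) T`. -/
def coherentStateTransform {g : ℕ} (Ω : Matrix (Fin g) (Fin g) ℂ) (t : ℝ)
    (T : TorusTest g →ₗ[ℂ] ℂ) (z : Fin g → ℂ) : ℂ := ∑' n, cstTerm Ω t T z n

/-- The term of index `n` of the theta series `θ_l(z, Ω)` of level `k`. -/
def thetaTerm {g : ℕ} (Ω : Matrix (Fin g) (Fin g) ℂ) (k : ℕ) (l : Fin g → ℤ) (z : Fin g → ℂ)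
    (n : Fin g → ℤ) : ℂ :=
  exp (Real.pi * I / k * ∑ i, ∑ j, ((l i + k * n i : ℤ) : ℂ) * Ω i j * ((l j + k * n j : ℤ) : ℂ)) *
    exp (2 * Real.pi * I * ∑ i, ((l i + k * n i : ℤ) : ℂ) * z i)

/-- The theta function with characteristic `θ_l(z, Ω)` of level `k`. -/
def thetaFun {g : ℕ} (Ω : Matrix (Fin g) (Fin g) ℂ) (k : ℕ) (l : Fin g → ℤ) (z : Fin g → ℂ) : ℂ :=
  ∑' n, thetaTerm Ω k l z n

/-! ### Coordinates, period matrix and theta divisor attached to an adapted basis -/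

namespace LagrangianDecomposition.AdaptedBasis

variable {A : PPAV V} {D : LagrangianDecomposition A} (B : D.AdaptedBasis)

theorem a_mem (i : Fin (finrank ℂ V)) : B.a i ∈ D.plus := by
  rw [← B.span_a]; exact Submodule.subset_span ⟨i, rfl⟩

theorem E_sum_a (p q : Fin (finrank ℂ V) → ℝ) :
    A.E (∑ i, p i • B.a i) (∑ j, q j • B.a j) = 0 := by
  simp only [map_sum, map_smul, LinearMap.sum_apply, LinearMap.smul_apply]
  refine Finset.sum_eq_zero fun j _ => ?_
  rw [Finset.sum_eq_zero fun i _ => ?_]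
  · simp
  · rw [D.isotropic_plus _ (B.a_mem _) _ (B.a_mem _)]; simp

theorem coeff_eq_zero (p : Fin (finrank ℂ V) → ℝ) (h : ∑ i, p i • B.a i = 0) (j) : p j = 0 := by
  have : A.E (B.b j) (∑ i, p i • B.a i) = p j := by
    simp [map_sum, B.dual]
  rw [← this, h, map_zero]

theorem linearIndependent_a : LinearIndependent ℂ B.a := by
  rw [Fintype.linearIndependent_iff]
  intro c hc j
  set u := ∑ i, (c i).re • B.a i with hu
  set w := ∑ i, (c i).im • B.a i with hw
  have h0 : u + I • w = 0 := by
    rw [← hc, hu, hw, Finset.smul_sum, ← Finset.sum_add_distrib]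
    refine Finset.sum_congr rfl fun i _ => ?_
    conv_rhs => rw [← Complex.re_add_im (c i)]
    rw [add_smul, mul_comm, mul_smul]
    rfl
  have hw0 : w = 0 := by
    by_contra hne
    have h1 := A.positive w hne
    have h2 : I • w = -u := by rw [eq_neg_iff_add_eq_zero, add_comm]; exact h0
    rw [h2, map_neg, LinearMap.neg_apply, hu, hw, B.E_sum_a] at h1
    simp at h1
  have hu0 : u = 0 := by simpa [hw0] using h0
  exact Complex.ext (B.coeff_eq_zero _ hu0 j) (B.coeff_eq_zero _ hw0 j)

/-- The vectors `a_i` form a complex basis of `V`. -/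
def complexBasis : Basis (Fin (finrank ℂ V)) ℂ V :=
  basisOfLinearIndependentOfCardEqFinrank' B.a B.linearIndependent_a (by simp)

/-- The complex coordinates `z` of `V`, dual to the basis `a`. -/
def z (v : V) : Fin (finrank ℂ V) → ℂ := fun i => B.complexBasis.repr v i

/-- The real coordinates `y` along `V₋`: `v = ∑ x_i a_i + ∑ y_i b_i` with `x`, `y` real. -/
def y (v : V) : Fin (finrank ℂ V) → ℝ := fun j => A.E v (B.a j)

/-- The period matrix: `b_j = ∑ Ω_{ij} a_i`. -/
def period : Matrix (Fin (finrank ℂ V)) (Fin (finrank ℂ V)) ℂ := fun i j => B.z (B.b j) i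

/-- The section of `L ^ k` represented by a function `F` of `z` in the holomorphic frame
`exp(k π i y · z)`, which trivializes the pull back of `L ^ k` to `V / Λ₊ = (ℂ^*)^g`. -/
def toSection (k : ℕ) (F : (Fin (finrank ℂ V) → ℂ) → ℂ) (v : V) : ℂ :=
  exp (Real.pi * I * k * ∑ j, (B.y v j : ℂ) * B.z v j) * F (B.z v)

/-- The representative `-(1/k) ∑ l_j b_j` in `V₋` of a point of order `k` of `T₋`. -/
def bsVec (k : ℕ) (l : Fin (finrank ℂ V) → ℤ) : V := -∑ j, ((l j : ℝ) / (k : ℝ)) • B.b j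

/-- The point of `T₋` represented by `-(1/k) ∑ l_j b_j`. -/
def bsPoint (k : ℕ) (l : Fin (finrank ℂ V) → ℤ) : D.Tminus :=
  ⟨A.lattice.mkQ (B.bsVec k l), by
    refine Submodule.mem_map_of_mem ?_
    refine D.Vminus.neg_mem (D.Vminus.sum_mem fun j _ => D.Vminus.smul_mem _ ?_)
    refine Submodule.subset_span ?_
    rw [SetLike.mem_coe, ← B.span_b]
    exact Submodule.subset_span ⟨j, rfl⟩⟩

/-- A section `s` of `L ^ k` over the fibre through `β ∈ V₋` as a function on the zero fibre `T₊`: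
`s` is divided by the parallel transport, along the segments from `x` to `x + β`, of the constant
section `1` of `L ^ k` over `T₊`. -/
def fibreFun (k : ℕ) (β : V) (s : V → ℂ) (x : Fin (finrank ℂ V) → ℝ) : ℂ :=
  s (β + ∑ i, x i • B.a i) * exp (-(Real.pi * I * k * (A.E β (∑ i, x i • B.a i) : ℂ)))

/-- The Riemann theta function on `V`, whose divisor is the pull back to `V` of the theta divisor
`Θ` of `V / Λ`. -/
def riemannTheta (v : V) : ℂ := thetaFun B.period 1 0 (B.z v)

/-- The space `H⁰(V / Λ, 𝒪(kΘ))` of meromorphic functions `f` on `V / Λ` with `div f + kΘ ≥ 0`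
(as functions on `V`, with the value `0` at the points of `Θ`). -/
def divisorSpace (k : ℕ) : Submodule ℂ (V → ℂ) where
  carrier := {f | (∀ v, B.riemannTheta v = 0 → f v = 0) ∧
    (∀ v, ∀ u ∈ A.lattice, f (v + u) = f v) ∧
    ∀ v₀, ∃ U ∈ 𝓝 v₀, ∃ F : V → ℂ, DifferentiableOn ℂ F U ∧
      ∀ v ∈ U, B.riemannTheta v ≠ 0 → F v = f v * B.riemannTheta v ^ k}
  zero_mem' := ⟨fun _ _ => rfl, fun _ _ _ => rfl, fun v₀ =>
    ⟨Set.univ, Filter.univ_mem, 0, differentiableOn_const 0, by simp⟩⟩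
  add_mem' := by
    rintro f h ⟨hf, hf1, hf2⟩ ⟨hh, hh1, hh2⟩
    refine ⟨fun v hv => by simp [hf v hv, hh v hv], fun v u hu => by
      simp only [Pi.add_apply, hf1 v u hu, hh1 v u hu], fun v₀ => ?_⟩
    obtain ⟨U, hU, F, hF, hF1⟩ := hf2 v₀
    obtain ⟨W, hW, G, hG, hG1⟩ := hh2 v₀
    refine ⟨U ∩ W, Filter.inter_mem hU hW, F + G,
      (hF.mono Set.inter_subset_left).add (hG.mono Set.inter_subset_right), ?_⟩
    intro v hv hne
    simp only [Pi.add_apply, hF1 v hv.1 hne, hG1 v hv.2 hne]; ring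
  smul_mem' := by
    rintro c f ⟨hf, hf1, hf2⟩
    refine ⟨fun v hv => by simp [hf v hv], fun v u hu => by
      simp only [Pi.smul_apply, hf1 v u hu], fun v₀ => ?_⟩
    obtain ⟨U, hU, F, hF, hF1⟩ := hf2 v₀
    refine ⟨U, hU, c • F, hF.const_smul c, ?_⟩
    intro v hv hne
    simp only [Pi.smul_apply, smul_eq_mul, hF1 v hv hne]; ring

end LagrangianDecomposition.AdaptedBasis

end

/-!
In the holomorphic frame `exp (k π i y · z)` the sections of `L ^ k` annihilated by `∇^{0,1}` are
the entire functions `F(z)` with the automorphy factors of the lattice `ℤ^g + Ω ℤ^g`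
(`toSection_mem_kahlerSpace_iff`). Such an `F` is periodic under `ℤ^g`, hence determined by its
Fourier coefficients, and quasi-periodicity under `Ω ℤ^g` is the recursion which relates the
coefficients of index `n` and `n + k m`. The solutions of this recursion are
`n ↦ c(n mod k) exp (π i n · Ω n / k)`, so the theta functions with characteristics
`l ∈ (ℤ / k)^g` form a basis of the Kähler wave space (`IsThetaFunction.eq_sum`); the positivity of
`Im Ω` makes the theta series converge. The input from complex analysis is that an entire
function on `ℂ^g` is smooth, by Cauchy's formula on complex lines, and, if periodic, determined by
its Fourier coefficients on `ℝ^g`: the coefficient of index `n` of the translate by `w ∈ ℂ^g` is an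
entire function of `w`, so its behaviour under real translations determines it
(`entireFourierCoeff_eq`), and the Fourier coefficients on every torus `w + ℝ^g` vanish with those
on `ℝ^g`.

On the side of the real polarization, a covariantly constant section over the fibre through
`β ∈ V₋` is a multiple of `exp (-k π i x · y)`, where `v = ∑ x_i a_i + ∑ y_i b_i`. It is equivariant
under `Λ` exactly if `k y(β)` is integral, that is, if `k β ∈ Λ₋`. This gives the Bohr-Sommerfeld
fibres, their number, and the points `t_l` (`mem_bohrSommerfeld_iff`, `finrank_covConst`,
`bohrSommerfeld_eq_range`). A decomposition of `Λ` is found by splitting off hyperbolic planes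
(`exists_isCompl_isotropic`), and adapted bases exist because unimodularity makes `E` a perfect
pairing of `Λ₋` with `Λ₊`.

The isomorphism `Φ` sends a covariantly constant section `s` over `t_l` to `s(β_l)` times the theta
section with characteristic `l`. It is bijective since both sides have bases indexed by
`(ℤ / k)^g`. It does not depend on the adapted basis: the pairing `y(v) · z(w)` is the complex
linear extension in `w` of the functional `E(v, ·)` on `V₊`, and in terms of this pairing the theta
section is a sum over the coset `β_l + Λ₋` (`toSection_thetaFun_eq_tsum`). The distribution
`θ_l^ℝ` has the Fourier coefficient `1` at the indices in `l + k ℤ^g` and `0` elsewhere, by the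
orthogonality of the characters of `ℤ / k`, so its coherent state transform at time `1 / k` is
the theta series term by term.

Finally, dividing a holomorphic section of `L ^ k` by the `k`-th power of the section of `L` with
divisor `Θ` gives a function in `H⁰(𝒪(kΘ))`. This is bijective because the complement of `Θ` is
dense: local holomorphic representatives of `f ϑ ^ k` agree off `Θ`, hence everywhere, and glue to
an entire function (`divideMap_surjective`).
-/

/-! ### Entire functions of several complex variables -/

section Entire

open MeasureTheory Metric

variable {ι : Type*} [Fintype ι] {F : (ι → ℂ) → ℂ}

theorem hasDerivAt_comp_line (hF : Differentiable ℂ F) (u v : ι → ℂ) (τ : ℂ) :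
    HasDerivAt (fun τ : ℂ => F (u + τ • v)) (fderiv ℂ F (u + τ • v) v) τ := by
  have h : HasDerivAt (fun τ : ℂ => u + τ • v) v τ := by
    simpa using ((hasDerivAt_id τ).smul_const v).const_add u
  exact (hF _).hasFDerivAt.comp_hasDerivAt τ h

/-- Cauchy's estimate for the differential, from the estimate on complex lines. -/
theorem norm_fderiv_le_of_forall_mem_closedBall (hF : Differentiable ℂ F) {u : ι → ℂ} {C : ℝ}
    (hC : ∀ w ∈ closedBall u 1, ‖F w‖ ≤ C) : ‖fderiv ℂ F u‖ ≤ C := by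
  have hC0 : 0 ≤ C := (norm_nonneg _).trans (hC u (mem_closedBall_self zero_le_one))
  refine ContinuousLinearMap.opNorm_le_of_unit_norm hC0 fun v hv => ?_
  have hd : Differentiable ℂ fun τ : ℂ => F (u + τ • v) := fun τ =>
    (hasDerivAt_comp_line hF u v τ).differentiableAt
  have h := norm_deriv_le_of_forall_mem_sphere_norm_le (C := C) zero_lt_one
    (hd.diffContOnCl (s := ball 0 1)) fun τ hτ => hC _ (by
      have : ‖τ‖ = 1 := by simpa using hτ
      simp [norm_smul, hv, this])
  rw [(hasDerivAt_comp_line hF u v 0).deriv] at h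
  simpa using h

/-- An average of translates of an entire function, over a bounded set of translations, is
entire. -/
theorem Differentiable.integral_translate {α : Type*} [MeasurableSpace α] {μ : Measure α}
    [IsFiniteMeasure μ] (hF : Differentiable ℂ F) {c : α → ι → ℂ} (hc : Measurable c) {R : ℝ}
    (hR : ∀ t, ‖c t‖ ≤ R) {ψ : α → ℂ} (hψ : Measurable ψ) {C : ℝ} (hC : ∀ t, ‖ψ t‖ ≤ C) :
    Differentiable ℂ fun w => ∫ t, ψ t * F (w + c t) ∂μ := by
  intro w₀
  obtain ⟨K, hK⟩ := (isCompact_closedBall w₀ (R + 2)).exists_bound_of_continuousOn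
    hF.continuous.continuousOn
  have hmeas : ∀ w, AEStronglyMeasurable (fun t => ψ t * F (w + c t)) μ := fun w =>
    (hψ.mul (hF.continuous.measurable.comp (measurable_const.add hc))).aestronglyMeasurable
  have hdist : ∀ w ∈ closedBall w₀ 2, ∀ t, w + c t ∈ closedBall w₀ (R + 2) := by
    intro w hw t
    rw [mem_closedBall, dist_eq_norm] at hw ⊢
    calc ‖w + c t - w₀‖ = ‖c t + (w - w₀)‖ := by congr 1; abel
      _ ≤ R + 2 := (norm_add_le _ _).trans (add_le_add (hR t) hw)
  refine (hasFDerivAt_integral_of_dominated_of_fderiv_le (𝕜 := ℂ)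
    (F' := fun w t => ψ t • fderiv ℂ F (w + c t)) (bound := fun _ => C * K)
    (ball_mem_nhds w₀ zero_lt_one) (Filter.Eventually.of_forall hmeas) ?_ ?_ ?_
    (integrable_const _) ?_).differentiableAt
  · refine Integrable.of_bound (hmeas w₀) (C * K) (Filter.Eventually.of_forall fun t => ?_)
    rw [norm_mul]
    exact mul_le_mul (hC t) (hK _ (hdist w₀ (mem_closedBall_self (by norm_num)) t))
      (norm_nonneg _) ((norm_nonneg _).trans (hC t))
  · exact (hψ.smul ((measurable_fderiv ℂ F).comp
      (measurable_const.add hc))).aestronglyMeasurable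
  · refine Filter.Eventually.of_forall fun t w hw => ?_
    rw [norm_smul]
    refine mul_le_mul (hC t) (norm_fderiv_le_of_forall_mem_closedBall hF fun x hx => ?_)
      (norm_nonneg _) ((norm_nonneg _).trans (hC t))
    have hx' : x - c t ∈ closedBall w₀ 2 := by
      rw [mem_closedBall, dist_eq_norm] at hx ⊢
      rw [mem_ball, dist_eq_norm] at hw
      calc ‖x - c t - w₀‖ = ‖(x - (w + c t)) + (w - w₀)‖ := by congr 1; abel
        _ ≤ 2 := (norm_add_le _ _).trans (by linarith)
    simpa using hK _ (hdist _ hx' t)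
  · refine Filter.Eventually.of_forall fun t w _ => ?_
    have h : HasFDerivAt (fun w => F (w + c t)) (fderiv ℂ F (w + c t)) w := by
      have h1 := (hF (w + c t)).hasFDerivAt.comp w ((hasFDerivAt_id w).add_const (c t))
      simpa using! h1
    exact h.const_smul (ψ t)

/-- The partial derivatives of an entire function are entire, by Cauchy's integral formula. -/
theorem Differentiable.fderiv_apply_of_complex (hF : Differentiable ℂ F) (v : ι → ℂ) :
    Differentiable ℂ fun w => fderiv ℂ F w v := by
  have hcirc : ∀ θ, ‖circleMap 0 1 θ‖ = 1 := fun θ => by simp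
  have key : (fun w => fderiv ℂ F w v) = fun w => (2 * Real.pi * I : ℂ)⁻¹ *
      ∫ θ in Set.Ioc 0 (2 * Real.pi), (circleMap 0 1 θ * I * (circleMap 0 1 θ ^ 2)⁻¹) *
        F (w + circleMap 0 1 θ • v) := by
    funext w
    have hd : Differentiable ℂ fun τ : ℂ => F (w + τ • v) := fun τ =>
      (hasDerivAt_comp_line hF w v τ).differentiableAt
    have h := (hd.diffContOnCl (s := ball 0 1)).circleIntegral_one_div_sub_center_pow_smul
      zero_lt_one 1
    rw [iteratedDeriv_one, (hasDerivAt_comp_line hF w v 0).deriv, circleIntegral,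
      intervalIntegral.integral_of_le (by positivity)] at h
    have h2 : (2 * Real.pi * I : ℂ) ≠ 0 := by simp [Real.pi_ne_zero]
    rw [eq_inv_mul_iff_mul_eq₀ h2]
    simp only [zero_smul, add_zero, smul_eq_mul] at h
    rw [show (2 * Real.pi * I : ℂ) * fderiv ℂ F w v =
      2 * Real.pi * I / ((Nat.factorial 1 : ℕ) : ℂ) * fderiv ℂ F w v by simp, ← h]
    congr 1
    funext θ
    simp
    ring
  rw [key]
  refine Differentiable.const_mul ?_ _
  refine hF.integral_translate (R := ‖v‖) (C := 1) ?_ ?_ ?_ ?_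
  · exact ((continuous_circleMap 0 1).smul continuous_const).measurable
  · intro θ; rw [norm_smul, hcirc, one_mul]
  · refine ((continuous_circleMap 0 1).mul continuous_const).measurable.mul ?_
    exact ((continuous_circleMap 0 1).pow 2).measurable.inv
  · intro θ; simp

/-- Entire functions of several variables are smooth. -/
theorem Differentiable.contDiff_of_complex (hF : Differentiable ℂ F) : ContDiff ℂ ∞ F := by
  rw [contDiff_infty]
  intro n
  induction n generalizing F with
  | zero => exact contDiff_zero.2 hF.continuous
  | succ n ih =>
    rw [Nat.cast_succ, contDiff_succ_iff_fderiv_apply]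
    exact ⟨hF, fun h => absurd h (by simp), fun y => ih (hF.fderiv_apply_of_complex y)⟩

/-- The identity theorem: an entire function which vanishes near a point vanishes identically. -/
theorem Differentiable.eq_zero_of_eventually_eq_zero (hF : Differentiable ℂ F) {u : ι → ℂ}
    (hu : ∀ᶠ w in 𝓝 u, F w = 0) (w : ι → ℂ) : F w = 0 := by
  have hd : Differentiable ℂ fun τ : ℂ => F (u + τ • (w - u)) := fun τ =>
    (hasDerivAt_comp_line hF u (w - u) τ).differentiableAt
  have hc : Filter.Tendsto (fun τ : ℂ => u + τ • (w - u)) (𝓝 0) (𝓝 u) := by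
    have : Continuous fun τ : ℂ => u + τ • (w - u) := by fun_prop
    simpa using this.tendsto 0
  have ha := hd.differentiableOn.analyticOnNhd isOpen_univ
  have h := ha.eqOn_zero_of_preconnected_of_eventuallyEq_zero
    isPreconnected_univ (Set.mem_univ (0 : ℂ)) (hc.eventually hu) (Set.mem_univ (1 : ℂ))
  simpa using h

end Entire

/-! ### Fourier coefficients of periodic entire functions -/

section Fourier

open MeasureTheory

/-- The representative in `(0, 1]^ι` of a point of the torus `(ℝ / ℤ)^ι`. -/
noncomputable def torusRep {ι : Type*} (t : ι → AddCircle (1 : ℝ)) : ι → ℝ :=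
  fun i => (AddCircle.equivIoc 1 0 (t i) : ℝ)

theorem coe_torusRep {ι : Type*} (t : ι → AddCircle (1 : ℝ)) (i : ι) :
    ((torusRep t i : ℝ) : AddCircle (1 : ℝ)) = t i :=
  (AddCircle.equivIoc 1 0).symm_apply_apply (t i)

theorem measurable_torusRep {ι : Type*} : Measurable (torusRep (ι := ι)) :=
  measurable_pi_lambda _ fun i => measurable_subtype_coe.comp
    ((AddCircle.measurableEquivIoc 1 0).measurable.comp (measurable_pi_apply i))

/-- A vector in `ℝ^ι`, regarded as a vector in `ℂ^ι`. -/
noncomputable def realVec {ι : Type*} (x : ι → ℝ) : ι → ℂ := fun i => (x i : ℂ)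

theorem continuous_realVec {ι : Type*} : Continuous (realVec (ι := ι)) :=
  continuous_pi fun i => continuous_ofReal.comp (continuous_apply i)

variable {ι : Type*} [Fintype ι] {F : (ι → ℂ) → ℂ}

theorem norm_realVec_torusRep_le (t : ι → AddCircle (1 : ℝ)) : ‖realVec (torusRep t)‖ ≤ 1 := by
  rw [pi_norm_le_iff_of_nonneg zero_le_one]
  intro i
  have h := (AddCircle.equivIoc (1 : ℝ) 0 (t i)).2
  simp only [zero_add, Set.mem_Ioc] at h
  rw [realVec, Complex.norm_real, Real.norm_eq_abs, torusRep, abs_of_pos h.1]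
  exact h.2

/-- The character `exp (2 π i n · z)` of `ℂ^ι / ℤ^ι`. -/
noncomputable def multiChar (n : ι → ℤ) (z : ι → ℂ) : ℂ :=
  exp (2 * Real.pi * I * ∑ i, (n i : ℂ) * z i)

theorem multiChar_add_left (m n : ι → ℤ) (z : ι → ℂ) :
    multiChar (m + n) z = multiChar m z * multiChar n z := by
  simp only [multiChar, ← Complex.exp_add, ← mul_add, ← Finset.sum_add_distrib, Pi.add_apply,
    Int.cast_add, add_mul]

theorem multiChar_add_right (n : ι → ℤ) (z w : ι → ℂ) :
    multiChar n (z + w) = multiChar n z * multiChar n w := by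
  simp only [multiChar, ← Complex.exp_add, ← mul_add, ← Finset.sum_add_distrib, Pi.add_apply]

theorem multiChar_zero_left (z : ι → ℂ) : multiChar 0 z = 1 := by simp [multiChar]

theorem multiChar_zero_right (n : ι → ℤ) : multiChar n 0 = 1 := by simp [multiChar]

theorem multiChar_ne_zero (n : ι → ℤ) (z : ι → ℂ) : multiChar n z ≠ 0 := exp_ne_zero _

theorem multiChar_neg_mul_self (n : ι → ℤ) (z : ι → ℂ) : multiChar (-n) z * multiChar n z = 1 := by
  rw [← multiChar_add_left, neg_add_cancel, multiChar_zero_left]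

theorem multiChar_intCast (n m : ι → ℤ) : multiChar n (fun i => (m i : ℂ)) = 1 := by
  rw [multiChar, Complex.exp_eq_one_iff]
  exact ⟨∑ i, n i * m i, by push_cast; ring⟩

theorem norm_multiChar_realVec (n : ι → ℤ) (x : ι → ℝ) : ‖multiChar n (realVec x)‖ = 1 := by
  rw [multiChar, show 2 * Real.pi * I * ∑ i, (n i : ℂ) * realVec x i =
    ((2 * Real.pi * ∑ i, n i * x i : ℝ) : ℂ) * I by simp only [realVec]; push_cast; ring]
  exact Complex.norm_exp_ofReal_mul_I _

theorem differentiable_multiChar (n : ι → ℤ) : Differentiable ℂ (multiChar n) := by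
  unfold multiChar; fun_prop

/-- The product of the Haar probability measures on the torus `(ℝ / ℤ)^ι`. -/
noncomputable abbrev torusMeasure (ι : Type*) [Fintype ι] : Measure (ι → AddCircle (1 : ℝ)) :=
  Measure.pi fun _ => AddCircle.haarAddCircle

/-- The function `F` is periodic for the lattice `ℤ^ι`. -/
def IsIntPeriodic {ι : Type*} (F : (ι → ℂ) → ℂ) : Prop :=
  ∀ (z : ι → ℂ) (n : ι → ℤ), F (z + fun i => (n i : ℂ)) = F z

/-- Invariance under the unit vectors implies invariance under all integral vectors. -/
theorem apply_add_intCast_of_single {R α : Type*} [Ring R] [DecidableEq ι] {f : (ι → R) → α}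
    (h : ∀ z j, f (z + Pi.single j 1) = f z) (z : ι → R) (n : ι → ℤ) :
    f (z + fun i => (n i : R)) = f z := by
  have h1 : ∀ (j : ι) (a : ℤ) z, f (z + Pi.single j (a : R)) = f z := by
    intro j a
    induction a with
    | zero => simp
    | succ a ih =>
      intro z
      have e : z + Pi.single j (((a : ℤ) + 1 : ℤ) : R) =
          z + Pi.single j ((a : ℤ) : R) + Pi.single j 1 := by
        rw [add_assoc, ← Pi.single_add, Int.cast_add, Int.cast_one]
      rw [e, h, ih]
    | pred a ih =>
      intro z
      have e : z + Pi.single j ((-(a : ℤ) : ℤ) : R) =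
          z + Pi.single j ((-(a : ℤ) - 1 : ℤ) : R) + Pi.single j 1 := by
        rw [add_assoc, ← Pi.single_add, Int.cast_sub, Int.cast_one, sub_add_cancel]
      rw [← ih z, e, h]
  have h2 : ∀ (s : Finset ι) z, f (z + ∑ j ∈ s, Pi.single j (n j : R)) = f z := by
    intro s
    induction s using Finset.induction_on with
    | empty => simp
    | insert j s hj ih =>
      intro z
      rw [Finset.sum_insert hj, ← add_assoc, ih, h1]
  have := h2 Finset.univ z
  rwa [Finset.univ_sum_single] at this

theorem IsIntPeriodic.apply_add_realVec {ι : Type*} {F : (ι → ℂ) → ℂ} (hF : IsIntPeriodic F)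
    (z : ι → ℂ) {x y : ι → ℝ}
    (hxy : ∀ i, (x i : AddCircle (1 : ℝ)) = y i) : F (z + realVec x) = F (z + realVec y) := by
  have h : ∀ i, ∃ n : ℤ, x i = y i + n := by
    intro i
    have h1 := hxy i
    rw [← sub_eq_zero, ← AddCircle.coe_sub, AddCircle.coe_eq_zero_iff] at h1
    obtain ⟨n, hn⟩ := h1
    exact ⟨n, by rw [zsmul_eq_mul, mul_one] at hn; linarith⟩
  choose n hn using h
  rw [← hF (z + realVec y) n, add_assoc]
  congr 2
  funext i
  simp [realVec, hn i]

theorem isIntPeriodic_multiChar (n : ι → ℤ) : IsIntPeriodic (multiChar n) := fun z m => by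
  rw [multiChar_add_right, multiChar_intCast, mul_one]

/-- The Fourier coefficient of index `n` of the function `x ↦ F (w + x)` on the torus
`(ℝ / ℤ)^ι`. The translation `w` is complex, so that the coefficient is an entire function
of `w`. -/
noncomputable def entireFourierCoeff (F : (ι → ℂ) → ℂ) (n : ι → ℤ) (w : ι → ℂ) : ℂ :=
  ∫ t, multiChar (-n) (realVec (torusRep t)) * F (w + realVec (torusRep t)) ∂torusMeasure ι

theorem measurable_multiChar_torusRep (n : ι → ℤ) :
    Measurable fun t : ι → AddCircle (1 : ℝ) => multiChar n (realVec (torusRep t)) :=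
  ((differentiable_multiChar n).continuous.comp continuous_realVec).measurable.comp
    measurable_torusRep

theorem integrable_entireFourierCoeff (hF : Continuous F) (n : ι → ℤ) (w : ι → ℂ) :
    Integrable (fun t => multiChar (-n) (realVec (torusRep t)) * F (w + realVec (torusRep t)))
      (torusMeasure ι) := by
  obtain ⟨K, hK⟩ := (isCompact_closedBall w 1).exists_bound_of_continuousOn hF.continuousOn
  refine Integrable.of_bound (C := K) ?_ (Filter.Eventually.of_forall fun t => ?_)
  · refine ((measurable_multiChar_torusRep _).mul ?_).aestronglyMeasurable
    exact (hF.comp (continuous_const.add continuous_realVec)).measurable.comp measurable_torusRep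
  · rw [norm_mul, norm_multiChar_realVec, one_mul]
    exact hK _ (by simpa using norm_realVec_torusRep_le t)

theorem Differentiable.entireFourierCoeff (hF : Differentiable ℂ F) (n : ι → ℤ) :
    Differentiable ℂ (entireFourierCoeff F n) :=
  hF.integral_translate (R := 1) (C := 1) (continuous_realVec.measurable.comp measurable_torusRep)
    norm_realVec_torusRep_le (measurable_multiChar_torusRep _)
    fun _ => (norm_multiChar_realVec _ _).le

/-- The effect of a real translation on the Fourier coefficients, from the invariance of the Haar
measure. -/
theorem entireFourierCoeff_add_realVec (hF : IsIntPeriodic F) (n : ι → ℤ) (w : ι → ℂ)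
    (r : ι → ℝ) : entireFourierCoeff F n (w + realVec r) =
      multiChar n (realVec r) * entireFourierCoeff F n w := by
  set s : ι → AddCircle (1 : ℝ) := fun i => r i with hs
  have hcoe : ∀ t i, ((r + torusRep t) i : AddCircle (1 : ℝ)) = torusRep (t + s) i := by
    intro t i
    rw [coe_torusRep, Pi.add_apply, AddCircle.coe_add, coe_torusRep, Pi.add_apply, add_comm]
  have hadd : ∀ t, realVec (r + torusRep t) = realVec r + realVec (torusRep t) := fun t => by
    funext i; simp [realVec]
  rw [entireFourierCoeff, entireFourierCoeff, ← integral_const_mul]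
  refine Eq.trans ?_ (integral_add_right_eq_self _ s)
  refine integral_congr_ae (Filter.Eventually.of_forall fun t => ?_)
  have h1 : F (w + realVec (torusRep (t + s))) = F (w + realVec r + realVec (torusRep t)) := by
    rw [← hF.apply_add_realVec w (hcoe t), hadd, add_assoc]
  have h2 : multiChar (-n) (realVec (torusRep (t + s))) =
      multiChar (-n) (realVec r) * multiChar (-n) (realVec (torusRep t)) := by
    have := (isIntPeriodic_multiChar (-n)).apply_add_realVec 0 (hcoe t)
    rw [zero_add, zero_add] at this
    rw [← this, hadd, multiChar_add_right]
  simp only [h1, h2]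
  rw [← mul_assoc, ← mul_assoc, mul_comm (multiChar n (realVec r)), multiChar_neg_mul_self,
    one_mul]

/-- The same for all complex translations: after division by the character `n`, the coefficient is
an entire function of the translation which is invariant under the real ones. -/
theorem entireFourierCoeff_eq (hF : Differentiable ℂ F) (hF1 : IsIntPeriodic F) (n : ι → ℤ)
    (w : ι → ℂ) : entireFourierCoeff F n w = multiChar n w * entireFourierCoeff F n 0 := by
  set g : (ι → ℂ) → ℂ := fun w => multiChar (-n) w * entireFourierCoeff F n w with hg
  have hgd : Differentiable ℂ g := (differentiable_multiChar _).mul (hF.entireFourierCoeff n)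
  have hinv : ∀ w r, g (w + realVec r) = g w := by
    intro w r
    simp only [hg, entireFourierCoeff_add_realVec hF1, multiChar_add_right]
    rw [mul_assoc, ← mul_assoc (multiChar (-n) (realVec r)), multiChar_neg_mul_self, one_mul]
  have hreal : ∀ u r, fderiv ℂ g u (realVec r) = 0 := by
    intro u r
    -- the restriction to the line in the direction `r` is constant on the real axis
    have h1 : HasDerivAt (fun τ : ℝ => g (u + (τ : ℂ) • realVec r))
        (fderiv ℂ g (u + ((0 : ℝ) : ℂ) • realVec r) (realVec r)) 0 :=
      (hasDerivAt_comp_line hgd u (realVec r) ((0 : ℝ) : ℂ)).comp_ofReal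
    have h2 : (fun τ : ℝ => g (u + (τ : ℂ) • realVec r)) = fun _ => g u := by
      funext τ
      rw [← hinv u (τ • r)]
      congr 2
      funext i
      simp [realVec]
    rw [h2] at h1
    simpa using h1.unique (hasDerivAt_const 0 (g u))
  have hzero : ∀ u, fderiv ℂ g u = 0 := by
    intro u
    ext v
    have hv : v = realVec (fun i => (v i).re) + I • realVec (fun i => (v i).im) := by
      funext i
      simp only [realVec, Pi.add_apply, Pi.smul_apply, smul_eq_mul]
      rw [mul_comm, re_add_im]
    rw [hv, map_add, map_smul, hreal, hreal]
    simp
  have h := is_const_of_fderiv_eq_zero hgd hzero w 0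
  simp only [hg, multiChar_zero_right, one_mul] at h
  rw [← h, ← mul_assoc, mul_comm (multiChar n w), multiChar_neg_mul_self, one_mul]

/-- A periodic entire function whose Fourier coefficients vanish is zero. -/
theorem eq_zero_of_entireFourierCoeff_eq_zero (hF : Differentiable ℂ F) (hF1 : IsIntPeriodic F)
    (h : ∀ n, entireFourierCoeff F n 0 = 0) (w : ι → ℂ) : F w = 0 := by
  set f : (ι → AddCircle (1 : ℝ)) → ℂ := fun t => F (w + realVec (torusRep t)) with hf
  have hq : IsOpenQuotientMap (Pi.map fun (_ : ι) (x : ℝ) => (x : AddCircle (1 : ℝ))) :=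
    IsOpenQuotientMap.piMap fun _ => QuotientAddGroup.isOpenQuotientMap_mk
  have hlift : ∀ x : ι → ℝ, f (fun i => (x i : AddCircle (1 : ℝ))) = F (w + realVec x) :=
    fun x => hF1.apply_add_realVec w fun i => coe_torusRep _ i
  have hcont : Continuous f := by
    rw [hq.isQuotientMap.continuous_iff]
    have : f ∘ (Pi.map fun (_ : ι) (x : ℝ) => (x : AddCircle (1 : ℝ))) =
        fun x => F (w + realVec x) := funext hlift
    rw [this]
    exact hF.continuous.comp (continuous_const.add continuous_realVec)
  have hchar : ∀ (n : ι → ℤ) t, UnitAddTorus.mFourier n t = multiChar n (realVec (torusRep t)) := by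
    intro n t
    simp only [UnitAddTorus.mFourier, ContinuousMap.coe_mk, multiChar, Finset.mul_sum,
      Complex.exp_sum]
    refine Finset.prod_congr rfl fun i _ => ?_
    rw [← coe_torusRep t i, fourier_coe_apply]
    simp only [realVec, ofReal_one, div_one, mul_assoc]
  have hcoeff : UnitAddTorus.mFourierCoeff (⇑(⟨f, hcont⟩ : C(UnitAddTorus ι, ℂ))) = 0 := by
    funext n
    have h1 : UnitAddTorus.mFourierCoeff (⇑(⟨f, hcont⟩ : C(UnitAddTorus ι, ℂ))) n =
        ∫ t, UnitAddTorus.mFourier (-n) t • f t ∂torusMeasure ι := rfl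
    rw [h1]
    simp only [hchar, smul_eq_mul]
    exact (entireFourierCoeff_eq hF hF1 n w).trans (by rw [h n, mul_zero]; rfl)
  have hsum := UnitAddTorus.hasSum_mFourier_series_apply_of_summable
    (f := (⟨f, hcont⟩ : C(UnitAddTorus ι, ℂ))) (by rw [hcoeff]; exact summable_zero)
    (fun i => ((0 : ℝ) : AddCircle (1 : ℝ)))
  rw [hcoeff] at hsum
  have h0 : f (fun i => ((0 : ℝ) : AddCircle (1 : ℝ))) = 0 := by
    have h1 : HasSum (fun _ : ι → ℤ => (0 : ℂ)) (f (fun i => ((0 : ℝ) : AddCircle (1 : ℝ)))) := by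
      simpa using! hsum
    exact h1.unique hasSum_zero
  rw [hlift (fun _ => 0)] at h0
  have h00 : realVec (fun _ : ι => (0 : ℝ)) = 0 := by funext i; simp [realVec]
  rwa [h00, add_zero] at h0

theorem entireFourierCoeff_multiChar_self (n : ι → ℤ) :
    entireFourierCoeff (multiChar n) n 0 = 1 := by
  simp [entireFourierCoeff, multiChar_neg_mul_self]

theorem entireFourierCoeff_multiChar_of_ne {m n : ι → ℤ} (h : m ≠ n) :
    entireFourierCoeff (multiChar m) n 0 = 0 := by
  obtain ⟨i, hi⟩ := Function.ne_iff.mp h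
  by_contra hne
  have hlin : ∀ w, entireFourierCoeff (multiChar m) n w =
      multiChar m w * entireFourierCoeff (multiChar m) n 0 := by
    intro w
    rw [entireFourierCoeff, entireFourierCoeff, ← integral_const_mul]
    congr 1
    funext t
    rw [multiChar_add_right, zero_add]
    ring
  have heq : ∀ w, multiChar m w = multiChar n w := fun w =>
    mul_right_cancel₀ hne ((hlin w).symm.trans
      (entireFourierCoeff_eq (differentiable_multiChar m) (isIntPeriodic_multiChar m) n w))
  -- the two characters differ at the point with only non-zero coordinate `1 / (2 (m i - n i))`
  classical
  have hmn : ((m i : ℂ) - n i) ≠ 0 := by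
    rw [sub_ne_zero]; exact_mod_cast hi
  have h1 : multiChar (-n + m) (Pi.single i (1 / (2 * ((m i : ℂ) - n i)))) = 1 := by
    rw [multiChar_add_left, heq, multiChar_neg_mul_self]
  rw [multiChar, Finset.sum_eq_single i] at h1
  · rw [Pi.single_eq_same, show 2 * Real.pi * I * ((((-n + m) i : ℤ) : ℂ) *
      (1 / (2 * ((m i : ℂ) - n i)))) = Real.pi * I by
        push_cast [Pi.add_apply, Pi.neg_apply]
        field_simp
        ring, exp_pi_mul_I] at h1
    norm_num at h1
  · intro j _ hj
    rw [Pi.single_eq_of_ne hj, mul_zero]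
  · intro hi'
    exact absurd (Finset.mem_univ i) hi'

/-- The Fourier coefficients of an absolutely convergent Fourier series. -/
theorem entireFourierCoeff_tsum {a : (ι → ℤ) → ℂ} (ha : Summable fun m => ‖a m‖)
    (hF : ∀ x, F (realVec x) = ∑' m, a m * multiChar m (realVec x)) (n : ι → ℤ) :
    entireFourierCoeff F n 0 = a n := by
  set f : (ι → ℤ) → (ι → AddCircle (1 : ℝ)) → ℂ := fun m t =>
    a m * (multiChar (-n) (realVec (torusRep t)) * multiChar m (0 + realVec (torusRep t))) with hf
  have hint : ∀ m, Integrable (f m) (torusMeasure ι) := fun m =>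
    (integrable_entireFourierCoeff (differentiable_multiChar m).continuous n 0).const_mul (a m)
  have hnorm : ∀ m, ∫ t, ‖f m t‖ ∂torusMeasure ι = ‖a m‖ := by
    intro m
    simp [hf, norm_multiChar_realVec]
  have hs := hasSum_integral_of_summable_integral_norm hint (by simpa only [hnorm] using ha)
  have h1 : ∀ m, ∫ t, f m t ∂torusMeasure ι = a m * entireFourierCoeff (multiChar m) n 0 :=
    fun m => integral_const_mul _ _
  have h2 : ∫ t, ∑' m, f m t ∂torusMeasure ι = entireFourierCoeff F n 0 := by
    rw [entireFourierCoeff]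
    congr 1
    funext t
    rw [zero_add, hF, ← tsum_mul_left]
    congr 1
    funext m
    simp only [hf, zero_add]
    ring
  rw [h2] at hs
  have h3 := hasSum_single (f := fun m => ∫ t, f m t ∂torusMeasure ι) n fun m hm => by
    rw [h1, entireFourierCoeff_multiChar_of_ne hm, mul_zero]
  rw [← h3.unique hs, h1, entireFourierCoeff_multiChar_self, mul_one]

theorem entireFourierCoeff_sum_mul {κ : Type*} (s : Finset κ) (c : κ → ℂ)
    {G : κ → (ι → ℂ) → ℂ} (hG : ∀ l, Continuous (G l)) (n : ι → ℤ) (w : ι → ℂ) :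
    entireFourierCoeff (fun z => ∑ l ∈ s, c l * G l z) n w =
      ∑ l ∈ s, c l * entireFourierCoeff (G l) n w := by
  simp only [entireFourierCoeff, ← integral_const_mul]
  rw [← integral_finsetSum s fun l _ => (integrable_entireFourierCoeff (hG l) n w).const_mul (c l)]
  congr 1
  funext t
  rw [Finset.mul_sum]
  exact Finset.sum_congr rfl fun l _ => by ring

theorem entireFourierCoeff_sub {G : (ι → ℂ) → ℂ} (hF : Continuous F) (hG : Continuous G)
    (n : ι → ℤ) (w : ι → ℂ) : entireFourierCoeff (fun z => F z - G z) n w =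
      entireFourierCoeff F n w - entireFourierCoeff G n w := by
  simp only [entireFourierCoeff]
  rw [← integral_sub (integrable_entireFourierCoeff hF n w)
    (integrable_entireFourierCoeff hG n w)]
  simp only [mul_sub]

end Fourier

/-! ### Convergence of theta series -/

section Theta

theorem summable_exp_neg_sq_add_abs {c : ℝ} (hc : 0 < c) (R : ℝ) :
    Summable fun m : ℤ => Real.exp (-c * (m : ℝ) ^ 2 + R * |(m : ℝ)|) := by
  have h1 : Summable fun m : ℤ => Real.exp (-|(m : ℝ)|) := by
    refine Summable.of_nat_of_neg ?_ ?_
    · simpa using Real.summable_exp_neg_nat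
    · simpa using Real.summable_exp_neg_nat
  refine Summable.of_nonneg_of_le (fun _ => (Real.exp_pos _).le) (fun m => ?_)
    (h1.mul_left (Real.exp ((R + 1) ^ 2 / (4 * c))))
  rw [← Real.exp_add, Real.exp_le_exp]
  have h2 : 0 ≤ (2 * c * |(m : ℝ)| - (R + 1)) ^ 2 / (4 * c) := by positivity
  have h3 : (2 * c * |(m : ℝ)| - (R + 1)) ^ 2 / (4 * c) =
      c * (m : ℝ) ^ 2 - (R + 1) * |(m : ℝ)| + (R + 1) ^ 2 / (4 * c) := by
    rw [← sq_abs (m : ℝ)]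
    field_simp
    ring
  linarith

theorem sum_prod_apply_le {ι κ : Type*} [Fintype ι] {f : κ → ℝ} (hf : Summable f)
    (h0 : ∀ m, 0 ≤ f m) (u : Finset (ι → κ)) :
    ∑ n ∈ u, ∏ i, f (n i) ≤ ∏ _i : ι, ∑' m, f m := by
  classical
  obtain ⟨T, hT⟩ : ∃ T : Finset κ, ∀ n ∈ u, ∀ i, n i ∈ T :=
    ⟨u.biUnion fun n => Finset.univ.image n, fun n hn i => Finset.mem_biUnion.2
      ⟨n, hn, Finset.mem_image_of_mem n (Finset.mem_univ i)⟩⟩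
  have h1 : ∑ n ∈ u, ∏ i, f (n i) ≤ ∑ n ∈ Fintype.piFinset fun _ : ι => T, ∏ i, f (n i) :=
    Finset.sum_le_sum_of_subset_of_nonneg (fun n hn => Fintype.mem_piFinset.2 (hT n hn))
          fun n _ _ => Finset.prod_nonneg fun i _ => h0 _
  have h2 : ∏ _i : ι, ∑ m ∈ T, f m = ∑ n ∈ Fintype.piFinset fun _ : ι => T, ∏ i, f (n i) :=
    Finset.prod_univ_sum (fun _ : ι => T) fun _ m => f m
  have h3 : ∏ _i : ι, ∑ m ∈ T, f m ≤ ∏ _i : ι, ∑' m, f m :=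
        Finset.prod_le_prod (fun i _ => Finset.sum_nonneg fun m _ => h0 m)
          fun i _ => hf.sum_le_tsum _ fun m _ => h0 m
  rw [h2] at h3
  exact h1.trans h3

/-- A product of summable nonnegative functions of the single coordinates is summable. -/
theorem summable_prod_apply {ι κ : Type*} [Fintype ι] {f : κ → ℝ} (hf : Summable f)
    (h0 : ∀ m, 0 ≤ f m) : Summable fun n : ι → κ => ∏ i, f (n i) :=
  summable_of_sum_le (fun _ => Finset.prod_nonneg fun _ _ => h0 _) (sum_prod_apply_le hf h0)

variable {g : ℕ} {Ω : Matrix (Fin g) (Fin g) ℂ} {k : ℕ}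

/-- A positive definite quadratic form on `ℝ^g` is bounded below by its minimum on the unit
sphere. -/
theorem exists_pos_le_quadratic {Y : Matrix (Fin g) (Fin g) ℝ} (hY : Y.PosDef) :
    ∃ c > 0, ∀ x : Fin g → ℝ, c * ∑ i, x i ^ 2 ≤ ∑ i, ∑ j, x i * Y i j * x j := by
  set q : (Fin g → ℝ) → ℝ := fun x => ∑ i, ∑ j, x i * Y i j * x j with hq
  have hpos : ∀ x, x ≠ 0 → 0 < q x := by
    intro x hx
    have h := hY.dotProduct_mulVec_pos hx
    simpa [dotProduct, Matrix.mulVec, Finset.mul_sum, mul_assoc, hq] using h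
  have hcont : Continuous q := by fun_prop
  set K : Set (Fin g → ℝ) := {x | ∑ i, x i ^ 2 = 1} with hK
  have hKc : IsCompact K := by
    refine Metric.isCompact_of_isClosed_isBounded (isClosed_eq (by fun_prop) continuous_const) ?_
    refine (Metric.isBounded_closedBall (x := (0 : Fin g → ℝ)) (r := 1)).subset fun x hx => ?_
    rw [mem_closedBall_zero_iff, pi_norm_le_iff_of_nonneg zero_le_one]
    intro i
    rw [Real.norm_eq_abs, ← sq_le_one_iff_abs_le_one, ← (show ∑ i, x i ^ 2 = 1 from hx)]
    exact Finset.single_le_sum (f := fun i => x i ^ 2) (fun j _ => sq_nonneg _) (Finset.mem_univ i)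
  have hscale : ∀ x ≠ (0 : Fin g → ℝ), ∃ r : ℝ, 0 < r ∧ r ^ 2 = ∑ i, x i ^ 2 ∧ r⁻¹ • x ∈ K := by
    intro x hx
    have hs : 0 < ∑ i, x i ^ 2 := by
      obtain ⟨i, hi⟩ := Function.ne_iff.mp hx
      exact Finset.sum_pos' (fun j _ => sq_nonneg _) ⟨i, Finset.mem_univ i, by
        have : x i ≠ 0 := hi
        positivity⟩
    refine ⟨√(∑ i, x i ^ 2), Real.sqrt_pos.2 hs, Real.sq_sqrt hs.le, ?_⟩
    simp only [hK, Set.mem_ofPred_eq, Pi.smul_apply, smul_eq_mul, mul_pow, ← Finset.mul_sum]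
    rw [inv_pow, Real.sq_sqrt hs.le, inv_mul_cancel₀ hs.ne']
  have hhom : ∀ (r : ℝ) x, q (r • x) = r ^ 2 * q x := by
    intro r x
    simp only [hq, Pi.smul_apply, smul_eq_mul, Finset.mul_sum]
    exact Finset.sum_congr rfl fun i _ => Finset.sum_congr rfl fun j _ => by ring
  rcases K.eq_empty_or_nonempty with hE | hne
  · refine ⟨1, one_pos, fun x => ?_⟩
    by_cases hx : x = 0
    · simp [hx]
    · obtain ⟨r, -, -, hr⟩ := hscale x hx
      rw [hE] at hr
      exact hr.elim
  · obtain ⟨x₀, hx₀, hmin⟩ := hKc.exists_isMinOn hne hcont.continuousOn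
    have hx₀0 : x₀ ≠ 0 := by
      rintro rfl
      simp [hK] at hx₀
    refine ⟨q x₀, hpos _ hx₀0, fun x => ?_⟩
    by_cases hx : x = 0
    · simp [hx]
    · obtain ⟨r, hr0, hr2, hr⟩ := hscale x hx
      have h1 : q x₀ ≤ q (r⁻¹ • x) := hmin hr
      rw [hhom, inv_pow, ← div_eq_inv_mul, le_div_iff₀ (by positivity), hr2] at h1
      exact h1

/-- The coefficient `exp ((π i / k) m · Ω m)` of the theta series of level `k`. -/
noncomputable def thetaWeight (Ω : Matrix (Fin g) (Fin g) ℂ) (k : ℕ) (m : Fin g → ℤ) : ℂ :=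
  exp (Real.pi * I / k * ∑ i, ∑ j, (m i : ℂ) * Ω i j * (m j : ℂ))

theorem thetaWeight_ne_zero (m : Fin g → ℤ) : thetaWeight Ω k m ≠ 0 := exp_ne_zero _

theorem thetaTerm_eq (l : Fin g → ℤ) (z : Fin g → ℂ) (n : Fin g → ℤ) :
    thetaTerm Ω k l z n = thetaWeight Ω k (l + k • n) * multiChar (l + k • n) z := by
  simp [thetaTerm, thetaWeight, multiChar]

/-- The terms of the theta series are bounded, locally uniformly in `z`, by a product of Gaussian
factors. -/
theorem norm_thetaWeight_mul_multiChar_le {c : ℝ}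
    (hc : ∀ x : Fin g → ℝ, c * ∑ i, x i ^ 2 ≤ ∑ i, ∑ j, x i * (Ω.map im) i j * x j)
    {z : Fin g → ℂ} {R : ℝ} (hz : ‖z‖ ≤ R) (m : Fin g → ℤ) :
    ‖thetaWeight Ω k m * multiChar m z‖ ≤
      ∏ i, Real.exp (-(Real.pi / k * c) * (m i : ℝ) ^ 2 + 2 * Real.pi * R * |(m i : ℝ)|) := by
  rw [thetaWeight, multiChar, ← Complex.exp_add, Complex.norm_exp, ← Real.exp_sum,
    Real.exp_le_exp, Finset.sum_add_distrib, ← Finset.mul_sum, ← Finset.mul_sum, add_re]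
  refine add_le_add ?_ ?_
  · have h1 : (Real.pi * I / k * ∑ i, ∑ j, (m i : ℂ) * Ω i j * (m j : ℂ)).re =
        -(Real.pi / k * ∑ i, ∑ j, (m i : ℝ) * (Ω.map im) i j * (m j : ℝ)) := by
      have h2 : (Real.pi * I / k : ℂ) = ((Real.pi / k : ℝ) : ℂ) * I := by push_cast; ring
      rw [h2, mul_assoc, re_ofReal_mul, I_mul_re, Complex.im_sum]
      simp only [Complex.im_sum, mul_neg, Matrix.map_apply]
      refine congrArg (fun t => -(Real.pi / k * t)) ?_
      refine Finset.sum_congr rfl fun i _ => Finset.sum_congr rfl fun j _ => ?_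
      simp [mul_im]
    rw [h1, neg_mul, neg_le_neg_iff, mul_assoc]
    exact mul_le_mul_of_nonneg_left (hc _) (by positivity)
  · have h1 : (2 * Real.pi * I * ∑ i, (m i : ℂ) * z i).re =
        2 * Real.pi * ∑ i, -((m i : ℝ) * (z i).im) := by
      have h2 : (2 * Real.pi * I : ℂ) = ((2 * Real.pi : ℝ) : ℂ) * I := by push_cast; ring
      rw [h2, mul_assoc, re_ofReal_mul, I_mul_re, Complex.im_sum, ← Finset.sum_neg_distrib]
      simp [mul_im]
    rw [h1, mul_assoc (2 * Real.pi) R]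
    refine mul_le_mul_of_nonneg_left ?_ (show (0 : ℝ) ≤ 2 * Real.pi by positivity)
    rw [Finset.mul_sum]
    refine Finset.sum_le_sum fun i _ => ?_
    calc -((m i : ℝ) * (z i).im) ≤ |(m i : ℝ) * (z i).im| := neg_le_abs _
      _ = |(z i).im| * |(m i : ℝ)| := by rw [abs_mul, mul_comm]
      _ ≤ R * |(m i : ℝ)| := mul_le_mul_of_nonneg_right
        ((abs_im_le_norm _).trans ((norm_le_pi_norm z i).trans hz)) (abs_nonneg _)

theorem summable_thetaBound {c : ℝ} (hc : 0 < c) (hk : 1 ≤ k) (R : ℝ) :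
    Summable fun m : Fin g → ℤ =>
      ∏ i, Real.exp (-(Real.pi / k * c) * (m i : ℝ) ^ 2 + 2 * Real.pi * R * |(m i : ℝ)|) := by
  have hk' : (0 : ℝ) < k := by exact_mod_cast hk
  have h0 : ∀ m : ℤ, 0 ≤ Real.exp (-(Real.pi / k * c) * (m : ℝ) ^ 2 +
      2 * Real.pi * R * |(m : ℝ)|) := fun _ => Real.exp_nonneg _
  have h := summable_prod_apply (ι := Fin g) (summable_exp_neg_sq_add_abs
    (show 0 < Real.pi / k * c by positivity) (2 * Real.pi * R)) h0
  exact h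

theorem summable_norm_thetaWeight_mul_multiChar (hΩ : (Ω.map im).PosDef) (hk : 1 ≤ k)
    (z : Fin g → ℂ) : Summable fun m => ‖thetaWeight Ω k m * multiChar m z‖ := by
  obtain ⟨c, hc0, hc⟩ := exists_pos_le_quadratic hΩ
  exact Summable.of_nonneg_of_le (fun _ => norm_nonneg _)
    (norm_thetaWeight_mul_multiChar_le hc le_rfl) (summable_thetaBound hc0 hk _)

theorem injective_add_nsmul (hk : 1 ≤ k) (l : Fin g → ℤ) :
    Function.Injective fun n : Fin g → ℤ => l + k • n := by
  intro n n' h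
  have hk' : (k : ℤ) ≠ 0 := by exact_mod_cast (by omega : k ≠ 0)
  funext i
  have hi := congrFun h i
  simp only [Pi.add_apply, add_right_inj, nsmul_eq_mul] at hi
  exact mul_left_cancel₀ hk' hi

theorem mem_range_add_nsmul (l n : Fin g → ℤ) :
    n ∈ Set.range (fun m : Fin g → ℤ => l + k • m) ↔ ∀ i, (k : ℤ) ∣ n i - l i := by
  constructor
  · rintro ⟨m, rfl⟩ i
    exact ⟨m i, by simp⟩
  · intro h
    choose m hm using h
    exact ⟨m, funext fun i => by
      change l i + k • m i = n i
      rw [nsmul_eq_mul, ← hm i, add_sub_cancel]⟩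

theorem summable_thetaTerm (hΩ : (Ω.map im).PosDef) (hk : 1 ≤ k) (l : Fin g → ℤ)
    (z : Fin g → ℂ) : Summable (thetaTerm Ω k l z) := by
  have h := (summable_norm_thetaWeight_mul_multiChar hΩ hk z).of_norm.comp_injective
    (injective_add_nsmul hk l)
  exact h.congr fun n => thetaTerm_eq l z n

/-! ### Theta functions as entire functions with automorphy factors -/

theorem hasFDerivAt_multiChar (n : Fin g → ℤ) (z : Fin g → ℂ) :
    HasFDerivAt (multiChar n) (multiChar n z • ((2 * Real.pi * I : ℂ) •
      ∑ i, (n i : ℂ) • (ContinuousLinearMap.proj i : (Fin g → ℂ) →L[ℂ] ℂ))) z := by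
  have h : HasFDerivAt (fun z : Fin g → ℂ => 2 * Real.pi * I * ∑ i, (n i : ℂ) * z i)
      ((2 * Real.pi * I : ℂ) •
        ∑ i, (n i : ℂ) • (ContinuousLinearMap.proj i : (Fin g → ℂ) →L[ℂ] ℂ)) z := by
    refine HasFDerivAt.const_mul (HasFDerivAt.fun_sum fun i _ => ?_) _
    exact (hasFDerivAt_apply i z).const_mul _
  exact h.cexp

theorem differentiable_thetaFun (hΩ : (Ω.map im).PosDef) (hk : 1 ≤ k) (l : Fin g → ℤ) :
    Differentiable ℂ (thetaFun Ω k l) := by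
  intro z
  obtain ⟨c, hc0, hc⟩ := exists_pos_le_quadratic hΩ
  -- the factor `m` from the differentiation is absorbed by enlarging the radius by `1`
  have hlin : ∀ m : Fin g → ℤ, ‖(2 * Real.pi * I : ℂ) •
      ∑ i, (m i : ℂ) • (ContinuousLinearMap.proj i : (Fin g → ℂ) →L[ℂ] ℂ)‖ ≤
        2 * Real.pi * ∏ i, Real.exp |(m i : ℝ)| := by
    intro m
    rw [norm_smul]
    refine mul_le_mul (by simp [abs_of_pos Real.pi_pos]) ?_ (norm_nonneg _) (by positivity)
    calc ‖∑ i, (m i : ℂ) • (ContinuousLinearMap.proj i : (Fin g → ℂ) →L[ℂ] ℂ)‖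
        ≤ ∑ i, |(m i : ℝ)| := by
          refine norm_sum_le_of_le _ fun i _ => ?_
          rw [norm_smul]
          have h1 : ‖(ContinuousLinearMap.proj i : (Fin g → ℂ) →L[ℂ] ℂ)‖ ≤ 1 :=
            ContinuousLinearMap.opNorm_le_bound _ zero_le_one fun x => by
              simpa using norm_le_pi_norm x i
          calc ‖(m i : ℂ)‖ * ‖(ContinuousLinearMap.proj i : (Fin g → ℂ) →L[ℂ] ℂ)‖
              ≤ ‖(m i : ℂ)‖ * 1 := mul_le_mul_of_nonneg_left h1 (norm_nonneg _)
            _ = |(m i : ℝ)| := by simp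
      _ ≤ Real.exp (∑ i, |(m i : ℝ)|) := by
          linarith [Real.add_one_le_exp (∑ i, |(m i : ℝ)|)]
      _ = ∏ i, Real.exp |(m i : ℝ)| := Real.exp_sum _ _
  have hbound : ∀ m : Fin g → ℤ, ∀ w ∈ Metric.ball (0 : Fin g → ℂ) (‖z‖ + 1),
      ‖thetaWeight Ω k m • (multiChar m w • ((2 * Real.pi * I : ℂ) •
        ∑ i, (m i : ℂ) • (ContinuousLinearMap.proj i : (Fin g → ℂ) →L[ℂ] ℂ)))‖ ≤
      2 * Real.pi * ∏ i, Real.exp (-(Real.pi / k * c) * (m i : ℝ) ^ 2 +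
        2 * Real.pi * (‖z‖ + 1 + 1 / (2 * Real.pi)) * |(m i : ℝ)|) := by
    intro m w hw
    have hw' : ‖w‖ ≤ ‖z‖ + 1 := (mem_ball_zero_iff.1 hw).le
    rw [smul_smul, norm_smul]
    calc _ ≤ (∏ i, Real.exp (-(Real.pi / k * c) * (m i : ℝ) ^ 2 +
            2 * Real.pi * (‖z‖ + 1) * |(m i : ℝ)|)) * (2 * Real.pi * ∏ i, Real.exp |(m i : ℝ)|) :=
          mul_le_mul (norm_thetaWeight_mul_multiChar_le hc hw' m) (hlin m) (norm_nonneg _)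
            (Finset.prod_nonneg fun i _ => (Real.exp_pos _).le)
      _ = _ := by
          rw [mul_left_comm, ← Finset.prod_mul_distrib]
          congr 1
          refine Finset.prod_congr rfl fun i _ => ?_
          rw [← Real.exp_add]
          congr 1
          field_simp
          ring
  have hsum := ((summable_thetaBound (g := g) hc0 hk
    (‖z‖ + 1 + 1 / (2 * Real.pi))).mul_left (2 * Real.pi)).comp_injective
      (injective_add_nsmul hk l)
  have hz : z ∈ Metric.ball (0 : Fin g → ℂ) (‖z‖ + 1) := by simp
  have h := hasFDerivAt_tsum_of_isPreconnected (𝕜 := ℂ) hsum Metric.isOpen_ball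
    (convex_ball (0 : Fin g → ℂ) (‖z‖ + 1)).isPreconnected
    (f := fun n z => thetaWeight Ω k (l + k • n) * multiChar (l + k • n) z)
    (fun n w _ => (hasFDerivAt_multiChar (l + k • n) w).const_mul (thetaWeight Ω k (l + k • n)))
    (fun n w hw => hbound (l + k • n) w hw) hz
    ((summable_thetaTerm hΩ hk l z).congr fun n => (thetaTerm_eq l z n).symm) hz
  have heq : thetaFun Ω k l =
      fun y => ∑' n, thetaWeight Ω k (l + k • n) * multiChar (l + k • n) y := by
    funext y
    exact tsum_congr fun n => thetaTerm_eq l y n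
  rw [heq]
  exact h.differentiableAt

theorem thetaFun_add_intCast (l : Fin g → ℤ) : IsIntPeriodic (thetaFun Ω k l) := fun z n =>
  tsum_congr fun m => by rw [thetaTerm_eq, thetaTerm_eq, isIntPeriodic_multiChar]

/-- The weights are quasi-periodic, by completing the square. -/
theorem thetaWeight_add_single (hS : Ω.IsSymm) (hk : 1 ≤ k) (m : Fin g → ℤ) (j : Fin g) :
    thetaWeight Ω k (m + k • Pi.single j 1) =
      exp (Real.pi * I * k * Ω j j) * multiChar m (fun i => Ω i j) * thetaWeight Ω k m := by
  have hk' : (k : ℂ) ≠ 0 := by exact_mod_cast (by omega : k ≠ 0)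
  rw [thetaWeight, thetaWeight, multiChar, ← Complex.exp_add, ← Complex.exp_add]
  congr 1
  have h1 : ∀ i, (((m + k • Pi.single j 1 : Fin g → ℤ) i : ℤ) : ℂ) =
      (m i : ℂ) + if i = j then (k : ℂ) else 0 := by
    intro i
    by_cases h : i = j
    · subst h; simp
    · simp [h]
  simp only [h1, add_mul, mul_add, Finset.sum_add_distrib, ite_mul, mul_ite, zero_mul, mul_zero,
    Finset.sum_ite_eq', Finset.sum_ite_irrel, Finset.sum_const_zero, Finset.mem_univ, if_true]
  have h2 : ∑ i, (k : ℂ) * Ω j i * (m i : ℂ) = k * ∑ i, (m i : ℂ) * Ω i j := by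
    rw [Finset.mul_sum]
    exact Finset.sum_congr rfl fun i _ => by rw [hS.apply]; ring
  have h3 : ∑ i, (m i : ℂ) * Ω i j * (k : ℂ) = k * ∑ i, (m i : ℂ) * Ω i j := by
    rw [Finset.mul_sum]
    exact Finset.sum_congr rfl fun i _ => by ring
  rw [h2, h3]
  field_simp
  ring

theorem multiChar_nsmul_single (k : ℕ) (j : Fin g) (z : Fin g → ℂ) :
    multiChar (k • Pi.single j 1) z = exp (2 * Real.pi * I * k * z j) := by
  rw [multiChar, Finset.sum_eq_single j]
  · simp; ring_nf
  · intro i _ hi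
    simp [hi]
  · simp

/-- Theta functions of level `k`: entire functions with the automorphy factors of the lattice
`ℤ^g + Ω ℤ^g` which represent the sections of `L ^ k`. -/
def IsThetaFunction (Ω : Matrix (Fin g) (Fin g) ℂ) (k : ℕ) (F : (Fin g → ℂ) → ℂ) : Prop :=
  Differentiable ℂ F ∧ (∀ z j, F (z + Pi.single j 1) = F z) ∧
    ∀ z j, F (z + fun i => Ω i j) =
      exp (-(2 * Real.pi * I * k * z j) - Real.pi * I * k * Ω j j) * F z

theorem IsThetaFunction.isIntPeriodic {F : (Fin g → ℂ) → ℂ} (hF : IsThetaFunction Ω k F) :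
    IsIntPeriodic F := apply_add_intCast_of_single hF.2.1

theorem isThetaFunction_thetaFun (hS : Ω.IsSymm) (hΩ : (Ω.map im).PosDef) (hk : 1 ≤ k)
    (l : Fin g → ℤ) : IsThetaFunction Ω k (thetaFun Ω k l) := by
  refine ⟨differentiable_thetaFun hΩ hk l, fun z j => ?_, fun z j => ?_⟩
  · rw [← thetaFun_add_intCast l z (Pi.single j 1)]
    congr 2
    funext i
    by_cases h : i = j
    · subst h; simp
    · simp [h]
  · have h1 : ∀ n, thetaTerm Ω k l (z + fun i => Ω i j) n =
        exp (-(2 * Real.pi * I * k * z j) - Real.pi * I * k * Ω j j) *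
          thetaTerm Ω k l z (n + Pi.single j 1) := by
      intro n
      rw [thetaTerm_eq, thetaTerm_eq, smul_add, ← add_assoc, thetaWeight_add_single hS hk,
        multiChar_add_right, multiChar_add_left _ (k • Pi.single j 1), multiChar_nsmul_single,
        sub_eq_add_neg, Complex.exp_add, Complex.exp_neg, Complex.exp_neg]
      have e1 := Complex.exp_ne_zero (2 * Real.pi * I * k * z j)
      have e2 := Complex.exp_ne_zero (Real.pi * I * k * Ω j j)
      field_simp
    rw [thetaFun, thetaFun, tsum_congr h1, tsum_mul_left]
    congr 1
    exact (Equiv.addRight (Pi.single j 1 : Fin g → ℤ)).tsum_eq (thetaTerm Ω k l z)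

open Classical in
theorem entireFourierCoeff_thetaFun (hΩ : (Ω.map im).PosDef) (hk : 1 ≤ k) (l n : Fin g → ℤ) :
    entireFourierCoeff (thetaFun Ω k l) n 0 =
      if ∀ i, (k : ℤ) ∣ n i - l i then thetaWeight Ω k n else 0 := by
  set a : (Fin g → ℤ) → ℂ := fun n => if ∀ i, (k : ℤ) ∣ n i - l i then thetaWeight Ω k n else 0
    with ha
  refine entireFourierCoeff_tsum (a := a) ?_ (fun x => ?_) n
  · refine Summable.of_nonneg_of_le (fun _ => norm_nonneg _) (fun m => ?_)
      (summable_norm_thetaWeight_mul_multiChar hΩ hk 0)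
    rw [multiChar_zero_right, mul_one, ha]
    dsimp only
    split_ifs
    · exact le_rfl
    · simp
  · have hinj := injective_add_nsmul (g := g) hk l
    rw [← hinj.tsum_eq]
    · refine tsum_congr fun m => ?_
      have h : ∀ i, (k : ℤ) ∣ (l + k • m) i - l i :=
        (mem_range_add_nsmul l (l + k • m)).1 ⟨m, rfl⟩
      rw [thetaTerm_eq, ha]
      simp only [if_pos h]
    · intro m hm
      rw [mem_range_add_nsmul]
      by_contra h
      exact hm (by simp only [ha, if_neg h, zero_mul])

/-- The quasi-periodicity of a theta function as a recursion for its Fourier coefficients. -/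
theorem IsThetaFunction.entireFourierCoeff_add_single {F : (Fin g → ℂ) → ℂ}
    (hF : IsThetaFunction Ω k F) (n : Fin g → ℤ) (j : Fin g) :
    entireFourierCoeff F (n + k • Pi.single j 1) 0 =
      exp (Real.pi * I * k * Ω j j) * multiChar n (fun i => Ω i j) * entireFourierCoeff F n 0 := by
  have h1 := entireFourierCoeff_eq hF.1 hF.isIntPeriodic n (fun i => Ω i j)
  rw [mul_assoc, ← h1, entireFourierCoeff, entireFourierCoeff, ← MeasureTheory.integral_const_mul]
  congr 1
  funext t
  rw [zero_add, add_comm _ (realVec (torusRep t)), hF.2.2, neg_add, multiChar_add_left,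
    sub_eq_add_neg, Complex.exp_add, Complex.exp_neg (Real.pi * I * k * Ω j j),
    Complex.exp_neg, ← multiChar_nsmul_single]
  have e2 := Complex.exp_ne_zero (Real.pi * I * k * Ω j j)
  have e3 := multiChar_neg_mul_self (k • Pi.single j 1) (realVec (torusRep t))
  rw [eq_inv_of_mul_eq_one_left e3]
  field_simp

/-- The recursion is solved by the weights: the quotient depends only on the residue class of the
index modulo `k`. -/
theorem IsThetaFunction.entireFourierCoeff_div_thetaWeight (hS : Ω.IsSymm) (hk : 1 ≤ k)
    {F : (Fin g → ℂ) → ℂ} (hF : IsThetaFunction Ω k F) (n m : Fin g → ℤ) :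
    entireFourierCoeff F (n + k • m) 0 / thetaWeight Ω k (n + k • m) =
      entireFourierCoeff F n 0 / thetaWeight Ω k n := by
  have h := apply_add_intCast_of_single (ι := Fin g) (R := ℤ)
    (f := fun m => entireFourierCoeff F (n + k • m) 0 / thetaWeight Ω k (n + k • m))
    (fun m j => by
      rw [smul_add, ← add_assoc, hF.entireFourierCoeff_add_single, thetaWeight_add_single hS hk]
      have e1 := Complex.exp_ne_zero (Real.pi * I * k * Ω j j)
      have e2 := multiChar_ne_zero (n + k • m) (fun i => Ω i j)
      have e3 := thetaWeight_ne_zero (Ω := Ω) (k := k) (n + k • m)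
      field_simp) 0 m
  simpa using h

/-- The theta functions with characteristics of level `k` span the theta functions of level
`k`. -/
theorem IsThetaFunction.eq_sum (hS : Ω.IsSymm) (hΩ : (Ω.map im).PosDef) (hk : 1 ≤ k)
    {F : (Fin g → ℂ) → ℂ} (hF : IsThetaFunction Ω k F) :
    ∃ c : (Fin g → Fin k) → ℂ, ∀ z, F z = ∑ r, c r * thetaFun Ω k (fun i => ((r i : ℕ) : ℤ)) z := by
  classical
  set c : (Fin g → Fin k) → ℂ := fun r => entireFourierCoeff F (fun i => ((r i : ℕ) : ℤ)) 0 /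
    thetaWeight Ω k (fun i => ((r i : ℕ) : ℤ)) with hc
  have hθ := fun l : Fin g → ℤ => isThetaFunction_thetaFun hS hΩ hk l
  set S : (Fin g → ℂ) → ℂ := fun z => ∑ r, c r * thetaFun Ω k (fun i => ((r i : ℕ) : ℤ)) z
    with hSdef
  have hSd : Differentiable ℂ S :=
    Differentiable.fun_sum fun r _ => (hθ _).1.const_mul (c r)
  refine ⟨c, fun z => ?_⟩
  rw [← sub_eq_zero]
  refine eq_zero_of_entireFourierCoeff_eq_zero (F := fun z => F z - S z) (hF.1.sub hSd)
    (fun z n => ?_) (fun n => ?_) z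
  · have h1 : S (z + fun i => (n i : ℂ)) = S z :=
      Finset.sum_congr rfl fun r _ => by rw [(hθ _).isIntPeriodic]
    simp only [hF.isIntPeriodic z n, h1]
  · rw [entireFourierCoeff_sub hF.1.continuous hSd.continuous, hSdef,
      entireFourierCoeff_sum_mul _ _ (fun r => (hθ _).1.continuous), sub_eq_zero]
    -- only the residue class of `n` contributes
    have hkz : (0 : ℤ) < k := by exact_mod_cast hk
    set r₀ : Fin g → Fin k := fun i => ⟨(n i % k).toNat, by
      have := Int.emod_lt_of_pos (n i) hkz
      have := Int.emod_nonneg (n i) hkz.ne'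
      omega⟩ with hr₀
    have hr₀' : ∀ i, (((r₀ i : ℕ) : ℤ)) = n i % k := fun i =>
      Int.toNat_of_nonneg (Int.emod_nonneg (n i) hkz.ne')
    rw [Finset.sum_eq_single r₀]
    · have hdvd : ∀ i, (k : ℤ) ∣ n i - ((r₀ i : ℕ) : ℤ) := fun i => by
        rw [hr₀']; exact Int.dvd_self_sub_emod
      rw [entireFourierCoeff_thetaFun hΩ hk, if_pos hdvd, hc]
      obtain ⟨m, hm⟩ := (mem_range_add_nsmul (fun i => ((r₀ i : ℕ) : ℤ)) n).2 hdvd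
      have h := hF.entireFourierCoeff_div_thetaWeight hS hk (fun i => ((r₀ i : ℕ) : ℤ)) m
      have hm' : (fun i => ((r₀ i : ℕ) : ℤ)) + k • m = n := hm
      rw [hm'] at h
      dsimp only
      rw [← h, div_mul_cancel₀ _ (thetaWeight_ne_zero n)]
    · intro r _ hr
      rw [entireFourierCoeff_thetaFun hΩ hk, if_neg, mul_zero]
      intro hdvd
      apply hr
      funext i
      apply Fin.ext
      have h1 : ((r i : ℕ) : ℤ) % k = n i % k :=
        Int.modEq_iff_dvd.2 (hdvd i)
      rw [Int.emod_eq_of_lt (by positivity) (by exact_mod_cast (r i).2), ← hr₀'] at h1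
      exact_mod_cast h1
    · simp

end Theta

/-! ### Theta distributions and their coherent state transforms -/

section Distributions

variable {g : ℕ} {k : ℕ}

theorem levelDelta_apply (h : (Fin g → ℝ) → ℂ) (f : TorusTest g) :
    levelDelta k h f = ((k : ℂ) ^ g)⁻¹ * ∑ m : Fin g → Fin k,
      h (fun i => ((m i : ℕ) : ℝ) / k) * (f : (Fin g → ℝ) → ℂ) fun i => ((m i : ℕ) : ℝ) / k := by
  simp [levelDelta, torusDelta]

theorem torusChar_apply (n : Fin g → ℤ) (x : Fin g → ℝ) :
    (torusChar n : (Fin g → ℝ) → ℂ) x = multiChar n (realVec x) := rfl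

theorem levelDelta_const_mul (c : ℂ) (h : (Fin g → ℝ) → ℂ) :
    levelDelta k (fun x => c * h x) = c • levelDelta k h := by
  refine LinearMap.ext fun f => ?_
  rw [LinearMap.smul_apply, levelDelta_apply, levelDelta_apply, smul_eq_mul, mul_left_comm]
  congr 1
  rw [Finset.mul_sum]
  simp only [mul_assoc]

theorem isTorusDistribution_thetaDist (hk : 1 ≤ k) (l : Fin g → ℤ) :
    IsTorusDistribution (thetaDist k l) := by
  have hk' : (0 : ℝ) < k := by exact_mod_cast hk
  refine ⟨0, 1, fun f M hM => ?_⟩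
  have hM' : ∀ x, ‖(f : (Fin g → ℝ) → ℂ) x‖ ≤ M := fun x => by
    simpa using hM 0 le_rfl x
  rw [thetaDist, levelDelta_apply, norm_mul, norm_inv, norm_pow, Complex.norm_natCast, one_mul]
  have h1 : ‖∑ m : Fin g → Fin k, (torusChar l : (Fin g → ℝ) → ℂ) (fun i => ((m i : ℕ) : ℝ) / k) *
      (f : (Fin g → ℝ) → ℂ) fun i => ((m i : ℕ) : ℝ) / k‖ ≤ ∑ _m : Fin g → Fin k, M := by
    refine norm_sum_le_of_le _ fun m _ => ?_
    rw [norm_mul, torusChar_apply, norm_multiChar_realVec, one_mul]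
    exact hM' _
  have h2 : ∑ _m : Fin g → Fin k, M = (k : ℝ) ^ g * M := by simp
  rw [h2] at h1
  rw [inv_mul_le_iff₀ (by positivity)]
  exact h1

theorem exp_two_pi_div_eq_one_iff (hk : 1 ≤ k) (d : ℤ) :
    exp (2 * Real.pi * I * (d / k)) = 1 ↔ (k : ℤ) ∣ d := by
  have hk' : (k : ℂ) ≠ 0 := by exact_mod_cast (by omega : k ≠ 0)
  rw [Complex.exp_eq_one_iff]
  refine exists_congr fun m => ?_
  rw [mul_comm (m : ℂ), mul_right_inj' (by simp [Real.pi_ne_zero]), div_eq_iff hk']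
  rw [mul_comm]
  exact_mod_cast Iff.rfl

/-- Orthogonality of the characters of `ℤ / k`. -/
theorem sum_exp_two_pi_div (hk : 1 ≤ k) (d : ℤ) :
    ∑ a : Fin k, exp (2 * Real.pi * I * (d * (((a : ℕ) : ℝ) / k : ℝ))) =
      if (k : ℤ) ∣ d then (k : ℂ) else 0 := by
  have hk' : (k : ℂ) ≠ 0 := by exact_mod_cast (by omega : k ≠ 0)
  set ζ := exp (2 * Real.pi * I * (d / k)) with hζ
  have h1 : ∀ a : Fin k, exp (2 * Real.pi * I * (d * (((a : ℕ) : ℝ) / k : ℝ))) = ζ ^ (a : ℕ) := by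
    intro a
    rw [hζ, ← Complex.exp_nat_mul]
    congr 1
    push_cast
    ring
  rw [Finset.sum_congr rfl fun a _ => h1 a, Fin.sum_univ_eq_sum_range (fun a => ζ ^ a) k]
  split_ifs with h
  · rw [show ζ = 1 from (exp_two_pi_div_eq_one_iff hk d).2 h]
    simp
  · have hne : ζ ≠ 1 := fun h' => h ((exp_two_pi_div_eq_one_iff hk d).1 h')
    have hpow : ζ ^ k = 1 := by
      rw [hζ, ← Complex.exp_nat_mul, Complex.exp_eq_one_iff]
      exact ⟨d, by field_simp⟩
    rw [geom_sum_eq hne, hpow, sub_self, zero_div]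

open Classical in
theorem torusFourierCoeff_thetaDist (hk : 1 ≤ k) (l n : Fin g → ℤ) :
    torusFourierCoeff (thetaDist k l) n = if ∀ i, (k : ℤ) ∣ n i - l i then 1 else 0 := by
  have hk' : (k : ℂ) ≠ 0 := by exact_mod_cast (by omega : k ≠ 0)
  have h1 : ∀ m : Fin g → Fin k,
      (torusChar l : (Fin g → ℝ) → ℂ) (fun i => ((m i : ℕ) : ℝ) / k) *
        (torusChar (-n) : (Fin g → ℝ) → ℂ) (fun i => ((m i : ℕ) : ℝ) / k) =
      ∏ i, exp (2 * Real.pi * I * (((l i - n i : ℤ) : ℂ) * (((m i : ℕ) : ℝ) / k : ℝ))) := by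
    intro m
    rw [torusChar_apply, torusChar_apply, ← multiChar_add_left, multiChar, Finset.mul_sum,
      Complex.exp_sum]
    rfl
  have h2 := Finset.prod_univ_sum (fun _ : Fin g => (Finset.univ : Finset (Fin k))) fun i a =>
    exp (2 * Real.pi * I * (((l i - n i : ℤ) : ℂ) * (((a : ℕ) : ℝ) / k : ℝ)))
  rw [Fintype.piFinset_univ] at h2
  rw [torusFourierCoeff, thetaDist, levelDelta_apply, Finset.sum_congr rfl fun m _ => h1 m, ← h2,
    Finset.prod_congr rfl fun i _ => sum_exp_two_pi_div hk (l i - n i)]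
  split_ifs with h
  · rw [Finset.prod_congr rfl fun i _ => if_pos (dvd_sub_comm.1 (h i))]
    simp [hk']
  · push Not at h
    obtain ⟨i, hi⟩ := h
    rw [Finset.prod_eq_zero (Finset.mem_univ i) (if_neg fun h' => hi (dvd_sub_comm.1 h')),
      mul_zero]

theorem exp_laplaceEigenvalue (Ω : Matrix (Fin g) (Fin g) ℂ) (k : ℕ) (n : Fin g → ℤ) :
    exp (((1 / k : ℝ) : ℂ) / 2 * laplaceEigenvalue Ω n) = thetaWeight Ω k n := by
  rw [thetaWeight, laplaceEigenvalue]
  congr 1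
  have h : ∀ i j, -I * Ω i j / (2 * Real.pi) * (2 * Real.pi * I * n i) * (2 * Real.pi * I * n j) =
      (2 * Real.pi * I) * ((n i : ℂ) * Ω i j * n j) := by
    intro i j
    have hpi : (Real.pi : ℂ) ≠ 0 := by simp [Real.pi_ne_zero]
    field_simp
    rw [I_sq]
    ring
  simp only [h, ← Finset.mul_sum]
  push_cast
  ring

theorem cstTerm_add_nsmul {Ω : Matrix (Fin g) (Fin g) ℂ} (hk : 1 ≤ k) (l : Fin g → ℤ)
    (z : Fin g → ℂ) (n : Fin g → ℤ) :
    cstTerm Ω (1 / k) (thetaDist k l) z (l + k • n) = thetaTerm Ω k l z n := by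
  rw [cstTerm, torusFourierCoeff_thetaDist hk, if_pos ((mem_range_add_nsmul l _).1 ⟨n, rfl⟩),
    one_mul, exp_laplaceEigenvalue, thetaTerm_eq]
  rfl

theorem cstTerm_eq_zero {Ω : Matrix (Fin g) (Fin g) ℂ} (hk : 1 ≤ k) (l : Fin g → ℤ)
    (z : Fin g → ℂ) {n : Fin g → ℤ} (hn : n ∉ Set.range fun m : Fin g → ℤ => l + k • m) :
    cstTerm Ω (1 / k) (thetaDist k l) z n = 0 := by
  rw [mem_range_add_nsmul] at hn
  rw [cstTerm, torusFourierCoeff_thetaDist hk, if_neg hn, zero_mul, zero_mul]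

theorem summable_cstTerm {Ω : Matrix (Fin g) (Fin g) ℂ} (hΩ : (Ω.map im).PosDef) (hk : 1 ≤ k)
    (l : Fin g → ℤ) (z : Fin g → ℂ) : Summable (cstTerm Ω (1 / k) (thetaDist k l) z) := by
  rw [← (injective_add_nsmul hk l).summable_iff fun n hn => cstTerm_eq_zero hk l z hn]
  exact (summable_thetaTerm hΩ hk l z).congr fun n => (cstTerm_add_nsmul hk l z n).symm

theorem coherentStateTransform_thetaDist {Ω : Matrix (Fin g) (Fin g) ℂ} (hk : 1 ≤ k)
    (l : Fin g → ℤ) : coherentStateTransform Ω (1 / k) (thetaDist k l) = thetaFun Ω k l := by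
  funext z
  rw [coherentStateTransform, thetaFun, ← (injective_add_nsmul hk l).tsum_eq]
  · exact tsum_congr fun n => cstTerm_add_nsmul hk l z n
  · intro n hn
    by_contra h
    exact hn (cstTerm_eq_zero hk l z h)

theorem coherentStateTransform_smul (Ω : Matrix (Fin g) (Fin g) ℂ) (t : ℝ) (c : ℂ)
    (T : TorusTest g →ₗ[ℂ] ℂ) :
    coherentStateTransform Ω t (c • T) = c • coherentStateTransform Ω t T := by
  funext z
  rw [Pi.smul_apply, coherentStateTransform, coherentStateTransform, smul_eq_mul, ← tsum_mul_left]
  refine tsum_congr fun n => ?_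
  simp only [cstTerm, torusFourierCoeff, LinearMap.smul_apply, smul_eq_mul]
  ring

end Distributions

/-! ### Lagrangian decompositions of unimodular symplectic lattices -/

section SymplecticLattice

/-- A unimodular alternating form over `ℤ` has a decomposition into two isotropic summands, by
splitting off hyperbolic planes. -/
theorem exists_isCompl_isotropic (r : ℕ) : ∀ (M : Type*) [AddCommGroup M] [Module.Free ℤ M]
    [Module.Finite ℤ M] (ψ : M →ₗ[ℤ] M →ₗ[ℤ] ℤ), (∀ x, ψ x x = 0) →
    (∀ f : M →ₗ[ℤ] ℤ, ∃ u, ψ u = f) → finrank ℤ M = r →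
    ∃ P N : Submodule ℤ M, IsCompl P N ∧ (∀ x ∈ P, ∀ y ∈ P, ψ x y = 0) ∧
      ∀ x ∈ N, ∀ y ∈ N, ψ x y = 0 := by
  induction r using Nat.strong_induction_on with
  | _ r ih =>
    intro M _ _ _ ψ halt hsurj hr
    have hskew : ∀ x y, ψ x y = -ψ y x := fun x y => by
      have h := halt (x + y)
      simp only [map_add, LinearMap.add_apply, halt, zero_add, add_zero] at h
      linarith
    rcases Nat.eq_zero_or_pos r with h0 | hpos
    · have hM : ∀ x : M, x = 0 := by
        have : Subsingleton M := by
          rw [← finrank_eq_zero_iff_of_free (R := ℤ)]; omega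
        exact fun x => Subsingleton.elim _ _
      exact ⟨⊤, ⊥, isCompl_top_bot, fun x _ y _ => by rw [hM x]; simp,
        fun x _ y _ => by rw [hM x]; simp⟩
    · -- a hyperbolic pair `(u, e)`
      let bas := Module.finBasisOfFinrankEq ℤ M hr
      obtain ⟨u, hu⟩ := hsurj (bas.coord ⟨0, hpos⟩)
      set e := bas ⟨0, hpos⟩ with he
      have hue : ψ u e = 1 := by rw [hu]; simp [he]
      have heu : ψ e u = -1 := by rw [hskew, hue]
      let M' : Submodule ℤ M := LinearMap.ker (ψ u) ⊓ LinearMap.ker (ψ e)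
      have hM' : ∀ x, x ∈ M' ↔ ψ u x = 0 ∧ ψ e x = 0 := fun x => Iff.rfl
      have hM'u : ∀ x ∈ M', ψ x u = 0 := fun x hx => by rw [hskew, ((hM' x).1 hx).1, neg_zero]
      have hM'e : ∀ x ∈ M', ψ x e = 0 := fun x hx => by rw [hskew, ((hM' x).1 hx).2, neg_zero]
      let proj : M →ₗ[ℤ] M := LinearMap.id - (ψ u).smulRight e + (ψ e).smulRight u
      have hproj : ∀ x, proj x = x - ψ u x • e + ψ e x • u := fun x => rfl
      have hprojM : ∀ x, proj x ∈ M' := by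
        intro x
        rw [hM', hproj]
        simp [hue, heu, halt]
      have hrank : finrank ℤ M' < r := by
        have h1 : finrank ℤ M' ≤ finrank ℤ (LinearMap.ker (ψ u)) :=
          Submodule.finrank_mono inf_le_left
        have h2 := Submodule.finrank_quotient_add_finrank (LinearMap.ker (ψ u))
        have hs : Function.Surjective (ψ u) := fun a => ⟨a • e, by simp [hue]⟩
        have h3 := ((ψ u).quotKerEquivOfSurjective hs).finrank_eq
        rw [finrank_self] at h3
        omega
      obtain ⟨P, N, hPN, hP, hN⟩ := ih _ hrank M' ((ψ.compl₁₂ M'.subtype M'.subtype))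
        (fun x => halt x) (fun f => by
          obtain ⟨w, hw⟩ := hsurj (f.comp (proj.codRestrict M' hprojM))
          refine ⟨⟨proj w, hprojM w⟩, LinearMap.ext fun x => ?_⟩
          have h1 : ψ (proj w) x = ψ w x := by
            rw [hproj]
            simp [((hM' _).1 x.2).1, ((hM' _).1 x.2).2]
          have h2 : proj.codRestrict M' hprojM x = x := by
            apply Subtype.ext
            rw [LinearMap.codRestrict_apply, hproj, ((hM' _).1 x.2).1, ((hM' _).1 x.2).2]
            simp
          change ψ (proj w) x = f x
          rw [h1, hw, LinearMap.comp_apply, h2]) rfl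
      have hPle : ∀ x ∈ P.map M'.subtype, x ∈ M' := by
        rintro _ ⟨x, -, rfl⟩; exact x.2
      have hNle : ∀ x ∈ N.map M'.subtype, x ∈ M' := by
        rintro _ ⟨x, -, rfl⟩; exact x.2
      refine ⟨P.map M'.subtype ⊔ Submodule.span ℤ {u}, N.map M'.subtype ⊔ Submodule.span ℤ {e},
        ⟨?_, ?_⟩, ?_, ?_⟩
      · rw [Submodule.disjoint_def]
        intro x hx hx'
        obtain ⟨p, hp, c, hc, rfl⟩ := Submodule.mem_sup.1 hx
        obtain ⟨n, hn, d, hd, hnd⟩ := Submodule.mem_sup.1 hx'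
        obtain ⟨c, rfl⟩ := Submodule.mem_span_singleton.1 hc
        obtain ⟨d, rfl⟩ := Submodule.mem_span_singleton.1 hd
        have h1 := congrArg (ψ u) hnd
        have h2 := congrArg (ψ e) hnd
        simp only [map_add, map_smul, halt, hue, heu, ((hM' _).1 (hPle p hp)).1,
          ((hM' _).1 (hPle p hp)).2, ((hM' _).1 (hNle n hn)).1, ((hM' _).1 (hNle n hn)).2] at h1 h2
        have hd0 : d = 0 := by simpa using h1
        have hc0 : c = 0 := by simpa using h2.symm
        subst hd0 hc0
        simp only [zero_smul, add_zero] at hnd ⊢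
        obtain ⟨p, hp, rfl⟩ := hp
        obtain ⟨n, hn, rfl⟩ := hn
        have : n = p := Subtype.ext hnd
        subst this
        rw [Submodule.disjoint_def.1 hPN.disjoint n hp hn, map_zero]
      · rw [codisjoint_iff, eq_top_iff]
        intro x _
        obtain ⟨p, hp, n, hn, hpn⟩ := Submodule.mem_sup.1
          (hPN.sup_eq_top ▸ Submodule.mem_top : (⟨proj x, hprojM x⟩ : M') ∈ P ⊔ N)
        have hpn' : (p : M) + n = proj x := congrArg Subtype.val hpn
        have hx2 : x = ((p : M) + (-ψ e x) • u) + (n + ψ u x • e) := by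
          rw [add_add_add_comm, hpn', hproj, neg_smul]; abel
        rw [hx2]
        refine Submodule.add_mem_sup (Submodule.add_mem_sup ?_ ?_) (Submodule.add_mem_sup ?_ ?_)
        · exact ⟨p, hp, rfl⟩
        · exact Submodule.mem_span_singleton.2 ⟨_, rfl⟩
        · exact ⟨n, hn, rfl⟩
        · exact Submodule.mem_span_singleton.2 ⟨_, rfl⟩
      · intro x hx y hy
        obtain ⟨p, hp, c, hc, rfl⟩ := Submodule.mem_sup.1 hx
        obtain ⟨q, hq, d, hd, rfl⟩ := Submodule.mem_sup.1 hy
        obtain ⟨c, rfl⟩ := Submodule.mem_span_singleton.1 hc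
        obtain ⟨d, rfl⟩ := Submodule.mem_span_singleton.1 hd
        have h1 : ψ p q = 0 := by
          obtain ⟨p, hp, rfl⟩ := hp
          obtain ⟨q, hq, rfl⟩ := hq
          exact hP p hp q hq
        simp [h1, halt, hM'u p (hPle p hp), ((hM' _).1 (hPle q hq)).1]
      · intro x hx y hy
        obtain ⟨p, hp, c, hc, rfl⟩ := Submodule.mem_sup.1 hx
        obtain ⟨q, hq, d, hd, rfl⟩ := Submodule.mem_sup.1 hy
        obtain ⟨c, rfl⟩ := Submodule.mem_span_singleton.1 hc
        obtain ⟨d, rfl⟩ := Submodule.mem_span_singleton.1 hd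
        have h1 : ψ p q = 0 := by
          obtain ⟨p, hp, rfl⟩ := hp
          obtain ⟨q, hq, rfl⟩ := hq
          exact hN p hp q hq
        simp [h1, halt, hM'e p (hNle p hp), ((hM' _).1 (hNle q hq)).2]

end SymplecticLattice

namespace PPAV

variable {V : Type*} [NormedAddCommGroup V] [NormedSpace ℂ V] [FiniteDimensional ℂ V]
  (A : PPAV V)

theorem E_skew (v w : V) : A.E v w = -A.E w v := by
  have h := A.alternating (v + w)
  simp only [map_add, LinearMap.add_apply, A.alternating, zero_add, add_zero] at h
  linarith

theorem E_I_symm (v w : V) : A.E (I • v) w = A.E (I • w) v := by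
  have h := A.invariant (I • v) w
  rw [smul_smul, I_mul_I, neg_one_smul, map_neg, LinearMap.neg_apply] at h
  rw [← h, A.E_skew, neg_neg]

/-- The Riemann form is nondegenerate. -/
theorem eq_zero_of_E_eq_zero {v : V} (h : ∀ w, A.E v w = 0) : v = 0 := by
  by_contra hv
  have h1 := A.positive v hv
  rw [A.E_skew, h, neg_zero] at h1
  exact lt_irrefl _ h1

theorem eq_zero_of_E_lattice_eq_zero {v : V} (h : ∀ w ∈ A.lattice, A.E v w = 0) : v = 0 := by
  refine A.eq_zero_of_E_eq_zero fun w => ?_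
  have hle : Submodule.span ℝ (A.lattice : Set V) ≤ LinearMap.ker (A.E v) :=
    Submodule.span_le.2 fun w hw => h w hw
  exact hle (A.span_lattice ▸ Submodule.mem_top)

/-- The integral value of the Riemann form at two periods. -/
noncomputable def latticeVal (u v : A.lattice) : ℤ := (A.integral u u.2 v v.2).choose

theorem latticeVal_cast (u v : A.lattice) : (A.latticeVal u v : ℝ) = A.E u v :=
  (A.integral u u.2 v v.2).choose_spec.symm

/-- The Riemann form on the lattice, with integral values. -/
noncomputable def latticePairing : A.lattice →ₗ[ℤ] A.lattice →ₗ[ℤ] ℤ :=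
  LinearMap.mk₂ ℤ A.latticeVal
    (fun u u' v => Int.cast_injective (α := ℝ) (by simp [latticeVal_cast]))
    (fun c u v => Int.cast_injective (α := ℝ) (by simp [latticeVal_cast]))
    (fun u v v' => Int.cast_injective (α := ℝ) (by simp [latticeVal_cast]))
    (fun c u v => Int.cast_injective (α := ℝ) (by simp [latticeVal_cast]))

theorem latticePairing_cast (u v : A.lattice) : (A.latticePairing u v : ℝ) = A.E u v :=
  A.latticeVal_cast u v

theorem nonempty_lagrangianDecomposition : Nonempty (LagrangianDecomposition A) := by
  have := A.discrete
  obtain ⟨P, N, hPN, hP, hN⟩ := exists_isCompl_isotropic _ A.lattice A.latticePairing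
    (fun x => by
      apply Int.cast_injective (α := ℝ)
      rw [latticePairing_cast, A.alternating, Int.cast_zero])
    (fun f => by
      obtain ⟨u, hu, h⟩ := A.unimodular f
      refine ⟨⟨u, hu⟩, LinearMap.ext fun v => ?_⟩
      apply Int.cast_injective (α := ℝ)
      rw [latticePairing_cast, h]) rfl
  refine ⟨⟨P.map A.lattice.subtype, N.map A.lattice.subtype, ?_, ?_, ?_, ?_⟩⟩
  · rw [← Submodule.map_sup, hPN.sup_eq_top, Submodule.map_subtype_top]
  · rw [disjoint_iff, ← Submodule.map_inf _ A.lattice.injective_subtype, hPN.inf_eq_bot,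
      Submodule.map_bot]
  · rintro _ ⟨u, hu, rfl⟩ _ ⟨v, hv, rfl⟩
    have := hP u hu v hv
    rw [Submodule.subtype_apply, Submodule.subtype_apply, ← latticePairing_cast, this,
      Int.cast_zero]
  · rintro _ ⟨u, hu, rfl⟩ _ ⟨v, hv, rfl⟩
    have := hN u hu v hv
    rw [Submodule.subtype_apply, Submodule.subtype_apply, ← latticePairing_cast, this,
      Int.cast_zero]

end PPAV

namespace LagrangianDecomposition

variable {V : Type*} [NormedAddCommGroup V] [NormedSpace ℂ V] [FiniteDimensional ℂ V]
  {A : PPAV V} (D : LagrangianDecomposition A)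

theorem plus_le : D.plus ≤ A.lattice := D.sup_eq ▸ le_sup_left

theorem minus_le : D.minus ≤ A.lattice := D.sup_eq ▸ le_sup_right

/-- The pairing of `Λ₋` with `Λ₊`. -/
noncomputable def pairing : D.minus →ₗ[ℤ] D.plus →ₗ[ℤ] ℤ :=
  A.latticePairing.compl₁₂ (Submodule.inclusion D.minus_le) (Submodule.inclusion D.plus_le)

theorem pairing_cast (m : D.minus) (p : D.plus) : (D.pairing m p : ℝ) = A.E m p :=
  A.latticePairing_cast _ _

theorem pairing_injective : Function.Injective D.pairing := by
  rw [← LinearMap.ker_eq_bot, LinearMap.ker_eq_bot']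
  intro m hm
  apply Subtype.ext
  refine A.eq_zero_of_E_lattice_eq_zero fun w hw => ?_
  rw [← D.sup_eq] at hw
  obtain ⟨p, hp, n, hn, rfl⟩ := Submodule.mem_sup.1 hw
  rw [map_add, D.isotropic_minus _ m.2 _ hn, add_zero, ← D.pairing_cast m ⟨p, hp⟩, hm]
  simp

/-- The lattice as the direct sum of `Λ₊` and `Λ₋`. -/
noncomputable def prodEquiv : (D.plus × D.minus) ≃ₗ[ℤ] A.lattice :=
  LinearEquiv.ofBijective
    ((Submodule.inclusion D.plus_le).coprod (Submodule.inclusion D.minus_le)) (by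
      constructor
      · rw [← LinearMap.ker_eq_bot, LinearMap.ker_eq_bot']
        rintro ⟨p, m⟩ h
        have h1 : (p : V) + m = 0 := congrArg Subtype.val h
        have h2 : (p : V) = 0 := Submodule.disjoint_def.1 D.disjoint p p.2 (by
          rw [eq_neg_of_add_eq_zero_left h1]; exact D.minus.neg_mem m.2)
        rw [h2, zero_add] at h1
        exact Prod.ext (Subtype.ext h2) (Subtype.ext h1)
      · rintro ⟨w, hw⟩
        have hw' := hw
        rw [← D.sup_eq] at hw'
        obtain ⟨p, hp, m, hm, rfl⟩ := Submodule.mem_sup.1 hw'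
        exact ⟨(⟨p, hp⟩, ⟨m, hm⟩), rfl⟩)

theorem prodEquiv_apply_coe (p : D.plus) (m : D.minus) :
    (D.prodEquiv (p, m) : V) = p + m := rfl

theorem pairing_surjective : Function.Surjective D.pairing := by
  intro f
  -- the functional `f` is extended to the lattice by zero on `Λ₋`
  obtain ⟨u, hu, h⟩ := A.unimodular ((f.comp (LinearMap.fst ℤ D.plus D.minus)).comp
    D.prodEquiv.symm.toLinearMap)
  rw [← D.sup_eq] at hu
  obtain ⟨p, hp, m, hm, rfl⟩ := Submodule.mem_sup.1 hu
  refine ⟨⟨m, hm⟩, LinearMap.ext fun q => Int.cast_injective (α := ℝ) ?_⟩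
  have h1 := h (D.prodEquiv (q, 0))
  rw [prodEquiv_apply_coe, Submodule.coe_zero, add_zero, map_add, LinearMap.add_apply] at h1
  simp only [LinearMap.comp_apply, LinearEquiv.coe_coe,
    LinearEquiv.symm_apply_apply, LinearMap.fst_apply, D.isotropic_plus _ hp _ q.2,
    zero_add] at h1
  rw [pairing_cast, ← h1]

/-- The perfect pairing of `Λ₋` with `Λ₊`. -/
noncomputable def pairingEquiv : D.minus ≃ₗ[ℤ] Module.Dual ℤ D.plus :=
  LinearEquiv.ofBijective D.pairing ⟨D.pairing_injective, D.pairing_surjective⟩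

theorem nonempty_adaptedBasis : Nonempty D.AdaptedBasis := by
  classical
  have := A.discrete
  have : DiscreteTopology D.plus := DiscreteTopology.of_subset A.discrete D.plus_le
  have : DiscreteTopology D.minus := DiscreteTopology.of_subset A.discrete D.minus_le
  have : IsZLattice ℝ A.lattice := ⟨A.span_lattice⟩
  have hrank : finrank ℤ D.plus = finrank ℂ V := by
    have h1 := D.prodEquiv.finrank_eq
    rw [finrank_prod, ZLattice.rank ℝ A.lattice, finrank_real_of_complex] at h1
    have h2 : finrank ℤ D.minus = finrank ℤ (D.plus →ₗ[ℤ] ℤ) := D.pairingEquiv.finrank_eq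
    rw [Module.finrank_linearMap_self] at h2
    omega
  let a := Module.finBasisOfFinrankEq ℤ D.plus hrank
  let b := a.dualBasis.map D.pairingEquiv.symm
  refine ⟨⟨fun i => a i, fun i => b i, ?_, ?_, fun i j => ?_⟩⟩
  · have h := congrArg (Submodule.map D.plus.subtype) a.span_eq
    rw [Submodule.map_span, ← Set.range_comp, Submodule.map_subtype_top] at h
    exact h
  · have h := congrArg (Submodule.map D.minus.subtype) b.span_eq
    rw [Submodule.map_span, ← Set.range_comp, Submodule.map_subtype_top] at h
    exact h
  · rw [← pairing_cast]
    have h : D.pairing (b i) = a.dualBasis i := D.pairingEquiv.apply_symm_apply _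
    rw [h, Module.Basis.dualBasis_apply_self]
    by_cases hij : i = j
    · simp [hij]
    · simp [hij, Ne.symm hij]

end LagrangianDecomposition

/-! ### Coordinates attached to an adapted basis -/

namespace LagrangianDecomposition.AdaptedBasis

variable {V : Type*} [NormedAddCommGroup V] [NormedSpace ℂ V] [FiniteDimensional ℂ V]
  {A : PPAV V} {D : LagrangianDecomposition A} (B : D.AdaptedBasis)

theorem b_mem (i : Fin (finrank ℂ V)) : B.b i ∈ D.minus := by
  rw [← B.span_b]; exact Submodule.subset_span ⟨i, rfl⟩

theorem E_a_a (i j : Fin (finrank ℂ V)) : A.E (B.a i) (B.a j) = 0 :=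
  D.isotropic_plus _ (B.a_mem i) _ (B.a_mem j)

theorem E_b_b (i j : Fin (finrank ℂ V)) : A.E (B.b i) (B.b j) = 0 :=
  D.isotropic_minus _ (B.b_mem i) _ (B.b_mem j)

/-- The real coordinates `x` along `V₊`: `v = ∑ x_i a_i + ∑ y_i b_i`. -/
noncomputable def x (v : V) : Fin (finrank ℂ V) → ℝ := fun j => A.E (B.b j) v

theorem x_add (v w : V) : B.x (v + w) = B.x v + B.x w := funext fun _ => map_add _ _ _

theorem x_sub (v w : V) : B.x (v - w) = B.x v - B.x w := funext fun _ => map_sub _ _ _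

theorem x_smul (c : ℝ) (v : V) : B.x (c • v) = c • B.x v := funext fun _ => map_smul _ _ _

theorem y_add (v w : V) : B.y (v + w) = B.y v + B.y w :=
  funext fun j => by simp [y]

theorem y_sub (v w : V) : B.y (v - w) = B.y v - B.y w :=
  funext fun j => by simp [y]

theorem y_smul (c : ℝ) (v : V) : B.y (c • v) = c • B.y v :=
  funext fun j => by simp [y]

theorem x_a (i : Fin (finrank ℂ V)) : B.x (B.a i) = Pi.single i 1 := by
  funext j
  rw [x, B.dual, Pi.single_apply]

theorem y_a (i : Fin (finrank ℂ V)) : B.y (B.a i) = 0 := funext fun j => B.E_a_a i j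

theorem x_b (i : Fin (finrank ℂ V)) : B.x (B.b i) = 0 := funext fun j => B.E_b_b j i

theorem y_b (i : Fin (finrank ℂ V)) : B.y (B.b i) = Pi.single i 1 := by
  funext j
  rw [y, B.dual, Pi.single_apply]
  simp only [eq_comm]

/-- The coordinate expansion as an endomorphism of `V`, which is the identity. -/
noncomputable def expand : V →ₗ[ℝ] V where
  toFun v := ∑ i, B.x v i • B.a i + ∑ i, B.y v i • B.b i
  map_add' v w := by
    simp only [x_add, y_add, Pi.add_apply, add_smul, Finset.sum_add_distrib]
    abel
  map_smul' c v := by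
    simp only [x_smul, y_smul, Pi.smul_apply, smul_assoc, ← Finset.smul_sum, ← smul_add,
      RingHom.id_apply]

theorem expand_a (i : Fin (finrank ℂ V)) : B.expand (B.a i) = B.a i := by
  change ∑ j, B.x (B.a i) j • B.a j + ∑ j, B.y (B.a i) j • B.b j = B.a i
  simp [x_a, y_a, Pi.single_apply]

theorem expand_b (i : Fin (finrank ℂ V)) : B.expand (B.b i) = B.b i := by
  change ∑ j, B.x (B.b i) j • B.a j + ∑ j, B.y (B.b i) j • B.b j = B.b i
  simp [x_b, y_b, Pi.single_apply]

theorem sum_x_add_sum_y (v : V) : ∑ i, B.x v i • B.a i + ∑ i, B.y v i • B.b i = v := by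
  let S : Submodule ℝ V := LinearMap.eqLocus B.expand LinearMap.id
  have hp : D.plus ≤ S.restrictScalars ℤ := by
    rw [← B.span_a, Submodule.span_le]
    rintro _ ⟨i, rfl⟩
    exact B.expand_a i
  have hm : D.minus ≤ S.restrictScalars ℤ := by
    rw [← B.span_b, Submodule.span_le]
    rintro _ ⟨i, rfl⟩
    exact B.expand_b i
  have hl : A.lattice ≤ S.restrictScalars ℤ := D.sup_eq ▸ sup_le hp hm
  have htop : Submodule.span ℝ (A.lattice : Set V) ≤ S := Submodule.span_le.2 hl
  exact htop (A.span_lattice ▸ Submodule.mem_top : v ∈ Submodule.span ℝ (A.lattice : Set V))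

theorem ext_coord {v w : V} (hx : B.x v = B.x w) (hy : B.y v = B.y w) : v = w := by
  rw [← B.sum_x_add_sum_y v, ← B.sum_x_add_sum_y w, hx, hy]

theorem x_sum_a (r : Fin (finrank ℂ V) → ℝ) : B.x (∑ i, r i • B.a i) = r := by
  funext j
  simp [x, B.dual]

theorem y_sum_a (r : Fin (finrank ℂ V) → ℝ) : B.y (∑ i, r i • B.a i) = 0 := by
  funext j
  simp [y, B.E_a_a]

theorem x_sum_b (r : Fin (finrank ℂ V) → ℝ) : B.x (∑ i, r i • B.b i) = 0 := by
  funext j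
  simp [x, B.E_b_b]

theorem y_sum_b (r : Fin (finrank ℂ V) → ℝ) : B.y (∑ i, r i • B.b i) = r := by
  funext j
  simp [y, B.dual]

theorem E_eq (v w : V) : A.E v w = ∑ j, (B.y v j * B.x w j - B.x v j * B.y w j) := by
  conv_lhs => rw [← B.sum_x_add_sum_y w]
  simp only [map_add, map_sum, map_smul, smul_eq_mul]
  rw [← Finset.sum_add_distrib]
  refine Finset.sum_congr rfl fun j _ => ?_
  rw [A.E_skew v (B.b j)]
  simp only [x, y]
  ring

theorem mem_Vplus_iff {v : V} : v ∈ D.Vplus ↔ B.y v = 0 := by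
  constructor
  · intro hv
    have hle : D.Vplus ≤ LinearMap.ker (LinearMap.pi fun j => A.E.flip (B.a j)) := by
      refine Submodule.span_le.2 fun p hp => ?_
      rw [SetLike.mem_coe, LinearMap.mem_ker]
      funext j
      exact D.isotropic_plus _ hp _ (B.a_mem j)
    exact hle hv
  · intro h
    rw [← B.sum_x_add_sum_y v, h]
    simp only [Pi.zero_apply, zero_smul, Finset.sum_const_zero, add_zero]
    exact D.Vplus.sum_mem fun i _ => D.Vplus.smul_mem _ (Submodule.subset_span (B.a_mem i))

theorem mem_Vminus_iff {v : V} : v ∈ D.Vminus ↔ B.x v = 0 := by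
  constructor
  · intro hv
    have hle : D.Vminus ≤ LinearMap.ker (LinearMap.pi fun j => A.E (B.b j)) := by
      refine Submodule.span_le.2 fun p hp => ?_
      rw [SetLike.mem_coe, LinearMap.mem_ker]
      funext j
      exact D.isotropic_minus _ (B.b_mem j) _ hp
    exact hle hv
  · intro h
    rw [← B.sum_x_add_sum_y v, h]
    simp only [Pi.zero_apply, zero_smul, Finset.sum_const_zero, zero_add]
    exact D.Vminus.sum_mem fun i _ => D.Vminus.smul_mem _ (Submodule.subset_span (B.b_mem i))

theorem sum_int_b_mem (n : Fin (finrank ℂ V) → ℤ) : ∑ i, (n i : ℝ) • B.b i ∈ D.minus :=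
  D.minus.sum_mem fun i _ => by
    rw [Int.cast_smul_eq_zsmul]; exact D.minus.smul_mem _ (B.b_mem i)

theorem exists_y_eq_intCast {v : V} (hv : v ∈ A.lattice) : ∃ n : Fin (finrank ℂ V) → ℤ,
    B.y v = fun i => (n i : ℝ) := by
  choose n hn using fun j => A.integral v hv _ (D.plus_le (B.a_mem j))
  exact ⟨n, funext hn⟩

theorem x_eq_zero_of_mem_minus {m : V} (hm : m ∈ D.minus) : B.x m = 0 :=
  B.mem_Vminus_iff.1 (Submodule.subset_span hm)

theorem mem_minus_of_coord {v : V} {n : Fin (finrank ℂ V) → ℤ} (hx : B.x v = 0)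
    (hy : B.y v = fun i => (n i : ℝ)) : v ∈ D.minus := by
  have h : v = ∑ i, (n i : ℝ) • B.b i := B.ext_coord
    (by rw [hx, B.x_sum_b fun i => (n i : ℝ)]) (by rw [hy, B.y_sum_b fun i => (n i : ℝ)])
  rw [h]
  exact B.sum_int_b_mem n

/-! ### The period matrix -/

theorem z_add (v w : V) : B.z (v + w) = B.z v + B.z w := funext fun i => by simp [z]

theorem z_smul (c : ℂ) (v : V) : B.z (c • v) = c • B.z v := funext fun i => by simp [z]

theorem z_a (i : Fin (finrank ℂ V)) : B.z (B.a i) = Pi.single i 1 := by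
  have h : B.complexBasis i = B.a i := by simp [complexBasis]
  funext j
  rw [z, ← h, Basis.repr_self, Finsupp.single_eq_pi_single]

theorem z_b (i : Fin (finrank ℂ V)) : B.z (B.b i) = fun j => B.period j i := rfl

theorem sum_z (v : V) : ∑ i, B.z v i • B.a i = v := by
  have h : ∀ i, B.complexBasis i = B.a i := by simp [complexBasis]
  conv_rhs => rw [← B.complexBasis.sum_repr v]
  simp only [h]
  rfl

/-- The complex coordinates as a linear equivalence. -/
noncomputable def zEquiv : V ≃ₗ[ℂ] (Fin (finrank ℂ V) → ℂ) := B.complexBasis.equivFun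

theorem zEquiv_apply (v : V) : B.zEquiv v = B.z v := rfl

theorem z_real_smul (c : ℝ) (v : V) : B.z (c • v) = (c : ℂ) • B.z v := by
  rw [← Complex.coe_smul, B.z_smul]

theorem z_sum {κ : Type*} (s : Finset κ) (f : κ → V) : B.z (∑ i ∈ s, f i) = ∑ i ∈ s, B.z (f i) :=
  map_sum B.zEquiv f s

theorem z_eq (v : V) (i : Fin (finrank ℂ V)) :
    B.z v i = B.x v i + ∑ j, B.period i j * B.y v j := by
  conv_lhs => rw [← B.sum_x_add_sum_y v]
  simp only [z_add, z_sum, z_real_smul, z_a, z_b, Pi.add_apply, Finset.sum_apply, Pi.smul_apply,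
    Pi.single_apply, smul_eq_mul, mul_ite, mul_one, mul_zero, Finset.sum_ite_eq,
    Finset.mem_univ, if_true]
  congr 1
  exact Finset.sum_congr rfl fun j _ => mul_comm _ _

theorem I_smul_eq (r : Fin (finrank ℂ V) → ℝ) :
    I • ∑ i, (∑ j, (B.period i j).im * r j) • B.a i =
      ∑ j, r j • B.b j - ∑ i, (∑ j, (B.period i j).re * r j) • B.a i := by
  rw [eq_sub_iff_add_eq, ← B.sum_z (∑ j, r j • B.b j), Finset.smul_sum, ← Finset.sum_add_distrib]
  refine Finset.sum_congr rfl fun i _ => ?_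
  rw [B.z_eq, B.x_sum_b, B.y_sum_b, Pi.zero_apply, ofReal_zero, zero_add, ← Complex.coe_smul,
    ← Complex.coe_smul, smul_smul, ← add_smul]
  congr 1
  push_cast
  rw [Finset.mul_sum, ← Finset.sum_add_distrib]
  refine Finset.sum_congr rfl fun j _ => ?_
  conv_rhs => rw [← re_add_im (B.period i j)]
  ring

theorem E_I_smul_eq (r s : Fin (finrank ℂ V) → ℝ) :
    A.E (I • ∑ i, (∑ j, (B.period i j).im * r j) • B.a i)
      (∑ i, (∑ j, (B.period i j).im * s j) • B.a i) =
        ∑ i, r i * ∑ j, (B.period i j).im * s j := by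
  rw [I_smul_eq, map_sub, LinearMap.sub_apply, B.E_sum_a, sub_zero, B.E_eq]
  simp [B.x_sum_a, B.y_sum_b, B.x_sum_b, B.y_sum_a]

theorem im_period_symm (i j : Fin (finrank ℂ V)) :
    (B.period i j).im = (B.period j i).im := by
  have h := A.E_I_symm (∑ p, (∑ q, (B.period p q).im * (Pi.single i 1 : _ → ℝ) q) • B.a p)
    (∑ p, (∑ q, (B.period p q).im * (Pi.single j 1 : _ → ℝ) q) • B.a p)
  rw [B.E_I_smul_eq, B.E_I_smul_eq] at h
  simpa [Pi.single_apply] using h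

theorem re_period_symm (i j : Fin (finrank ℂ V)) :
    (B.period i j).re = (B.period j i).re := by
  have h := A.invariant (∑ p, (∑ q, (B.period p q).im * (Pi.single i 1 : _ → ℝ) q) • B.a p)
    (∑ p, (∑ q, (B.period p q).im * (Pi.single j 1 : _ → ℝ) q) • B.a p)
  rw [B.E_sum_a, B.I_smul_eq, B.I_smul_eq, B.E_eq] at h
  simp only [x_sub, y_sub, B.x_sum_a, B.y_sum_a, B.x_sum_b, B.y_sum_b] at h
  simp [Pi.single_apply] at h
  linarith

theorem period_isSymm : B.period.IsSymm :=
  Matrix.IsSymm.ext fun i j => Complex.ext (B.re_period_symm j i) (B.im_period_symm j i)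

theorem period_im_posDef : (B.period.map Complex.im).PosDef := by
  refine Matrix.PosDef.of_dotProduct_mulVec_pos ?_ fun r hr => ?_
  · exact Matrix.IsHermitian.ext fun i j => by simpa using B.im_period_symm j i
  · have h := B.E_I_smul_eq r r
    have h1 := A.positive (∑ i, (∑ j, (B.period i j).im * r j) • B.a i) fun h0 => by
      have h2 := B.I_smul_eq r
      rw [h0, smul_zero] at h2
      have h3 := congrArg B.y h2
      rw [B.y_sub, B.y_sum_b, B.y_sum_a, sub_zero] at h3
      exact hr (h3.symm.trans (funext fun j => by simp [y]))
    rw [h] at h1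
    simpa [dotProduct, Matrix.mulVec] using h1

end LagrangianDecomposition.AdaptedBasis

namespace LagrangianDecomposition

variable {V : Type*} [NormedAddCommGroup V] [NormedSpace ℂ V] [FiniteDimensional ℂ V]
  {A : PPAV V} (D : LagrangianDecomposition A)

theorem mkQ_mem_Tplus_iff (B : D.AdaptedBasis) {v : V} :
    A.lattice.mkQ v ∈ D.Tplus ↔ ∃ n : Fin (finrank ℂ V) → ℤ, B.y v = fun i => (n i : ℝ) := by
  constructor
  · rintro ⟨w, hw, hwv⟩
    have h : v - w ∈ A.lattice := by
      rw [← Submodule.ker_mkQ A.lattice, LinearMap.mem_ker, map_sub, hwv, sub_self]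
    obtain ⟨n, hn⟩ := B.exists_y_eq_intCast h
    refine ⟨n, ?_⟩
    rw [← hn, B.y_sub, B.mem_Vplus_iff.1 hw, sub_zero]
  · rintro ⟨n, hn⟩
    refine ⟨v - ∑ i, (n i : ℝ) • B.b i, ?_, ?_⟩
    · change _ ∈ D.Vplus
      rw [B.mem_Vplus_iff, B.y_sub, B.y_sum_b fun i => (n i : ℝ), hn, sub_self]
    · rw [map_sub, sub_eq_self, ← LinearMap.mem_ker, Submodule.ker_mkQ]
      exact D.minus_le (B.sum_int_b_mem n)

theorem isCompl_Tplus_Tminus : IsCompl D.Tplus D.Tminus := by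
  obtain ⟨B⟩ := D.nonempty_adaptedBasis
  constructor
  · rw [Submodule.disjoint_def]
    rintro _ hp ⟨w, hw, rfl⟩
    obtain ⟨n, hn⟩ := (D.mkQ_mem_Tplus_iff B).1 hp
    rw [← LinearMap.mem_ker, Submodule.ker_mkQ]
    exact D.minus_le (B.mem_minus_of_coord (B.mem_Vminus_iff.1 hw) hn)
  · rw [codisjoint_iff, eq_top_iff]
    rintro t -
    obtain ⟨v, rfl⟩ := A.lattice.mkQ_surjective t
    rw [← B.sum_x_add_sum_y v, map_add]
    refine Submodule.add_mem_sup (Submodule.mem_map_of_mem ?_) (Submodule.mem_map_of_mem ?_)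
    · exact B.mem_Vplus_iff.2 (B.y_sum_a _)
    · exact B.mem_Vminus_iff.2 (B.x_sum_b _)

end LagrangianDecomposition

/-! ### Holomorphic sections as theta functions -/

section Phase

/-- The phase `exp (k π i r)` of the automorphy factors of `L ^ k`. -/
noncomputable def phase (k : ℕ) (r : ℝ) : ℂ := exp (Real.pi * I * k * (r : ℂ))

theorem phase_add (k : ℕ) (r s : ℝ) : phase k (r + s) = phase k r * phase k s := by
  rw [phase, phase, phase, ← Complex.exp_add]
  push_cast
  ring_nf

theorem phase_zero (k : ℕ) : phase k 0 = 1 := by simp [phase]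

theorem phase_ne_zero (k : ℕ) (r : ℝ) : phase k r ≠ 0 := exp_ne_zero _

theorem phase_neg_mul_self (k : ℕ) (r : ℝ) : phase k (-r) * phase k r = 1 := by
  rw [← phase_add, neg_add_cancel, phase_zero]

theorem phase_eq_phase_neg_iff (k : ℕ) (r : ℝ) :
    phase k r = phase k (-r) ↔ ∃ n : ℤ, k * r = n := by
  have h1 : phase k r = phase k (-r) ↔ phase k (r + r) = 1 := by
    constructor
    · intro h
      rw [phase_add]
      nth_rw 1 [h]
      exact phase_neg_mul_self k r
    · intro h
      rw [← mul_left_inj' (phase_ne_zero k r), phase_neg_mul_self, ← phase_add, h]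
  rw [h1, phase, Complex.exp_eq_one_iff]
  refine exists_congr fun n => ?_
  rw [show (Real.pi * I * k * ((r + r : ℝ) : ℂ) : ℂ) = ((k * r : ℝ) : ℂ) * (2 * Real.pi * I) by
    push_cast; ring, mul_left_inj' (by simp [Real.pi_ne_zero])]
  exact_mod_cast Iff.rfl

end Phase

namespace LagrangianDecomposition

variable {V : Type*} [NormedAddCommGroup V] [NormedSpace ℂ V] [FiniteDimensional ℂ V]
  {A : PPAV V} {D : LagrangianDecomposition A}

theorem isSection_iff_phase {k : ℕ} {s : V → ℂ} : D.IsSection k s ↔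
    ∀ v, ∀ p ∈ D.plus, ∀ m ∈ D.minus,
      s (v + (p + m)) = phase k (A.E p m + A.E v (p + m)) * s v := Iff.rfl

theorem IsSection.add_plus {k : ℕ} {s : V → ℂ} (hs : D.IsSection k s) (v : V) {p : V}
    (hp : p ∈ D.plus) : s (v + p) = phase k (A.E v p) * s v := by
  have h := isSection_iff_phase.1 hs v p hp 0 D.minus.zero_mem
  simpa using h

theorem IsSection.add_minus {k : ℕ} {s : V → ℂ} (hs : D.IsSection k s) (v : V) {m : V}
    (hm : m ∈ D.minus) : s (v + m) = phase k (A.E v m) * s v := by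
  have h := isSection_iff_phase.1 hs v 0 D.plus.zero_mem m hm
  simpa using h

theorem isSection_of_add {k : ℕ} {s : V → ℂ}
    (hplus : ∀ p ∈ D.plus, ∀ v, s (v + p) = phase k (A.E v p) * s v)
    (hminus : ∀ m ∈ D.minus, ∀ v, s (v + m) = phase k (A.E v m) * s v) : D.IsSection k s := by
  rw [isSection_iff_phase]
  intro v p hp m hm
  rw [← add_assoc, hminus m hm, hplus p hp, ← mul_assoc, ← phase_add, map_add, map_add,
    LinearMap.add_apply]
  congr 2
  ring

/-- On an isotropic sublattice the automorphy relation follows from the one on generators. -/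
theorem _root_.PPAV.add_eq_phase_mul_of_span {k : ℕ} {s : V → ℂ} {L : Submodule ℤ V}
    (hL : ∀ u ∈ L, ∀ v ∈ L, A.E u v = 0) {ι : Type*} {a : ι → V}
    (ha : Submodule.span ℤ (Set.range a) = L)
    (h : ∀ i v, s (v + a i) = phase k (A.E v (a i)) * s v) :
    ∀ p ∈ L, ∀ v, s (v + p) = phase k (A.E v p) * s v := by
  let S : AddSubgroup V :=
    { carrier := {p | p ∈ L ∧ ∀ v, s (v + p) = phase k (A.E v p) * s v}
      zero_mem' := ⟨L.zero_mem, fun v => by simp [phase_zero]⟩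
      add_mem' := by
        rintro p q ⟨hp, hp'⟩ ⟨hq, hq'⟩
        refine ⟨L.add_mem hp hq, fun v => ?_⟩
        rw [← add_assoc, hq', hp', ← mul_assoc, ← phase_add, map_add (A.E v), map_add A.E,
          LinearMap.add_apply, hL p hp q hq, add_zero, add_comm]
      neg_mem' := by
        rintro p ⟨hp, hp'⟩
        refine ⟨L.neg_mem hp, fun v => ?_⟩
        have h1 := hp' (v + -p)
        rw [neg_add_cancel_right] at h1
        rw [h1, ← mul_assoc, ← phase_add, map_neg, map_add, LinearMap.add_apply, map_neg,
          LinearMap.neg_apply, A.alternating, neg_zero, add_zero, neg_add_cancel, phase_zero,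
          one_mul] }
  have hle : Submodule.span ℤ (Set.range a) ≤ AddSubgroup.toIntSubmodule S := by
    rw [Submodule.span_le]
    rintro _ ⟨i, rfl⟩
    exact ⟨ha ▸ Submodule.subset_span ⟨i, rfl⟩, h i⟩
  intro p hp
  rw [← ha] at hp
  exact (hle hp).2

namespace AdaptedBasis

variable (B : D.AdaptedBasis)

theorem isSection_iff {k : ℕ} {s : V → ℂ} : D.IsSection k s ↔
    (∀ i v, s (v + B.a i) = phase k (A.E v (B.a i)) * s v) ∧
      ∀ i v, s (v + B.b i) = phase k (A.E v (B.b i)) * s v :=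
  ⟨fun hs => ⟨fun i v => hs.add_plus v (B.a_mem i), fun i v => hs.add_minus v (B.b_mem i)⟩,
    fun h => isSection_of_add
      (A.add_eq_phase_mul_of_span D.isotropic_plus B.span_a h.1)
      (A.add_eq_phase_mul_of_span D.isotropic_minus B.span_b h.2)⟩

/-- The pairing `y(v) · z(w)`: for every `v` it is the complex linear form in `w` which extends the
real linear form `E(v, w)` on `V₊`. -/
noncomputable def yz (v w : V) : ℂ := ∑ j, (B.y v j : ℂ) * B.z w j

theorem yz_add_left (u v w : V) : B.yz (u + v) w = B.yz u w + B.yz v w := by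
  simp [yz, y_add, add_mul, Finset.sum_add_distrib]

theorem yz_add_right (u v w : V) : B.yz u (v + w) = B.yz u v + B.yz u w := by
  simp [yz, z_add, mul_add, Finset.sum_add_distrib]

theorem yz_smul_left (c : ℝ) (v w : V) : B.yz (c • v) w = c * B.yz v w := by
  simp [yz, y_smul, mul_assoc, Finset.mul_sum]

theorem yz_smul_right (c : ℂ) (v w : V) : B.yz v (c • w) = c * B.yz v w := by
  simp only [yz, z_smul, Finset.mul_sum, Pi.smul_apply, smul_eq_mul]
  exact Finset.sum_congr rfl fun j _ => by ring

theorem yz_real_smul_right (c : ℝ) (v w : V) : B.yz v (c • w) = c * B.yz v w := by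
  rw [← Complex.coe_smul, B.yz_smul_right]

theorem yz_a (v : V) (j : Fin (finrank ℂ V)) : B.yz v (B.a j) = B.y v j := by
  simp [yz, z_a, Pi.single_apply]

theorem yz_b_left (v : V) (j : Fin (finrank ℂ V)) : B.yz (B.b j) v = B.z v j := by
  rw [yz, y_b, Finset.sum_eq_single j]
  · simp
  · intro i _ hi
    simp [hi]
  · simp

/-- The symmetry of the period matrix makes `E` the antisymmetrization of `y(v) · z(w)`. -/
theorem E_eq_yz_sub (v w : V) : (A.E v w : ℂ) = B.yz v w - B.yz w v := by
  have hS : ∑ j, ∑ i, (B.y v j : ℂ) * (B.period j i * B.y w i) =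
      ∑ j, ∑ i, (B.y w j : ℂ) * (B.period j i * B.y v i) := by
    rw [Finset.sum_comm]
    refine Finset.sum_congr rfl fun i _ => Finset.sum_congr rfl fun j _ => ?_
    rw [B.period_isSymm.apply]
    ring
  simp only [yz, z_eq, mul_add, Finset.mul_sum, Finset.sum_add_distrib]
  rw [hS, add_sub_add_right_eq_sub, B.E_eq, ← Finset.sum_sub_distrib]
  push_cast
  exact Finset.sum_congr rfl fun j _ => by ring

theorem toSection_eq (k : ℕ) (F : (Fin (finrank ℂ V) → ℂ) → ℂ) (v : V) :
    B.toSection k F v = exp (Real.pi * I * k * B.yz v v) * F (B.z v) := rfl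

theorem toSection_zero_iff {k : ℕ} {F : (Fin (finrank ℂ V) → ℂ) → ℂ} {v : V} :
    B.toSection k F v = 0 ↔ F (B.z v) = 0 := by
  rw [toSection_eq, mul_eq_zero, or_iff_right (exp_ne_zero _)]

theorem exists_z_eq (u : Fin (finrank ℂ V) → ℂ) : ∃ v, B.z v = u :=
  ⟨B.zEquiv.symm u, B.zEquiv.apply_symm_apply u⟩

/-- Every function on `V` is given by a function of `z` in the holomorphic frame. -/
theorem exists_toSection_eq (k : ℕ) (s : V → ℂ) : ∃ F, B.toSection k F = s := by
  refine ⟨fun u => exp (-(Real.pi * I * k * B.yz (B.zEquiv.symm u) (B.zEquiv.symm u))) *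
    s (B.zEquiv.symm u), funext fun v => ?_⟩
  rw [toSection_eq, ← zEquiv_apply, B.zEquiv.symm_apply_apply, ← mul_assoc, ← Complex.exp_add,
    add_neg_cancel, Complex.exp_zero, one_mul]

theorem isSection_toSection_iff (k : ℕ) (F : (Fin (finrank ℂ V) → ℂ) → ℂ) :
    D.IsSection k (B.toSection k F) ↔
      (∀ z j, F (z + Pi.single j 1) = F z) ∧
        ∀ z j, F (z + fun i => B.period i j) =
          exp (-(2 * Real.pi * I * k * z j) - Real.pi * I * k * B.period j j) * F z := by
  have ha : ∀ i v, B.toSection k F (v + B.a i) = phase k (A.E v (B.a i)) * B.toSection k F v ↔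
      F (B.z v + Pi.single i 1) = F (B.z v) := by
    intro i v
    have h1 : B.yz (v + B.a i) (v + B.a i) = B.yz v v + B.y v i := by
      rw [yz_add_right, yz_a, yz_add_left, y_add, y_a]
      simp [yz, y_a]
    rw [toSection_eq, toSection_eq, h1, z_add, z_a, phase, ← mul_assoc, ← Complex.exp_add, mul_add,
      add_comm (Real.pi * I * k * B.yz v v)]
    exact mul_right_inj' (exp_ne_zero _)
  have hb : ∀ i v, B.toSection k F (v + B.b i) = phase k (A.E v (B.b i)) * B.toSection k F v ↔
      F (B.z v + fun j => B.period j i) =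
        exp (-(2 * Real.pi * I * k * B.z v i) - Real.pi * I * k * B.period i i) * F (B.z v) := by
    intro i v
    have h1 : B.yz (v + B.b i) (v + B.b i) =
        B.yz v v + B.yz v (B.b i) + B.z v i + B.period i i := by
      rw [yz_add_right, yz_add_left, yz_add_left, yz_b_left, yz_b_left, z_b]
      ring
    rw [toSection_eq, toSection_eq, h1, z_add, z_b, phase, B.E_eq_yz_sub, yz_b_left, ← mul_assoc,
      ← Complex.exp_add]
    rw [show Real.pi * I * k * (B.yz v (B.b i) - B.z v i) + Real.pi * I * k * B.yz v v =
      Real.pi * I * k * (B.yz v v + B.yz v (B.b i) + B.z v i + B.period i i) +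
        (-(2 * Real.pi * I * k * B.z v i) - Real.pi * I * k * B.period i i) by ring,
      Complex.exp_add _ (-(2 * Real.pi * I * k * B.z v i) - Real.pi * I * k * B.period i i),
      mul_assoc (exp _) (exp _)]
    exact mul_right_inj' (exp_ne_zero _)
  rw [B.isSection_iff]
  simp only [ha, hb]
  constructor
  · rintro ⟨h1, h2⟩
    refine ⟨fun u j => ?_, fun u j => ?_⟩ <;> obtain ⟨v, rfl⟩ := B.exists_z_eq u
    · exact h1 j v
    · exact h2 j v
  · exact fun h => ⟨fun i v => h.1 _ i, fun i v => h.2 _ i⟩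

/-- The complex coordinates as a continuous linear equivalence. -/
noncomputable def zCLE : V ≃L[ℂ] (Fin (finrank ℂ V) → ℂ) := B.zEquiv.toContinuousLinearEquiv

theorem zCLE_apply (v : V) : B.zCLE v = B.z v := rfl

theorem contDiff_z : ContDiff ℝ ∞ B.z :=
  (B.zCLE.toContinuousLinearMap.restrictScalars ℝ).contDiff

theorem contDiff_yz : ContDiff ℝ ∞ fun v => B.yz v v := by
  refine ContDiff.sum fun j _ => ContDiff.mul ?_ (contDiff_pi.1 B.contDiff_z j)
  exact ofRealCLM.contDiff.comp (LinearMap.toContinuousLinearMap (A.E.flip (B.a j))).contDiff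

theorem contDiff_toSection_iff {k : ℕ} {F : (Fin (finrank ℂ V) → ℂ) → ℂ} :
    ContDiff ℝ ∞ (B.toSection k F) ↔ ContDiff ℝ ∞ F := by
  have hframe : ContDiff ℝ ∞ fun v => exp (Real.pi * I * k * B.yz v v) :=
    (contDiff_const.mul B.contDiff_yz).cexp
  constructor
  · intro h
    have h1 : F = fun u => exp (-(Real.pi * I * k * B.yz (B.zCLE.symm u) (B.zCLE.symm u))) *
        B.toSection k F (B.zCLE.symm u) := by
      funext u
      rw [toSection_eq, ← zCLE_apply, B.zCLE.apply_symm_apply, ← mul_assoc, ← Complex.exp_add,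
        neg_add_cancel, Complex.exp_zero, one_mul]
    have hz : ContDiff ℝ ∞ B.zCLE.symm :=
      (B.zCLE.symm.toContinuousLinearMap.restrictScalars ℝ).contDiff
    rw [h1]
    exact ((contDiff_const.mul B.contDiff_yz).neg.cexp.comp hz).mul (h.comp hz)
  · intro h
    exact hframe.mul (h.comp B.contDiff_z)

/-- The covariant derivative in the holomorphic frame. -/
theorem covDeriv_toSection (k : ℕ) {F : (Fin (finrank ℂ V) → ℂ) → ℂ} (hF : Differentiable ℝ F)
    (v w : V) : A.covDeriv k (B.toSection k F) v w = exp (Real.pi * I * k * B.yz v v) *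
      (fderiv ℝ F (B.z v) (B.z w) + 2 * Real.pi * I * k * B.yz v w * F (B.z v)) := by
  have hs : DifferentiableAt ℝ (B.toSection k F) v := by
    have h1 : Differentiable ℝ fun v => exp (Real.pi * I * k * B.yz v v) :=
      (contDiff_const.mul B.contDiff_yz).cexp.differentiable (by simp)
    exact (h1.mul (hF.comp (B.contDiff_z.differentiable (by simp)))) v
  have h1 : HasLineDerivAt ℝ (B.toSection k F) (fderiv ℝ (B.toSection k F) v w) v w :=
    hs.hasFDerivAt.hasLineDerivAt w
  have h2 : HasLineDerivAt ℝ (B.toSection k F) (exp (Real.pi * I * k * B.yz v v) *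
      (Real.pi * I * k * (B.yz v w + B.yz w v) * F (B.z v) +
        fderiv ℝ F (B.z v) (B.z w))) v w := by
    have hline : ∀ τ : ℝ, B.toSection k F (v + τ • w) = exp (Real.pi * I * k *
        (B.yz v v + τ * (B.yz v w + B.yz w v) + τ ^ 2 * B.yz w w)) * F (B.z v + τ • B.z w) := by
      intro τ
      rw [toSection_eq, z_add, z_real_smul, yz_add_left, yz_add_right, yz_add_right, yz_smul_left,
        yz_smul_left, yz_real_smul_right, yz_real_smul_right, Complex.coe_smul]
      congr 2
      ring
    have hτ : HasDerivAt (fun τ : ℝ => (τ : ℂ)) 1 0 := ofRealCLM.hasDerivAt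
    have hpoly : HasDerivAt (fun τ : ℝ => Real.pi * I * k *
        (B.yz v v + τ * (B.yz v w + B.yz w v) + τ ^ 2 * B.yz w w))
        (Real.pi * I * k * (B.yz v w + B.yz w v)) 0 := by
      have h := (((hτ.mul_const (B.yz v w + B.yz w v)).const_add (B.yz v v)).add
        ((hτ.pow 2).mul_const (B.yz w w))).const_mul (Real.pi * I * k : ℂ)
      simpa using! h
    have hFl : HasDerivAt (fun τ : ℝ => F (B.z v + τ • B.z w)) (fderiv ℝ F (B.z v) (B.z w)) 0 :=
      (hF (B.z v)).hasFDerivAt.hasLineDerivAt (B.z w)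
    have h := hpoly.cexp.mul hFl
    rw [HasLineDerivAt]
    simp only [hline]
    convert! h using 1
    simp
    ring
  have h3 := HasDerivAt.unique h1 h2
  rw [PPAV.covDeriv, h3, PPAV.connForm, B.E_eq_yz_sub, toSection_eq]
  ring

/-- In the holomorphic frame the holomorphic sections of `L ^ k` are the theta functions of
level `k`. -/
theorem toSection_mem_kahlerSpace_iff (k : ℕ) (F : (Fin (finrank ℂ V) → ℂ) → ℂ) :
    B.toSection k F ∈ D.kahlerSpace k ↔ IsThetaFunction B.period k F := by
  -- `∇^{0,1}` is the Cauchy-Riemann operator in this frame: the connection term is complex linear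
  have hCR : ∀ (_ : Differentiable ℝ F) (v w : V), A.covDeriv k (B.toSection k F) v w +
      I * A.covDeriv k (B.toSection k F) v (I • w) = exp (Real.pi * I * k * B.yz v v) *
        (fderiv ℝ F (B.z v) (B.z w) + I * fderiv ℝ F (B.z v) (I • B.z w)) := by
    intro hF v w
    rw [B.covDeriv_toSection k hF, B.covDeriv_toSection k hF, B.yz_smul_right, z_smul]
    linear_combination exp (Real.pi * I * k * B.yz v v) * (2 * Real.pi * I * k * B.yz v w *
      F (B.z v)) * I_mul_I
  constructor
  · rintro ⟨h1, h2, h3⟩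
    have hsm := B.contDiff_toSection_iff.1 h1
    have hF : Differentiable ℝ F := hsm.differentiable (by simp)
    refine ⟨fun u => ?_, (B.isSection_toSection_iff k F).1 h2⟩
    obtain ⟨v, rfl⟩ := B.exists_z_eq u
    have hlin : ∀ u, fderiv ℝ F (B.z v) (I • u) = I * fderiv ℝ F (B.z v) u := by
      intro u
      obtain ⟨w, rfl⟩ := B.exists_z_eq u
      have h := h3 v w
      rw [hCR hF, mul_eq_zero, or_iff_right (exp_ne_zero _)] at h
      linear_combination (-I) * h + fderiv ℝ F (B.z v) (I • B.z w) * I_mul_I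
    rw [differentiableAt_iff_restrictScalars ℝ (hF _)]
    refine ⟨⟨⟨⟨fun u => fderiv ℝ F (B.z v) u, fun u w => map_add _ u w⟩, fun c u => ?_⟩,
      (fderiv ℝ F (B.z v)).continuous⟩, ?_⟩
    · change fderiv ℝ F (B.z v) (c • u) = c • fderiv ℝ F (B.z v) u
      have hc : c • u = c.re • u + c.im • (I • u) := by
        funext i
        simp only [Pi.add_apply, Pi.smul_apply, smul_eq_mul, real_smul]
        conv_lhs => rw [← re_add_im c]
        ring
      rw [hc, map_add, map_smul, map_smul, hlin, real_smul, real_smul, smul_eq_mul]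
      conv_rhs => rw [← re_add_im c]
      ring
    · ext u; rfl
  · rintro ⟨h1, h2⟩
    have hsm : ContDiff ℝ ∞ F := h1.contDiff_of_complex.restrict_scalars ℝ
    refine ⟨B.contDiff_toSection_iff.2 hsm, (B.isSection_toSection_iff k F).2 h2, fun v w => ?_⟩
    have hF : Differentiable ℝ F := hsm.differentiable (by simp)
    rw [hCR hF, (h1 (B.z v)).fderiv_restrictScalars ℝ]
    simp only [ContinuousLinearMap.coe_restrictScalars', map_smul, smul_eq_mul]
    linear_combination exp (Real.pi * I * k * B.yz v v) * fderiv ℂ F (B.z v) (B.z w) * I_mul_I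

end AdaptedBasis

end LagrangianDecomposition

/-! ### Bohr-Sommerfeld fibres and covariantly constant sections -/

namespace LagrangianDecomposition

variable {V : Type*} [NormedAddCommGroup V] [NormedSpace ℂ V] [FiniteDimensional ℂ V]
  {A : PPAV V} {D : LagrangianDecomposition A}

theorem _root_.PPAV.mkQ_eq_zero_iff {v : V} : A.lattice.mkQ v = 0 ↔ v ∈ A.lattice :=
  Submodule.Quotient.mk_eq_zero _

theorem exists_rep_of_mem_Tminus (t : D.Tminus) : ∃ β ∈ D.Vminus, A.lattice.mkQ β = t := t.2

theorem mkQ_mem_fibre_iff (B : D.AdaptedBasis) {t : D.Tminus} {β : V}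
    (hβt : A.lattice.mkQ β = t) {v : V} : A.lattice.mkQ v ∈ D.fibre t ↔
      ∃ n : Fin (finrank ℂ V) → ℤ, B.y (v - β) = fun i => (n i : ℝ) := by
  rw [fibre, ← hβt, ← D.mkQ_mem_Tplus_iff B, map_sub]
  rfl

theorem mkQ_mem_fibre_self {t : D.Tminus} {β : V} (hβt : A.lattice.mkQ β = t) :
    A.lattice.mkQ β ∈ D.fibre t := by
  change A.lattice.mkQ β - t ∈ D.Tplus
  rw [hβt, sub_self]
  exact D.Tplus.zero_mem

theorem mkQ_add_mem_fibre_iff {t : D.Tminus} {v w : V} (hw : A.lattice.mkQ w ∈ D.Tplus) :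
    A.lattice.mkQ (v + w) ∈ D.fibre t ↔ A.lattice.mkQ v ∈ D.fibre t := by
  change A.lattice.mkQ (v + w) - t ∈ D.Tplus ↔ A.lattice.mkQ v - t ∈ D.Tplus
  rw [map_add, add_sub_right_comm]
  exact D.Tplus.add_mem_iff_left hw

theorem mkQ_mem_Tplus_of_mem_Vplus {w : V} (hw : w ∈ D.Vplus) : A.lattice.mkQ w ∈ D.Tplus :=
  Submodule.mem_map_of_mem hw

theorem mkQ_mem_Tplus_of_mem_lattice {w : V} (hw : w ∈ A.lattice) : A.lattice.mkQ w ∈ D.Tplus := by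
  rw [PPAV.mkQ_eq_zero_iff.2 hw]
  exact D.Tplus.zero_mem

/-- The points of order `k` of `T₋` are those for which the coordinates `k y` are integral. -/
theorem nsmul_eq_zero_iff (B : D.AdaptedBasis) (k : ℕ) {t : D.Tminus} {β : V} (hβ : β ∈ D.Vminus)
    (hβt : A.lattice.mkQ β = t) :
    k • t = 0 ↔ ∀ j, ∃ n : ℤ, k * B.y β j = n := by
  have h1 : k • t = 0 ↔ (k : ℝ) • β ∈ A.lattice := by
    rw [← PPAV.mkQ_eq_zero_iff, Nat.cast_smul_eq_nsmul, map_nsmul, hβt]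
    exact Subtype.ext_iff
  rw [h1]
  constructor
  · intro h
    obtain ⟨n, hn⟩ := B.exists_y_eq_intCast h
    exact fun j => ⟨n j, by simpa [B.y_smul] using congrFun hn j⟩
  · intro h
    choose n hn using h
    refine D.minus_le (B.mem_minus_of_coord (n := n) ?_ ?_)
    · rw [B.x_smul, B.mem_Vminus_iff.1 hβ, smul_zero]
    · rw [B.y_smul]
      exact funext hn

/-- Along `V₊` a covariantly constant section is an exponential. -/
theorem apply_add_of_mem_covConst {k : ℕ} {t : D.Tminus} {s : V → ℂ} (hs : s ∈ D.covConst k t)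
    {v w : V} (hv : A.lattice.mkQ v ∈ D.fibre t) (hw : w ∈ D.Vplus) :
    s (v + w) = phase k (-A.E v w) * s v := by
  have hline : ∀ τ : ℝ, HasDerivAt (fun τ : ℝ => s (v + τ • w))
      (-(Real.pi * I * k * (A.E v w : ℂ) * s (v + τ • w))) τ := by
    intro τ
    have hmem : A.lattice.mkQ (v + τ • w) ∈ D.fibre t :=
      (mkQ_add_mem_fibre_iff (mkQ_mem_Tplus_of_mem_Vplus (D.Vplus.smul_mem τ hw))).2 hv
    have h : HasDerivAt (fun ε : ℝ => s (v + τ • w + ε • w))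
        (-(A.connForm k (v + τ • w) w * s (v + τ • w))) 0 := hs.2.2 _ hmem w hw
    have hE : A.E (v + τ • w) w = A.E v w := by
      rw [map_add, LinearMap.add_apply, map_smul, LinearMap.smul_apply, A.alternating, smul_zero,
        add_zero]
    rw [PPAV.connForm, hE] at h
    have h2 := HasDerivAt.scomp (g₁ := fun ε : ℝ => s (v + τ • w + ε • w)) τ
      (by simpa using h) ((hasDerivAt_id τ).sub_const τ)
    simpa [Function.comp_def, sub_smul, add_assoc] using! h2
  have hconst : ∀ τ : ℝ, HasDerivAt (fun τ : ℝ => exp (Real.pi * I * k * (A.E v w : ℂ) * τ) *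
      s (v + τ • w)) 0 τ := by
    intro τ
    have hτ : HasDerivAt (fun τ : ℝ => (τ : ℂ)) 1 τ := ofRealCLM.hasDerivAt
    have h := ((hτ.const_mul (Real.pi * I * k * (A.E v w : ℂ))).cexp).mul (hline τ)
    convert! h using 1
    ring
  have h := is_const_of_deriv_eq_zero (fun τ => (hconst τ).differentiableAt)
    (fun τ => (hconst τ).deriv) 1 0
  simp only [ofReal_one, mul_one, one_smul, ofReal_zero, mul_zero, Complex.exp_zero, one_mul,
    zero_smul, add_zero] at h
  rw [← h, ← mul_assoc]
  change s (v + w) = phase k (-A.E v w) * phase k (A.E v w) * s (v + w)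
  rw [phase_neg_mul_self, one_mul]

/-- A covariantly constant section is determined by its value at one point of `V₋`. -/
theorem apply_eq_of_mem_covConst (B : D.AdaptedBasis) {k : ℕ} {t : D.Tminus} {s : V → ℂ}
    (hs : s ∈ D.covConst k t) {β : V} (hβ : β ∈ D.Vminus) (hβt : A.lattice.mkQ β = t) {v : V}
    (hv : A.lattice.mkQ v ∈ D.fibre t) :
    s v = s β * phase k (-∑ j, B.x v j * B.y v j) := by
  obtain ⟨n, hn⟩ := (mkQ_mem_fibre_iff B hβt).1 hv
  set m := ∑ i, (n i : ℝ) • B.b i with hm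
  have hmem : m ∈ D.minus := B.sum_int_b_mem n
  set w := ∑ i, B.x v i • B.a i with hw
  have hwmem : w ∈ D.Vplus := B.mem_Vplus_iff.2 (B.y_sum_a _)
  have hxβ : B.x β = 0 := B.mem_Vminus_iff.1 hβ
  have hv' : v = β + m + w := by
    refine B.ext_coord ?_ ?_
    · rw [B.x_add, B.x_add, hxβ, hm, B.x_sum_b, hw, B.x_sum_a, zero_add, zero_add]
    · rw [B.y_add, B.y_add, hm, B.y_sum_b fun i => (n i : ℝ), hw, B.y_sum_a, ← hn, B.y_sub,
        add_zero, add_sub_cancel]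
  have hE1 : A.E β m = 0 := by
    rw [B.E_eq, hxβ, B.x_eq_zero_of_mem_minus hmem]
    simp
  have hE2 : A.E (β + m) w = ∑ j, B.x v j * B.y v j := by
    have hy : B.y (β + m) = B.y v := by
      rw [hv', B.y_add _ w, hw, B.y_sum_a, add_zero]
    rw [B.E_eq, hy, hw, B.x_sum_a, B.y_sum_a]
    refine Finset.sum_congr rfl fun j _ => ?_
    rw [Pi.zero_apply, mul_zero, sub_zero, mul_comm]
  have hmem2 : A.lattice.mkQ (β + m) ∈ D.fibre t :=
    (mkQ_add_mem_fibre_iff (mkQ_mem_Tplus_of_mem_lattice (D.minus_le hmem))).2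
      (mkQ_mem_fibre_self hβt)
  conv_lhs => rw [hv']
  rw [apply_add_of_mem_covConst hs hmem2 hwmem, hs.2.1.add_minus β hmem, hE1, phase_zero, one_mul,
    hE2, mul_comm]

open Classical in
/-- The covariantly constant section over the fibre of `t` with value `1` on the preimage of `t`
in `V₋`. -/
noncomputable def flatSection (B : D.AdaptedBasis) (k : ℕ) (t : D.Tminus) (v : V) : ℂ :=
  if A.lattice.mkQ v ∈ D.fibre t then phase k (-∑ j, B.x v j * B.y v j) else 0

theorem flatSection_rep (B : D.AdaptedBasis) (k : ℕ) {t : D.Tminus} {β : V} (hβ : β ∈ D.Vminus)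
    (hβt : A.lattice.mkQ β = t) : flatSection B k t β = 1 := by
  rw [flatSection, if_pos (mkQ_mem_fibre_self hβt), B.mem_Vminus_iff.1 hβ]
  simp [phase_zero]

theorem flatSection_mem_covConst (B : D.AdaptedBasis) {k : ℕ} {t : D.Tminus} (ht : k • t = 0) :
    flatSection B k t ∈ D.covConst k t := by
  obtain ⟨β, hβ, hβt⟩ := exists_rep_of_mem_Tminus t
  have hint := (nsmul_eq_zero_iff B k hβ hβt).1 ht
  refine ⟨fun v hv => if_neg hv, ?_, fun v hv w hw => ?_⟩
  · rw [B.isSection_iff]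
    refine ⟨fun i v => ?_, fun i v => ?_⟩
    · by_cases hv : A.lattice.mkQ v ∈ D.fibre t
      · rw [flatSection, flatSection, if_pos hv, if_pos ((mkQ_add_mem_fibre_iff
          (mkQ_mem_Tplus_of_mem_lattice (D.plus_le (B.a_mem i)))).2 hv)]
        -- the two phases agree because `k y` is integral over the fibre of `t`
        have h1 : ∑ j, B.x (v + B.a i) j * B.y (v + B.a i) j =
            ∑ j, B.x v j * B.y v j + B.y v i := by
          simp [B.x_add, B.y_add, B.x_a, B.y_a, add_mul, Finset.sum_add_distrib, Pi.single_apply]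
        obtain ⟨n, hn⟩ := (mkQ_mem_fibre_iff B hβt).1 hv
        obtain ⟨c, hc⟩ := hint i
        have h2 : phase k (B.y v i) = phase k (-B.y v i) := by
          rw [phase_eq_phase_neg_iff]
          refine ⟨c + k * n i, ?_⟩
          have h3 := congrFun hn i
          rw [B.y_sub, Pi.sub_apply] at h3
          rw [show B.y v i = B.y β i + n i by linarith]
          push_cast
          rw [mul_add, hc]
        rw [h1, neg_add, phase_add, ← h2, mul_comm]
        rfl
      · rw [flatSection, flatSection, if_neg hv, if_neg fun h => hv ((mkQ_add_mem_fibre_iff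
          (mkQ_mem_Tplus_of_mem_lattice (D.plus_le (B.a_mem i)))).1 h), mul_zero]
    · by_cases hv : A.lattice.mkQ v ∈ D.fibre t
      · rw [flatSection, flatSection, if_pos hv, if_pos ((mkQ_add_mem_fibre_iff
          (mkQ_mem_Tplus_of_mem_lattice (D.minus_le (B.b_mem i)))).2 hv), ← phase_add]
        congr 1
        have h1 : ∑ j, B.x (v + B.b i) j * B.y (v + B.b i) j =
            ∑ j, B.x v j * B.y v j + B.x v i := by
          simp [B.x_add, B.y_add, B.x_b, B.y_b, mul_add, Finset.sum_add_distrib, Pi.single_apply]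
        rw [h1, A.E_skew, neg_add, add_comm]
        rfl
      · rw [flatSection, flatSection, if_neg hv, if_neg fun h => hv ((mkQ_add_mem_fibre_iff
          (mkQ_mem_Tplus_of_mem_lattice (D.minus_le (B.b_mem i)))).1 h), mul_zero]
  · have hyw : B.y w = 0 := B.mem_Vplus_iff.1 hw
    have hE : A.E v w = ∑ j, B.x w j * B.y v j := by
      rw [B.E_eq, hyw]
      refine Finset.sum_congr rfl fun j _ => ?_
      rw [Pi.zero_apply, mul_zero, sub_zero, mul_comm]
    have hline : ∀ τ : ℝ, flatSection B k t (v + τ • w) = exp (Real.pi * I * k *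
        ((-∑ j, B.x v j * B.y v j : ℝ) - τ * (A.E v w : ℂ))) := by
      intro τ
      rw [flatSection, if_pos ((mkQ_add_mem_fibre_iff
        (mkQ_mem_Tplus_of_mem_Vplus (D.Vplus.smul_mem τ hw))).2 hv), phase]
      congr 2
      have h1 : ∑ j, B.x (v + τ • w) j * B.y (v + τ • w) j =
          ∑ j, B.x v j * B.y v j + τ * A.E v w := by
        rw [hE, Finset.mul_sum, ← Finset.sum_add_distrib]
        refine Finset.sum_congr rfl fun j _ => ?_
        rw [B.x_add, B.y_add, B.x_smul, B.y_smul, hyw]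
        simp only [Pi.add_apply, Pi.smul_apply, Pi.zero_apply, smul_eq_mul, mul_zero, add_zero]
        ring
      rw [h1]
      push_cast
      ring
    have hτ : HasDerivAt (fun τ : ℝ => (τ : ℂ)) 1 0 := ofRealCLM.hasDerivAt
    have h := (((hτ.mul_const (A.E v w : ℂ)).const_sub
      ((-∑ j, B.x v j * B.y v j : ℝ) : ℂ)).const_mul (Real.pi * I * k : ℂ)).cexp
    rw [HasLineDerivAt]
    simp only [hline]
    convert! h using 1
    have h0 := hline 0
    rw [zero_smul, add_zero] at h0
    rw [h0, PPAV.connForm]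
    ring

theorem mem_bohrSommerfeld_iff (k : ℕ) (t : D.Tminus) : t ∈ D.bohrSommerfeld k ↔ k • t = 0 := by
  obtain ⟨B⟩ := D.nonempty_adaptedBasis
  obtain ⟨β, hβ, hβt⟩ := exists_rep_of_mem_Tminus t
  constructor
  · rintro ⟨s, hs, hne⟩
    rw [nsmul_eq_zero_iff B k hβ hβt]
    intro j
    have hv := mkQ_mem_fibre_self hβt
    -- the holonomy along the loop of direction `a_j` is trivial
    have h1 := apply_add_of_mem_covConst hs hv (Submodule.subset_span (B.a_mem j) :
      B.a j ∈ D.Vplus)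
    rw [hs.2.1.add_plus β (B.a_mem j)] at h1
    exact (phase_eq_phase_neg_iff k _).1 (mul_right_cancel₀ (hne β hv) h1)
  · intro ht
    refine ⟨_, flatSection_mem_covConst B ht, fun v hv => ?_⟩
    rw [flatSection, if_pos hv]
    exact phase_ne_zero _ _

theorem eq_smul_flatSection (B : D.AdaptedBasis) {k : ℕ} {t : D.Tminus} {s : V → ℂ}
    (hs : s ∈ D.covConst k t) {β : V} (hβ : β ∈ D.Vminus) (hβt : A.lattice.mkQ β = t) :
    s = s β • flatSection B k t := by
  funext v
  rw [Pi.smul_apply, smul_eq_mul, flatSection]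
  split_ifs with hv
  · exact apply_eq_of_mem_covConst B hs hβ hβt hv
  · rw [hs.1 v hv, mul_zero]

theorem finrank_covConst {k : ℕ} {t : D.Tminus} (ht : t ∈ D.bohrSommerfeld k) :
    finrank ℂ (D.covConst k t) = 1 := by
  obtain ⟨B⟩ := D.nonempty_adaptedBasis
  obtain ⟨β, hβ, hβt⟩ := exists_rep_of_mem_Tminus t
  have hmem := flatSection_mem_covConst B ((mem_bohrSommerfeld_iff k t).1 ht)
  refine finrank_eq_one (⟨flatSection B k t, hmem⟩ : D.covConst k t) (fun h => ?_) fun s => ?_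
  · have h1 : flatSection B k t = 0 := congrArg Subtype.val h
    have h2 := flatSection_rep B k hβ hβt
    rw [h1] at h2
    exact zero_ne_one h2
  · exact ⟨(s : V → ℂ) β, Subtype.ext (eq_smul_flatSection B s.2 hβ hβt).symm⟩

namespace AdaptedBasis

variable (B : D.AdaptedBasis)

theorem bsVec_eq (k : ℕ) (l : Fin (finrank ℂ V) → ℤ) :
    B.bsVec k l = ∑ j, (-((l j : ℝ) / k)) • B.b j := by
  simp [bsVec]

theorem x_bsVec (k : ℕ) (l : Fin (finrank ℂ V) → ℤ) : B.x (B.bsVec k l) = 0 := by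
  rw [bsVec_eq, B.x_sum_b]

theorem y_bsVec (k : ℕ) (l : Fin (finrank ℂ V) → ℤ) :
    B.y (B.bsVec k l) = fun j => -((l j : ℝ) / k) := by
  rw [bsVec_eq, B.y_sum_b fun j => -((l j : ℝ) / k)]

theorem bsVec_mem (k : ℕ) (l : Fin (finrank ℂ V) → ℤ) : B.bsVec k l ∈ D.Vminus :=
  B.mem_Vminus_iff.2 (B.x_bsVec k l)

theorem mkQ_bsVec (k : ℕ) (l : Fin (finrank ℂ V) → ℤ) :
    A.lattice.mkQ (B.bsVec k l) = B.bsPoint k l := rfl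

theorem bohrSommerfeld_eq_range {k : ℕ} (hk : 1 ≤ k) :
    D.bohrSommerfeld k = Set.range (B.bsPoint k) := by
  have hk' : (k : ℝ) ≠ 0 := by exact_mod_cast (by omega : k ≠ 0)
  ext t
  rw [mem_bohrSommerfeld_iff]
  constructor
  · intro ht
    obtain ⟨β, hβ, hβt⟩ := exists_rep_of_mem_Tminus t
    choose n hn using (nsmul_eq_zero_iff B k hβ hβt).1 ht
    refine ⟨-n, Subtype.ext ?_⟩
    rw [← mkQ_bsVec, ← hβt]
    congr 1
    refine B.ext_coord ?_ ?_
    · rw [x_bsVec, B.mem_Vminus_iff.1 hβ]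
    · rw [y_bsVec]
      funext j
      rw [Pi.neg_apply, Int.cast_neg, ← hn]
      field_simp
  · rintro ⟨l, rfl⟩
    rw [nsmul_eq_zero_iff B k (B.bsVec_mem k l) (B.mkQ_bsVec k l)]
    refine fun j => ⟨-l j, ?_⟩
    rw [y_bsVec]
    push_cast
    field_simp

theorem bsPoint_eq_iff {k : ℕ} (hk : 1 ≤ k) (l l' : Fin (finrank ℂ V) → ℤ) :
    B.bsPoint k l = B.bsPoint k l' ↔ ∀ i, (k : ℤ) ∣ l i - l' i := by
  have hk' : (k : ℝ) ≠ 0 := by exact_mod_cast (by omega : k ≠ 0)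
  have h1 : B.bsPoint k l = B.bsPoint k l' ↔ B.bsVec k l' - B.bsVec k l ∈ A.lattice := by
    rw [← Subtype.coe_inj, ← mkQ_bsVec, ← mkQ_bsVec, ← PPAV.mkQ_eq_zero_iff, map_sub,
      sub_eq_zero, eq_comm]
  have hy : B.y (B.bsVec k l' - B.bsVec k l) = fun i => ((l i - l' i : ℤ) : ℝ) / k := by
    rw [y_sub, y_bsVec, y_bsVec]
    funext i
    rw [Pi.sub_apply]
    push_cast
    ring
  rw [h1]
  constructor
  · intro h i
    obtain ⟨n, hn⟩ := B.exists_y_eq_intCast h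
    rw [hy] at hn
    have h2 := congrFun hn i
    rw [div_eq_iff hk', mul_comm] at h2
    exact ⟨n i, by exact_mod_cast h2⟩
  · intro h
    choose n hn using h
    refine D.minus_le (B.mem_minus_of_coord (n := n) ?_ ?_)
    · rw [x_sub, x_bsVec, x_bsVec, sub_zero]
    · rw [hy]
      funext i
      rw [hn]
      push_cast
      field_simp

theorem bijective_bsPoint_fin {k : ℕ} (hk : 1 ≤ k) : Function.Bijective
    fun r : Fin (finrank ℂ V) → Fin k => (⟨B.bsPoint k fun i => ((r i : ℕ) : ℤ), by
      rw [B.bohrSommerfeld_eq_range hk]; exact ⟨_, rfl⟩⟩ : D.bohrSommerfeld k) := by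
  constructor
  · intro r r' h
    have h1 := (B.bsPoint_eq_iff hk _ _).1 (congrArg Subtype.val h)
    funext i
    have h2 := Int.modEq_iff_dvd.2 (h1 i)
    rw [Int.ModEq, Int.emod_eq_of_lt (by positivity) (by exact_mod_cast (r' i).2),
      Int.emod_eq_of_lt (by positivity) (by exact_mod_cast (r i).2)] at h2
    exact Fin.ext (by exact_mod_cast h2.symm)
  · rintro ⟨t, ht⟩
    rw [B.bohrSommerfeld_eq_range hk] at ht
    obtain ⟨l, rfl⟩ := ht
    have hkz : (0 : ℤ) < k := by exact_mod_cast hk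
    refine ⟨fun i => ⟨(l i % k).toNat, ?_⟩, Subtype.ext ((B.bsPoint_eq_iff hk _ _).2 fun i => ?_)⟩
    · have h1 := Int.emod_lt_of_pos (l i) hkz
      have h2 := Int.emod_nonneg (l i) hkz.ne'
      omega
    · rw [Int.toNat_of_nonneg (Int.emod_nonneg (l i) hkz.ne'), dvd_sub_comm]
      exact Int.dvd_self_sub_emod

end AdaptedBasis

theorem card_bohrSommerfeld {k : ℕ} (hk : 1 ≤ k) :
    Nat.card (D.bohrSommerfeld k) = k ^ finrank ℂ V := by
  obtain ⟨B⟩ := D.nonempty_adaptedBasis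
  rw [← Nat.card_eq_of_bijective _ (B.bijective_bsPoint_fin hk)]
  simp

end LagrangianDecomposition

/-! ### The isomorphism of the two wave spaces -/

namespace LagrangianDecomposition

variable {V : Type*} [NormedAddCommGroup V] [NormedSpace ℂ V] [FiniteDimensional ℂ V]
  {A : PPAV V} {D : LagrangianDecomposition A}

theorem sub_mem_minus {β β' : V} (hβ : β ∈ D.Vminus) (hβ' : β' ∈ D.Vminus)
    (h : A.lattice.mkQ β = A.lattice.mkQ β') : β' - β ∈ D.minus := by
  obtain ⟨B⟩ := D.nonempty_adaptedBasis
  have h1 : β' - β ∈ A.lattice := by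
    rw [← PPAV.mkQ_eq_zero_iff, map_sub, h, sub_self]
  obtain ⟨n, hn⟩ := B.exists_y_eq_intCast h1
  exact B.mem_minus_of_coord (B.mem_Vminus_iff.1 (D.Vminus.sub_mem hβ' hβ)) hn

/-- The value of a section at a representative in `V₋` depends only on the point of `T₋`. -/
theorem IsSection.apply_eq_of_mkQ_eq {k : ℕ} {s : V → ℂ} (hs : D.IsSection k s) {β β' : V}
    (hβ : β ∈ D.Vminus) (hβ' : β' ∈ D.Vminus) (h : A.lattice.mkQ β = A.lattice.mkQ β') :
    s β = s β' := by
  obtain ⟨B⟩ := D.nonempty_adaptedBasis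
  have hm := sub_mem_minus hβ hβ' h
  have hE : A.E β (β' - β) = 0 := by
    rw [B.E_eq, B.mem_Vminus_iff.1 hβ, B.x_eq_zero_of_mem_minus hm]
    simp
  rw [← add_sub_cancel β β', hs.add_minus β hm, hE, phase_zero, one_mul]

namespace AdaptedBasis

variable (B B' : D.AdaptedBasis)

theorem yz_of_mem_Vplus {v w : V} (hw : w ∈ D.Vplus) : B.yz v w = A.E v w := by
  have h : B.yz w v = 0 := by simp [yz, B.mem_Vplus_iff.1 hw]
  rw [B.E_eq_yz_sub, h, sub_zero]

theorem yz_sum_right {κ : Type*} (v : V) (s : Finset κ) (f : κ → V) :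
    B.yz v (∑ i ∈ s, f i) = ∑ i ∈ s, B.yz v (f i) := by
  simp only [yz, z_sum, Finset.sum_apply, Finset.mul_sum]
  exact Finset.sum_comm

/-- The pairing `y(v) · z(w)` does not depend on the adapted basis. -/
theorem yz_eq_yz (v w : V) : B.yz v w = B'.yz v w := by
  conv_rhs => rw [← B.sum_z w, yz_sum_right]
  refine Finset.sum_congr rfl fun j _ => ?_
  rw [yz_smul_right, B'.yz_of_mem_Vplus (Submodule.subset_span (B.a_mem j)), mul_comm]
  rfl

/-- The summand of a theta section of `L ^ k` with index `u ∈ (1 / k) Λ₋`, evaluated at `v`. -/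
noncomputable def thetaSummand (k : ℕ) (v u : V) : ℂ :=
  exp (Real.pi * I * k * (B.yz v v + B.yz u u - 2 * B.yz u v))

theorem thetaSummand_eq (k : ℕ) (v u : V) : B.thetaSummand k v u = B'.thetaSummand k v u := by
  simp only [thetaSummand, B.yz_eq_yz B']

theorem yz_bsVec_left (k : ℕ) (m : Fin (finrank ℂ V) → ℤ) (v : V) :
    B.yz (B.bsVec k m) v = -(1 / k) * ∑ j, (m j : ℂ) * B.z v j := by
  rw [yz, y_bsVec, Finset.mul_sum]
  refine Finset.sum_congr rfl fun j _ => ?_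
  push_cast
  ring

theorem thetaSummand_bsVec {k : ℕ} (hk : 1 ≤ k) (v : V) (m : Fin (finrank ℂ V) → ℤ) :
    B.thetaSummand k v (B.bsVec k m) =
      exp (Real.pi * I * k * B.yz v v) * (thetaWeight B.period k m * multiChar m (B.z v)) := by
  have hk' : (k : ℂ) ≠ 0 := by exact_mod_cast (by omega : k ≠ 0)
  have h1 : B.yz (B.bsVec k m) (B.bsVec k m) =
      1 / k ^ 2 * ∑ i, ∑ j, (m i : ℂ) * B.period i j * (m j : ℂ) := by
    rw [yz_bsVec_left, Finset.mul_sum, Finset.mul_sum]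
    refine Finset.sum_congr rfl fun i _ => ?_
    rw [z_eq, x_bsVec, y_bsVec, Pi.zero_apply, ofReal_zero, zero_add, Finset.mul_sum,
      Finset.mul_sum, Finset.mul_sum]
    refine Finset.sum_congr rfl fun j _ => ?_
    push_cast
    field_simp
  rw [thetaSummand, h1, yz_bsVec_left, thetaWeight, multiChar, ← Complex.exp_add,
    ← Complex.exp_add]
  congr 1
  field_simp
  ring

theorem bsVec_add_nsmul {k : ℕ} (hk : 1 ≤ k) (l n : Fin (finrank ℂ V) → ℤ) :
    B.bsVec k (l + k • n) = B.bsVec k l + -∑ i, (n i : ℝ) • B.b i := by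
  have hk' : (k : ℝ) ≠ 0 := by exact_mod_cast (by omega : k ≠ 0)
  rw [bsVec, bsVec, ← neg_add, ← Finset.sum_add_distrib]
  congr 1
  refine Finset.sum_congr rfl fun i _ => ?_
  rw [← add_smul]
  congr 1
  have h : (l + k • n) i = l i + k * n i := by simp
  rw [h]
  push_cast
  field_simp

theorem bijective_neg_sum_b : Function.Bijective fun n : Fin (finrank ℂ V) → ℤ =>
    (⟨-∑ i, (n i : ℝ) • B.b i, D.minus.neg_mem (B.sum_int_b_mem n)⟩ : D.minus) := by
  constructor
  · intro n n' h
    have h1 := congrArg B.y (neg_injective (congrArg Subtype.val h))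
    rw [B.y_sum_b fun i => (n i : ℝ), B.y_sum_b fun i => (n' i : ℝ)] at h1
    funext i
    exact_mod_cast congrFun h1 i
  · rintro ⟨m, hm⟩
    obtain ⟨n, hn⟩ := B.exists_y_eq_intCast (D.minus_le (D.minus.neg_mem hm))
    refine ⟨n, Subtype.ext ?_⟩
    rw [neg_eq_iff_eq_neg]
    refine B.ext_coord ?_ ?_
    · rw [B.x_sum_b, B.x_eq_zero_of_mem_minus (D.minus.neg_mem hm)]
    · rw [B.y_sum_b fun i => (n i : ℝ), hn]

/-- A theta section as a sum over the coset `β_l + Λ₋`, in terms independent of the basis. -/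
theorem toSection_thetaFun_eq_tsum {k : ℕ} (hk : 1 ≤ k) (l : Fin (finrank ℂ V) → ℤ) (v : V) :
    B.toSection k (thetaFun B.period k l) v =
      ∑' m : D.minus, B.thetaSummand k v (B.bsVec k l + m) := by
  rw [← (Equiv.ofBijective _ B.bijective_neg_sum_b).tsum_eq, toSection_eq, thetaFun,
    ← tsum_mul_left]
  refine tsum_congr fun n => ?_
  rw [Equiv.ofBijective_apply, ← B.bsVec_add_nsmul hk, B.thetaSummand_bsVec hk, thetaTerm_eq]

/-- The theta section with characteristic `l` depends only on the point `t_l` of `T₋`, and not on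
the adapted basis. -/
theorem toSection_thetaFun_congr {k : ℕ} (hk : 1 ≤ k) {l l' : Fin (finrank ℂ V) → ℤ}
    (h : B.bsPoint k l = B'.bsPoint k l') :
    B.toSection k (thetaFun B.period k l) = B'.toSection k (thetaFun B'.period k l') := by
  have hm := sub_mem_minus (B.bsVec_mem k l) (B'.bsVec_mem k l') (congrArg Subtype.val h)
  funext v
  rw [B.toSection_thetaFun_eq_tsum hk, B'.toSection_thetaFun_eq_tsum hk,
    ← (Equiv.addLeft (⟨_, hm⟩ : D.minus)).tsum_eq]
  refine tsum_congr fun m => ?_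
  rw [B.thetaSummand_eq B', Equiv.coe_addLeft, Submodule.coe_add, ← add_assoc, add_sub_cancel]

/-- The holomorphic section of `L ^ k` given by the theta function with characteristic `l`. -/
noncomputable def thetaSection {k : ℕ} (hk : 1 ≤ k) (l : Fin (finrank ℂ V) → ℤ) :
    D.kahlerSpace k :=
  ⟨B.toSection k (thetaFun B.period k l), (B.toSection_mem_kahlerSpace_iff k _).2
    (isThetaFunction_thetaFun B.period_isSymm B.period_im_posDef hk l)⟩

theorem exists_bsPoint_eq {k : ℕ} (hk : 1 ≤ k) (t : D.bohrSommerfeld k) :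
    ∃ l, B.bsPoint k l = t :=
  (B.bohrSommerfeld_eq_range hk).subset t.2

/-- A characteristic `l` of the given Bohr-Sommerfeld point. -/
noncomputable def bsIndex {k : ℕ} (hk : 1 ≤ k) (t : D.bohrSommerfeld k) :
    Fin (finrank ℂ V) → ℤ := (B.exists_bsPoint_eq hk t).choose

theorem bsPoint_bsIndex {k : ℕ} (hk : 1 ≤ k) (t : D.bohrSommerfeld k) :
    B.bsPoint k (B.bsIndex hk t) = t := (B.exists_bsPoint_eq hk t).choose_spec

open Classical in
/-- The map from the Bohr-Sommerfeld wave space to the Kähler wave space which sends a covariantly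
constant section `s` over `t_l` to `s(β_l)` times the theta section with characteristic `l`. -/
noncomputable def waveMap {k : ℕ} (hk : 1 ≤ k) : D.bsSpace k →ₗ[ℂ] D.kahlerSpace k :=
  DirectSum.toModule ℂ (D.bohrSommerfeld k) (D.kahlerSpace k) fun t =>
    ((LinearMap.proj (B.bsVec k (B.bsIndex hk t)) : (V → ℂ) →ₗ[ℂ] ℂ).comp
      (D.covConst k (t : D.Tminus)).subtype).smulRight (B.thetaSection hk (B.bsIndex hk t))

theorem waveMap_bsIncl {k : ℕ} (hk : 1 ≤ k) (t : D.bohrSommerfeld k)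
    (s : D.covConst k (t : D.Tminus)) : B.waveMap hk (D.bsIncl k t s) =
      (s : V → ℂ) (B.bsVec k (B.bsIndex hk t)) • B.thetaSection hk (B.bsIndex hk t) := by
  rw [waveMap, bsIncl, DirectSum.toModule_lof]
  rfl

/-- The same description of the map holds for every other adapted basis. -/
theorem waveMap_bsIncl_coe {k : ℕ} (hk : 1 ≤ k) (t : D.bohrSommerfeld k)
    (s : D.covConst k (t : D.Tminus)) {l : Fin (finrank ℂ V) → ℤ} (hl : B'.bsPoint k l = t) :
    (B.waveMap hk (D.bsIncl k t s) : V → ℂ) =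
      (s : V → ℂ) (B'.bsVec k l) • B'.toSection k (thetaFun B'.period k l) := by
  have h := (B.bsPoint_bsIndex hk t).trans hl.symm
  rw [waveMap_bsIncl, ← B.toSection_thetaFun_congr B' hk h, ← s.2.2.1.apply_eq_of_mkQ_eq
    (B.bsVec_mem k (B.bsIndex hk t)) (B'.bsVec_mem k l) (congrArg Subtype.val h)]
  rfl

theorem finite_bohrSommerfeld (B : D.AdaptedBasis) {k : ℕ} (hk : 1 ≤ k) :
    Finite (D.bohrSommerfeld k) :=
  Finite.of_surjective _ (B.bijective_bsPoint_fin hk).2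

theorem waveMap_surjective {k : ℕ} (hk : 1 ≤ k) : Function.Surjective (B.waveMap hk) := by
  rintro ⟨s, hs⟩
  obtain ⟨F, rfl⟩ := B.exists_toSection_eq k s
  obtain ⟨c, hc⟩ := ((B.toSection_mem_kahlerSpace_iff k F).1 hs).eq_sum B.period_isSymm
    B.period_im_posDef hk
  -- the theta section with characteristic `r` comes from the flat section with value `1` at `β_r`
  have hr : ∀ r : Fin (finrank ℂ V) → Fin k, ∃ q, (B.waveMap hk q : V → ℂ) =
      B.toSection k (thetaFun B.period k fun i => ((r i : ℕ) : ℤ)) := by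
    intro r
    set l : Fin (finrank ℂ V) → ℤ := fun i => ((r i : ℕ) : ℤ) with hl
    have hmem : B.bsPoint k l ∈ D.bohrSommerfeld k := by
      rw [B.bohrSommerfeld_eq_range hk]; exact ⟨l, rfl⟩
    refine ⟨D.bsIncl k ⟨_, hmem⟩ ⟨flatSection B k (B.bsPoint k l),
      flatSection_mem_covConst B ((mem_bohrSommerfeld_iff k _).1 hmem)⟩, ?_⟩
    rw [B.waveMap_bsIncl_coe B hk _ _ rfl]
    change flatSection B k (B.bsPoint k l) (B.bsVec k l) • _ = _
    rw [flatSection_rep B k (t := B.bsPoint k l) (B.bsVec_mem k l) (B.mkQ_bsVec k l), one_smul]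
  choose q hq using hr
  refine ⟨∑ r, c r • q r, Subtype.ext (funext fun v => ?_)⟩
  rw [map_sum, Submodule.coe_sum, Finset.sum_apply]
  change _ = B.toSection k F v
  rw [toSection_eq, hc, Finset.mul_sum]
  refine Finset.sum_congr rfl fun r _ => ?_
  rw [map_smul, Submodule.coe_smul, hq, Pi.smul_apply, smul_eq_mul, toSection_eq]
  ring

theorem waveMap_injective {k : ℕ} (hk : 1 ≤ k) : Function.Injective (B.waveMap hk) := by
  classical
  have := B.finite_bohrSommerfeld hk
  have := Fintype.ofFinite (D.bohrSommerfeld k)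
  refine (injective_iff_map_eq_zero _).2 fun q hq => ?_
  have hθ := fun t : D.bohrSommerfeld k => isThetaFunction_thetaFun B.period_isSymm
    B.period_im_posDef hk (B.bsIndex hk t)
  set c : D.bohrSommerfeld k → ℂ := fun t => (q t : V → ℂ) (B.bsVec k (B.bsIndex hk t)) with hc
  have hsum : q = ∑ t, D.bsIncl k t (q t) := by
    conv_lhs => rw [← DirectSum.sum_univ_of q]
    rfl
  have hF : ∀ u, ∑ t, c t * thetaFun B.period k (B.bsIndex hk t) u = 0 := by
    intro u
    obtain ⟨v, rfl⟩ := B.exists_z_eq u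
    have h1 := congrArg (fun s : D.kahlerSpace k => (s : V → ℂ) v) hq
    rw [hsum, map_sum] at h1
    simp only [Submodule.coe_sum, Finset.sum_apply, waveMap_bsIncl, Submodule.coe_smul,
      Pi.smul_apply, smul_eq_mul, thetaSection, toSection_eq, Submodule.coe_zero,
      Pi.zero_apply] at h1
    refine mul_left_cancel₀ (exp_ne_zero (Real.pi * I * k * B.yz v v)) ?_
    rw [mul_zero, ← h1, Finset.mul_sum]
    exact Finset.sum_congr rfl fun t _ => by ring
  have hc0 : ∀ t, c t = 0 := by
    intro t
    -- the Fourier coefficient of index `l` isolates the characteristic `l`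
    have h1 := entireFourierCoeff_sum_mul Finset.univ c
      (G := fun t => thetaFun B.period k (B.bsIndex hk t)) (fun t => (hθ t).1.continuous)
      (B.bsIndex hk t) 0
    rw [Finset.sum_eq_single t, entireFourierCoeff_thetaFun B.period_im_posDef hk,
      if_pos fun i => by simp] at h1
    · simp only [hF] at h1
      have h2 : entireFourierCoeff (fun _ => (0 : ℂ)) (B.bsIndex hk t) 0 = 0 := by
        simp [entireFourierCoeff]
      rw [h2] at h1
      exact (mul_eq_zero.1 h1.symm).resolve_right (thetaWeight_ne_zero _)
    · intro t' _ ht'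
      rw [entireFourierCoeff_thetaFun B.period_im_posDef hk, if_neg, mul_zero]
      intro hdvd
      have h3 := (B.bsPoint_eq_iff hk _ _).2 hdvd
      rw [bsPoint_bsIndex, bsPoint_bsIndex] at h3
      exact ht' (Subtype.ext h3.symm)
    · simp
  have hq0 : ∀ t, q t = 0 := by
    intro t
    apply Subtype.ext
    rw [eq_smul_flatSection B (q t).2 (B.bsVec_mem k (B.bsIndex hk t))
      (congrArg Subtype.val (B.bsPoint_bsIndex hk t))]
    rw [show (q t : V → ℂ) (B.bsVec k (B.bsIndex hk t)) = 0 from hc0 t, zero_smul]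
    rfl
  rw [hsum]
  exact Finset.sum_eq_zero fun t _ => by rw [hq0, map_zero]

/-- The isomorphism of the Bohr-Sommerfeld and the Kähler wave space. -/
noncomputable def waveEquiv {k : ℕ} (hk : 1 ≤ k) : D.bsSpace k ≃ₗ[ℂ] D.kahlerSpace k :=
  LinearEquiv.ofBijective (B.waveMap hk) ⟨B.waveMap_injective hk, B.waveMap_surjective hk⟩

/-- As a function on `T₊`, a covariantly constant section over `t_l` is a multiple of the character
`l`. -/
theorem fibreFun_bsVec {k : ℕ} (hk : 1 ≤ k) (l : Fin (finrank ℂ V) → ℤ)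
    (s : D.covConst k (B.bsPoint k l)) : B.fibreFun k (B.bsVec k l) (s : V → ℂ) =
      fun x => (s : V → ℂ) (B.bsVec k l) * (torusChar l : (Fin (finrank ℂ V) → ℝ) → ℂ) x := by
  have hk' : (k : ℂ) ≠ 0 := by exact_mod_cast (by omega : k ≠ 0)
  funext x
  have hw : ∑ i, x i • B.a i ∈ D.Vplus := B.mem_Vplus_iff.2 (B.y_sum_a x)
  have hE : A.E (B.bsVec k l) (∑ i, x i • B.a i) = -∑ j, (l j : ℝ) / k * x j := by
    rw [B.E_eq, B.y_bsVec, B.x_sum_a, B.y_sum_a, ← Finset.sum_neg_distrib]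
    exact Finset.sum_congr rfl fun j _ => by rw [Pi.zero_apply]; ring
  rw [fibreFun, apply_add_of_mem_covConst s.2 (mkQ_mem_fibre_self (B.mkQ_bsVec k l)) hw,
    mul_comm (phase _ _), mul_assoc, phase, ← Complex.exp_add, torusChar_apply, multiChar, hE]
  congr 2
  simp only [realVec]
  push_cast
  simp only [neg_neg, mul_neg, Finset.mul_sum]
  rw [← Finset.sum_add_distrib]
  refine Finset.sum_congr rfl fun j _ => ?_
  field_simp
  ring

/-- The product of the function defined by a covariantly constant section with the delta
distribution of level `k` is a multiple of a theta distribution. -/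
theorem levelDelta_fibreFun {k : ℕ} (hk : 1 ≤ k) (l : Fin (finrank ℂ V) → ℤ)
    (s : D.covConst k (B.bsPoint k l)) :
    levelDelta k (B.fibreFun k (B.bsVec k l) (s : V → ℂ)) =
      (s : V → ℂ) (B.bsVec k l) • thetaDist k l := by
  rw [B.fibreFun_bsVec hk, levelDelta_const_mul, thetaDist]

theorem toSection_smul (k : ℕ) (c : ℂ) (F : (Fin (finrank ℂ V) → ℂ) → ℂ) :
    B.toSection k (c • F) = c • B.toSection k F := by
  funext v
  simp only [toSection, Pi.smul_apply, smul_eq_mul]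
  ring

end AdaptedBasis

end LagrangianDecomposition

/-! ### The divisor of the Riemann theta function -/

namespace LagrangianDecomposition.AdaptedBasis

variable {V : Type*} [NormedAddCommGroup V] [NormedSpace ℂ V] [FiniteDimensional ℂ V]
  {A : PPAV V} {D : LagrangianDecomposition A} (B : D.AdaptedBasis)

/-- The section of `L` with divisor `Θ`. -/
noncomputable def riemannSection (v : V) : ℂ := B.toSection 1 (thetaFun B.period 1 0) v

theorem riemannSection_mem : B.riemannSection ∈ D.kahlerSpace 1 := (B.thetaSection le_rfl 0).2

theorem riemannSection_eq_zero_iff {v : V} : B.riemannSection v = 0 ↔ B.riemannTheta v = 0 :=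
  B.toSection_zero_iff

theorem riemannSection_pow (k : ℕ) (v : V) : B.riemannSection v ^ k =
    exp (Real.pi * I * k * B.yz v v) * B.riemannTheta v ^ k := by
  rw [riemannSection, toSection_eq, mul_pow, ← Complex.exp_nat_mul, riemannTheta]
  congr 2
  push_cast
  ring

theorem riemannSection_add_pow (k : ℕ) (v : V) {p m : V} (hp : p ∈ D.plus) (hm : m ∈ D.minus) :
    B.riemannSection (v + (p + m)) ^ k =
      phase k (A.E p m + A.E v (p + m)) * B.riemannSection v ^ k := by
  rw [B.riemannSection_mem.2.1 v p hp m hm, mul_pow, ← Complex.exp_nat_mul, phase]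
  congr 2
  push_cast
  ring

theorem differentiable_z : Differentiable ℂ B.z :=
  B.zCLE.differentiable

/-- The complement of the theta divisor is dense. -/
theorem frequently_riemannTheta_ne_zero (v : V) : ∃ᶠ w in 𝓝 v, B.riemannTheta w ≠ 0 := by
  intro h
  have h1 : ∀ᶠ u in 𝓝 (B.z v), thetaFun B.period 1 0 u = 0 := by
    have h2 : Filter.Tendsto B.zCLE.symm (𝓝 (B.z v)) (𝓝 v) := by
      have := B.zCLE.symm.continuous.tendsto (B.zCLE v)
      rwa [B.zCLE.symm_apply_apply] at this
    filter_upwards [h2.eventually h] with u hu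
    have h3 := not_not.1 hu
    rwa [riemannTheta, ← zCLE_apply, B.zCLE.apply_symm_apply] at h3
  have h0 : thetaFun B.period 1 0 = fun _ => 0 := by
    have hθ := isThetaFunction_thetaFun B.period_isSymm B.period_im_posDef le_rfl 0
    exact funext (hθ.1.eq_zero_of_eventually_eq_zero h1)
  -- an identically vanishing theta function would have vanishing Fourier coefficients
  have h4 := entireFourierCoeff_thetaFun B.period_im_posDef le_rfl 0 0
  rw [if_pos (by simp), h0] at h4
  exact thetaWeight_ne_zero _ (h4.symm.trans (by simp [entireFourierCoeff]))

/-- Functions which agree off the theta divisor near `v` agree at `v` if they are continuous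
there. -/
theorem eq_of_eq_off_divisor {F G : V → ℂ} {v : V} (hF : ContinuousAt F v)
    (hG : ContinuousAt G v) (h : ∀ᶠ w in 𝓝 v, B.riemannTheta w ≠ 0 → F w = G w) : F v = G v :=
  tendsto_nhds_unique_of_frequently_eq hF hG
    (((B.frequently_riemannTheta_ne_zero v).and_eventually h).mono fun _ hw => hw.2 hw.1)

/-- The quotient of a holomorphic section of `L ^ k` by the `k`-th power of the section with
divisor `Θ`. Division by zero gives the value `0` on `Θ`. -/
noncomputable def divideMap {k : ℕ} (hk : 1 ≤ k) : D.kahlerSpace k →ₗ[ℂ] B.divisorSpace k where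
  toFun s := ⟨fun v => (s : V → ℂ) v / B.riemannSection v ^ k, by
    refine ⟨fun v hv => ?_, fun v u hu => ?_, fun v₀ => ?_⟩
    · simp only
      rw [B.riemannSection_eq_zero_iff.2 hv, zero_pow (by omega), div_zero]
    · rw [← D.sup_eq] at hu
      obtain ⟨p, hp, m, hm, rfl⟩ := Submodule.mem_sup.1 hu
      simp only
      rw [B.riemannSection_add_pow k v hp hm, isSection_iff_phase.1 s.2.2.1 v p hp m hm,
        mul_div_mul_left _ _ (phase_ne_zero _ _)]
    · obtain ⟨G, hG⟩ := B.exists_toSection_eq k s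
      have hθ := (B.toSection_mem_kahlerSpace_iff k G).1 (hG ▸ s.2)
      refine ⟨Set.univ, Filter.univ_mem, fun v => G (B.z v),
        (hθ.1.comp B.differentiable_z).differentiableOn, fun v _ hv => ?_⟩
      simp only
      rw [← hG, toSection_eq, riemannSection_pow, mul_div_mul_left _ _ (exp_ne_zero _),
        div_mul_cancel₀ _ (pow_ne_zero k hv)]⟩
  map_add' s t := Subtype.ext (funext fun v => add_div _ _ _)
  map_smul' c s := Subtype.ext (funext fun v => mul_div_assoc _ _ _)

theorem divideMap_mul {k : ℕ} (hk : 1 ≤ k) (s : D.kahlerSpace k) {v : V}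
    (hv : B.riemannTheta v ≠ 0) :
    (B.divideMap hk s : V → ℂ) v * B.riemannSection v ^ k = (s : V → ℂ) v :=
  div_mul_cancel₀ _ (pow_ne_zero k (mt B.riemannSection_eq_zero_iff.1 hv))

theorem divideMap_injective {k : ℕ} (hk : 1 ≤ k) : Function.Injective (B.divideMap hk) := by
  intro s t h
  refine Subtype.ext (funext fun v => ?_)
  refine B.eq_of_eq_off_divisor s.2.1.continuous.continuousAt t.2.1.continuous.continuousAt ?_
  exact Filter.Eventually.of_forall fun w hw => by
    rw [← B.divideMap_mul hk s hw, ← B.divideMap_mul hk t hw, h]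

/-- The product of a function in `H⁰(𝒪(kΘ))` and `ϑ ^ k` extends to an entire function. -/
theorem exists_differentiable_eq_mul {k : ℕ} (f : B.divisorSpace k) : ∃ H : V → ℂ,
    Differentiable ℂ H ∧
      ∀ v, B.riemannTheta v ≠ 0 → H v = (f : V → ℂ) v * B.riemannTheta v ^ k := by
  choose U hU F hF hFf using f.2.2.2
  -- the value at `v` of the local representative at `v` is the value of any nearby representative
  have hcont : ∀ v₀, ∀ᶠ v in 𝓝 v₀, F v v = F v₀ v := by
    intro v₀
    filter_upwards [eventually_mem_nhds_iff.2 (hU v₀)] with v hv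
    refine B.eq_of_eq_off_divisor ((hF v).differentiableAt (hU v)).continuousAt
      ((hF v₀).differentiableAt hv).continuousAt ?_
    filter_upwards [hU v, hv] with w hw hw' hne
    rw [hFf v w hw hne, hFf v₀ w hw' hne]
  exact ⟨fun v => F v v, fun v₀ => ((hF v₀).differentiableAt (hU v₀)).congr_of_eventuallyEq
    (hcont v₀), fun v hv => hFf v v (mem_of_mem_nhds (hU v)) hv⟩

theorem divideMap_surjective {k : ℕ} (hk : 1 ≤ k) : Function.Surjective (B.divideMap hk) := by
  intro f
  obtain ⟨H, hH, hHf⟩ := B.exists_differentiable_eq_mul f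
  set G : (Fin (finrank ℂ V) → ℂ) → ℂ := fun u => H (B.zCLE.symm u) with hGdef
  have hG : Differentiable ℂ G := hH.comp B.zCLE.symm.differentiable
  have hs : ∀ v, B.riemannTheta v ≠ 0 →
      B.toSection k G v = (f : V → ℂ) v * B.riemannSection v ^ k := by
    intro v hv
    rw [toSection_eq, riemannSection_pow, hGdef]
    simp only [← zCLE_apply, B.zCLE.symm_apply_apply]
    rw [hHf v hv]
    ring
  have hcont : Continuous (B.toSection k G) := by
    have h1 : ContDiff ℝ ∞ G := hG.contDiff_of_complex.restrict_scalars ℝ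
    exact (B.contDiff_toSection_iff.2 h1).continuous
  -- both sides of the equivariance relation are continuous and agree off the theta divisor
  have hsec : D.IsSection k (B.toSection k G) := by
    rw [isSection_iff_phase]
    intro v p hp m hm
    have hphase : Continuous fun v => phase k (A.E p m + A.E v (p + m)) := by
      have : Continuous fun v => A.E v (p + m) :=
        (A.E.flip (p + m)).continuous_of_finiteDimensional
      unfold phase
      fun_prop
    refine B.eq_of_eq_off_divisor (F := fun v => B.toSection k G (v + (p + m)))
      (G := fun v => phase k (A.E p m + A.E v (p + m)) * B.toSection k G v)
      (hcont.comp (continuous_id.add continuous_const)).continuousAt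
      (hphase.mul hcont).continuousAt (Filter.Eventually.of_forall fun w hw => ?_)
    have hw' : B.riemannTheta (w + (p + m)) ≠ 0 := by
      rw [Ne, ← B.riemannSection_eq_zero_iff, B.riemannSection_mem.2.1 w p hp m hm]
      exact mul_ne_zero (exp_ne_zero _) (mt B.riemannSection_eq_zero_iff.1 hw)
    have hlat : p + m ∈ A.lattice := by
      rw [← D.sup_eq]
      exact Submodule.add_mem_sup hp hm
    rw [hs w hw, hs _ hw', B.riemannSection_add_pow k w hp hm, f.2.2.1 w _ hlat]
    ring
  refine ⟨⟨B.toSection k G, (B.toSection_mem_kahlerSpace_iff k G).2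
    ⟨hG, (B.isSection_toSection_iff k G).1 hsec⟩⟩, Subtype.ext (funext fun v => ?_)⟩
  by_cases hv : B.riemannTheta v = 0
  · rw [f.2.1 v hv, (B.divideMap hk _).2.1 v hv]
  · refine mul_right_cancel₀ (pow_ne_zero k (mt B.riemannSection_eq_zero_iff.1 hv)) ?_
    rw [B.divideMap_mul hk _ hv]
    exact hs v hv

/-- Multiplication by the `k`-th power of the section with divisor `Θ`, as an isomorphism from
`H⁰(𝒪(kΘ))` to the space of holomorphic sections of `L ^ k`. -/
noncomputable def divisorEquiv {k : ℕ} (hk : 1 ≤ k) : B.divisorSpace k ≃ₗ[ℂ] D.kahlerSpace k :=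
  (LinearEquiv.ofBijective (B.divideMap hk)
    ⟨B.divideMap_injective hk, B.divideMap_surjective hk⟩).symm

theorem divisorEquiv_apply {k : ℕ} (hk : 1 ≤ k) (f : B.divisorSpace k) {v : V}
    (hv : B.riemannTheta v ≠ 0) :
    (B.divisorEquiv hk f : V → ℂ) v = (f : V → ℂ) v * B.riemannSection v ^ k := by
  have h : B.divideMap hk (B.divisorEquiv hk f) = f := (LinearEquiv.ofBijective (B.divideMap hk)
    ⟨B.divideMap_injective hk, B.divideMap_surjective hk⟩).apply_symm_apply f
  rw [← B.divideMap_mul hk _ hv, h]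

end LagrangianDecomposition.AdaptedBasis

/-! ### The comparison theorem -/

/-- A linear isomorphism induces a bijection of projective spaces. -/
theorem exists_projectivization_equiv {E F : Type*} [AddCommGroup E] [Module ℂ E] [AddCommGroup F]
    [Module ℂ F] (Φ : E ≃ₗ[ℂ] F) : ∃ Ψ : ℙ ℂ E ≃ ℙ ℂ F, ∀ (q : E) (hq : q ≠ 0),
      Ψ (Projectivization.mk ℂ q hq) =
        Projectivization.mk ℂ (Φ q) (Φ.map_ne_zero_iff.mpr hq) := by
  refine ⟨⟨Projectivization.map Φ.toLinearMap Φ.injective,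
    Projectivization.map Φ.symm.toLinearMap Φ.symm.injective, fun p => ?_, fun p => ?_⟩,
    fun q hq => rfl⟩
  · induction p using Projectivization.ind with
    | h v hv => simp [Projectivization.map_mk]
  · induction p using Projectivization.ind with
    | h v hv => simp [Projectivization.map_mk]

theorem theorem1 {V : Type*} [NormedAddCommGroup V] [NormedSpace ℂ V] [FiniteDimensional ℂ V]
    (A : PPAV V) :
    -- the torus has real polarizations
    Nonempty (LagrangianDecomposition A) ∧
    ∀ D : LagrangianDecomposition A,
      IsCompl D.Tplus D.Tminus ∧
      Nonempty D.AdaptedBasis ∧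
      ∀ k : ℕ, 1 ≤ k →
        -- the Bohr-Sommerfeld fibres are the fibres over the points of order `k`
        (∀ t : D.Tminus, t ∈ D.bohrSommerfeld k ↔ k • t = 0) ∧
        Nat.card (D.bohrSommerfeld k) = k ^ Module.finrank ℂ V ∧
        (∀ t ∈ D.bohrSommerfeld k, Module.finrank ℂ (D.covConst k t) = 1) ∧
        -- the identification of the two wave spaces and of their projectivizations
        ∃ Φ : D.bsSpace k ≃ₗ[ℂ] D.kahlerSpace k,
          (∃ Ψ : ℙ ℂ (D.bsSpace k) ≃ ℙ ℂ (D.kahlerSpace k),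
            ∀ (q : D.bsSpace k) (hq : q ≠ 0),
              Ψ (Projectivization.mk ℂ q hq) =
                Projectivization.mk ℂ (Φ q) (Φ.map_ne_zero_iff.mpr hq)) ∧
          ∀ B : D.AdaptedBasis,
            B.period.IsSymm ∧ (B.period.map Complex.im).PosDef ∧
            -- holomorphic sections of `L ^ k` as functions with automorphy factors
            (∀ F : (Fin (Module.finrank ℂ V) → ℂ) → ℂ,
              B.toSection k F ∈ D.kahlerSpace k ↔
                Differentiable ℂ F ∧
                (∀ z j, F (z + Pi.single j 1) = F z) ∧
                ∀ z j, F (z + fun i => B.period i j) =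
                  Complex.exp (-(2 * Real.pi * Complex.I * k * z j) -
                    Real.pi * Complex.I * k * B.period j j) * F z) ∧
            -- `L ^ k` is the line bundle of the divisor `kΘ`
            (∃ M : B.divisorSpace k ≃ₗ[ℂ] D.kahlerSpace k,
              ∀ (f : B.divisorSpace k) (v : V), B.riemannTheta v ≠ 0 →
                (M f : V → ℂ) v =
                  (f : V → ℂ) v * B.toSection 1 (thetaFun B.period 1 0) v ^ k) ∧
            -- every Bohr-Sommerfeld fibre is the fibre over some `bsPoint`
            D.bohrSommerfeld k = Set.range (B.bsPoint k) ∧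
            ∀ l : Fin (Module.finrank ℂ V) → ℤ,
              -- the distribution `θ_l^ℝ` is the sum of `exp(2 π i (l + k n) · x)` over all `n`
              IsTorusDistribution (thetaDist k l) ∧
              (∀ n : Fin (Module.finrank ℂ V) → ℤ, torusFourierCoeff (thetaDist k l) n =
                if ∀ i, (k : ℤ) ∣ n i - l i then 1 else 0) ∧
              -- its coherent state transform is the theta function `θ_l`
              (∀ z, Summable (cstTerm B.period (1 / k) (thetaDist k l) z)) ∧
              (∀ z, Summable (thetaTerm B.period k l z)) ∧
              coherentStateTransform B.period (1 / k) (thetaDist k l) = thetaFun B.period k l ∧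
              -- a covariantly constant section `s` over a Bohr-Sommerfeld fibre defines a delta
              -- distribution, and its image under `Φ` is the transform of this distribution
              ∀ (ht : B.bsPoint k l ∈ D.bohrSommerfeld k) (s : D.covConst k (B.bsPoint k l)),
                levelDelta k (B.fibreFun k (B.bsVec k l) (s : V → ℂ)) =
                  (s : V → ℂ) (B.bsVec k l) • thetaDist k l ∧
                (Φ (D.bsIncl k ⟨B.bsPoint k l, ht⟩ s) : V → ℂ) =
                  B.toSection k (coherentStateTransform B.period (1 / k)
                    (levelDelta k (B.fibreFun k (B.bsVec k l) (s : V → ℂ)))) ∧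
                (Φ (D.bsIncl k ⟨B.bsPoint k l, ht⟩ s) : V → ℂ) =
                  (s : V → ℂ) (B.bsVec k l) • B.toSection k (thetaFun B.period k l) := by
  refine ⟨A.nonempty_lagrangianDecomposition, fun D => ⟨D.isCompl_Tplus_Tminus,
    D.nonempty_adaptedBasis, fun k hk => ?_⟩⟩
  obtain ⟨B₀⟩ := D.nonempty_adaptedBasis
  refine ⟨LagrangianDecomposition.mem_bohrSommerfeld_iff k,
    LagrangianDecomposition.card_bohrSommerfeld hk,
    fun t ht => LagrangianDecomposition.finrank_covConst ht,
    B₀.waveEquiv hk, exists_projectivization_equiv _, fun B => ⟨B.period_isSymm,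
    B.period_im_posDef, B.toSection_mem_kahlerSpace_iff k, ⟨B.divisorEquiv hk,
    fun f v hv => B.divisorEquiv_apply hk f hv⟩, B.bohrSommerfeld_eq_range hk, fun l => ?_⟩⟩
  refine ⟨isTorusDistribution_thetaDist hk l, fun n => ?_,
    summable_cstTerm B.period_im_posDef hk l, summable_thetaTerm B.period_im_posDef hk l,
    coherentStateTransform_thetaDist hk l, fun ht s => ?_⟩
  · rw [torusFourierCoeff_thetaDist hk l n]
  · have h := B₀.waveMap_bsIncl_coe B hk ⟨_, ht⟩ s rfl
    refine ⟨B.levelDelta_fibreFun hk l s, ?_, h⟩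
    rw [B.levelDelta_fibreFun hk, coherentStateTransform_smul, coherentStateTransform_thetaDist hk,
      B.toSection_smul]
    exact h
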